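/- **The model.** Let $\lambda_+,\lambda_->0$ with $\lambda_++\lambda_-=1$ and $p\in(0,1)$. Let $\Omega=\{-1,1\}^{\mathbf Z}$ with the product topology and product $\sigma$-algebra, and let $\mathrm{Ber}_p$ be the product Bernoulli measure on $\Omega$ with $\mathrm{Ber}_p(\sigma(x)=1)=p$. On a probability space $(\varOmega,\mathbf P)$ let $(N_x(t))_{t\ge 0}$, $x\in\mathbf Z$, be i.i.d. Poisson processes of rate one, and let $U_{x,k}$, $x\in\mathbf Z$, $k\ge1$, be i.i.d. uniform on $[0,1]$ and independent of the Poisson processes. Put $\Sigma=\Omega\times\varOmega$ with $\mathbf P_{\mathrm{Ber}_p}=\mathrm{Ber}_p\times\mathbf P$, write $\sigma_0$ for the first coordinate, and let $\mathcal F_t$ be the $\sigma$-algebra generated by $\sigma_0$, by $N_x(s)$ for $s\le t$, and by $U_{x,k}$ for $k\le N_x(t_-)$. For $L\in\mathbf N$ let $\sigma^L_t$ be the process on $\Omega$ started from $\sigma_0$, in which the sites $x<-L$ are frozen and which is updated as follows. At the $k$-th arrival of $N_y$, $y\ge -L$, at time $t$, the spin at $y$ is exchanged with the first spin of opposite sign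 to its right if $\sigma^L_{t-}(y)=+1$ and $U_{y,k}<\lambda_+$, or if $\sigma^L_{t-}(y)=-1$ and $U_{y,k}>\lambda_+$; otherwise nothing happens. Let $N_{y,+}$ and $N_{y,-}$ be the thinnings of $N_y$ that count the arrivals with $U_{y,k}\le\lambda_+$ and with $U_{y,k}>\lambda_+$ respectively. For $\eta=\pm1$ and an interval $I\subset\mathbf Z$ write $\chi^\eta_I(\sigma)=1$ if $\sigma(z)=\eta$ for all $z\in I$, and $\chi^\eta_I(\sigma)=0$ otherwise. **Proposition.** $\mathbf P_{\mathrm{Ber}_p}$-almost surely, $\sigma^L$ converges as $L\to\infty$ to a càdlàg process $(\sigma_t)_{t\ge0}$ in $\Omega$: for every $T\ge0$ and $x\in\mathbf Z$, for all large $L$ one has $\sigma^L_t(x)=\sigma_t(x)$ for all $t\in[0,T]$. The limiting process has the following properties. 1. $(\sigma_t)$ is a stationary, time-homogeneous Markov process with respect to $(\mathcal F_t)$ (to which it is adapted up to null sets), with invariant distribution $\mathrm{Ber}_p$. That is, the law of $(\sigma_{s+t})_{t\ge0}$ does not depend on $s$, $\sigma_t$ has law $\mathrm{Ber}_p$ for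 every $t$, and there are Markov kernels $\kappa_t$ on $\Omega$, each leaving $\mathrm{Ber}_p$ invariant, such that $\mathbf P_{\mathrm{Ber}_p}(\sigma_{s+t}\in A\mid\mathcal F_s)=\kappa_t(\sigma_s,A)$ a.s. for all $s,t\ge0$ and all measurable $A\subset\Omega$. 2. $\mathbf P_{\mathrm{Ber}_p}$-almost surely, for all $x\in\mathbf Z$ and all $0\le t_1<t_2$, the right-hand side of the following equation is absolutely summable and $$\sigma_{t_2}(x)-\sigma_{t_1}(x)=\sum_{\eta=\pm1}2\eta\left[\ \sum_{y<x}\int_{(t_1,t_2]}\chi^\eta_{[y,x-1]}(\sigma_{t-})\,\chi^{-\eta}_{\{x\}}(\sigma_{t-})\,dN_{y,\eta}(t)\;-\;\int_{(t_1,t_2]}\chi^{\eta}_{\{x\}}(\sigma_{t-})\,dN_{x,\eta}(t)\right].$$ -/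

import Mathlib

open MeasureTheory ProbabilityTheory Filter Topology
open scoped NNReal ENNReal

noncomputable section

namespace ToomInterface

/-- Spin configurations on `ℤ`, with spins in `{-1, 1}`. -/
abbrev Config : Type := ℤ → ℤˣ

/-- The product Bernoulli measure with `P(σ(x) = 1) = p` for every site `x`. -/
def productBernoulli (p : unitInterval) : Measure Config :=
  Measure.infinitePi fun _ : ℤ => bernoulliMeasure (1 : ℤˣ) (-1) p

/-! ### The driving noise -/

/-- `N` is a Poisson process of rate one, with nondecreasing right-continuous paths. -/
structure IsRateOnePoisson {𝒪 : Type*} [MeasurableSpace 𝒪] (P : Measure 𝒪)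
    (N : ℝ≥0 → 𝒪 → ℕ) : Prop where
  measurable : ∀ t, Measurable (N t)
  zero : ∀ ω, N 0 ω = 0
  mono : ∀ ω, Monotone fun t => N t ω
  rightCont : ∀ ω t, ContinuousWithinAt (fun s => N s ω) (Set.Ici t) t
  indepIncrements : HasIndepIncrements N P
  law : ∀ s t, s ≤ t → P.map (fun ω => N t ω - N s ω) = poissonMeasure (t - s)

/-- The processes `N x`, `x ∈ ℤ`, are i.i.d. Poisson processes of rate one, the variables `U x k`
are i.i.d. uniform on `[0, 1]`, and the two families are independent of each other. -/
structure IsDrivingNoise {𝒪 : Type*} [MeasurableSpace 𝒪] (P : Measure 𝒪)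
    (N : ℤ → ℝ≥0 → 𝒪 → ℕ) (U : ℤ → ℕ → 𝒪 → ℝ) : Prop where
  poisson : ∀ x, IsRateOnePoisson P (N x)
  measurable_U : ∀ x k, Measurable (U x k)
  uniform : ∀ x k, P.map (U x k) = (volume : Measure ℝ).restrict (Set.Icc 0 1)
  indep_N : iIndepFun (fun x ω t => N x t ω) P
  indep_U : iIndepFun (fun (i : ℤ × ℕ) ω => U i.1 i.2 ω) P
  indep_N_U : IndepFun (fun ω (x : ℤ) (t : ℝ≥0) => N x t ω) (fun ω (x : ℤ) (k : ℕ) => U x k ω) P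

/-- `k ≤ N(t-)` for a counting path `n` and `k ≥ 1`. -/
def ArrivedBefore (n : ℝ≥0 → ℕ) (k : ℕ) (t : ℝ≥0) : Prop := ∃ r < t, k ≤ n r

open Classical in
/-- The variable `U_{x,k}` on the event `1 ≤ k ≤ N_x(t-)`, and `0` off this event. -/
def revealedMark {𝒪 : Type*} (N : ℤ → ℝ≥0 → 𝒪 → ℕ) (U : ℤ → ℕ → 𝒪 → ℝ) (x : ℤ) (k : ℕ)
    (t : ℝ≥0) (ω : 𝒪) : ℝ :=
  if 1 ≤ k ∧ ArrivedBefore (fun s => N x s ω) k t then U x k ω else 0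

/-- The `σ`-algebra on `Config × 𝒪` generated by the initial configuration, by `N_x(s)`, `s ≤ t`,
and by `U_{x,k}`, `k ≤ N_x(t-)`. -/
@[reducible]
def noiseSigma {𝒪 : Type*} (N : ℤ → ℝ≥0 → 𝒪 → ℕ) (U : ℤ → ℕ → 𝒪 → ℝ) (t : ℝ≥0) :
    MeasurableSpace (Config × 𝒪) :=
  MeasurableSpace.comap Prod.fst inferInstance
    ⊔ (⨆ (x : ℤ) (s : ℝ≥0) (_ : s ≤ t),
        MeasurableSpace.comap (fun w : Config × 𝒪 => N x s w.2) inferInstance)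
    ⊔ (⨆ (x : ℤ) (k : ℕ),
        MeasurableSpace.comap (fun w : Config × 𝒪 => revealedMark N U x k t w.2) inferInstance)

theorem arrivedBefore_iff {n : ℝ≥0 → ℕ} (hn : Monotone n) (k : ℕ) (t : ℝ≥0) :
    ArrivedBefore n k t ↔ ∃ q : ℚ, Real.toNNReal q < t ∧ k ≤ n (Real.toNNReal q) := by
  constructor
  · rintro ⟨r, hr, hk⟩
    obtain ⟨q, hq1, hq2⟩ := exists_rat_btwn (show (r : ℝ) < t by exact_mod_cast hr)
    have h0 : (0 : ℝ) ≤ q := r.2.trans hq1.le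
    refine ⟨q, ?_, hk.trans (hn ?_)⟩
    · exact (Real.toNNReal_lt_iff_lt_coe h0).2 hq2
    · exact NNReal.coe_le_coe.1 (by rw [Real.coe_toNNReal _ h0]; exact hq1.le)
  · rintro ⟨q, hq, hk⟩
    exact ⟨_, hq, hk⟩

theorem measurableSet_arrivedBefore {Ω : Type*} {m : MeasurableSpace Ω} {N : ℝ≥0 → Ω → ℕ}
    (hN : ∀ ω, Monotone fun t => N t ω) (k : ℕ) (t : ℝ≥0) (hm : ∀ s < t, Measurable[m] (N s)) :
    MeasurableSet[m] {ω | ArrivedBefore (fun s => N s ω) k t} := by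
  have : {ω | ArrivedBefore (fun s => N s ω) k t} =
      ⋃ q : ℚ, ⋃ _ : Real.toNNReal q < t, {ω | k ≤ N (Real.toNNReal q) ω} := by
    ext ω
    simp only [Set.mem_ofPred_eq, Set.mem_iUnion, exists_prop]
    exact arrivedBefore_iff (hN ω) k t
  rw [this]
  refine MeasurableSet.iUnion fun q => MeasurableSet.iUnion fun hq => ?_
  exact hm _ hq (measurableSet_Ici (a := k))

theorem noiseSigma_N_measurable {𝒪 : Type*} (N : ℤ → ℝ≥0 → 𝒪 → ℕ) (U : ℤ → ℕ → 𝒪 → ℝ)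
    (x : ℤ) {s t : ℝ≥0} (hst : s ≤ t) :
    Measurable[noiseSigma N U t] fun w : Config × 𝒪 => N x s w.2 := by
  rw [measurable_iff_comap_le]
  refine le_trans ?_ (le_sup_left.trans' le_sup_right)
  exact le_iSup_of_le x (le_iSup_of_le s (le_iSup_of_le hst le_rfl))

/-- The filtration `F_t`. -/
def noiseFiltration {𝒪 : Type*} [MeasurableSpace 𝒪] {P : Measure 𝒪}
    {N : ℤ → ℝ≥0 → 𝒪 → ℕ} {U : ℤ → ℕ → 𝒪 → ℝ} (h : IsDrivingNoise P N U) :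
    Filtration ℝ≥0 (inferInstance : MeasurableSpace (Config × 𝒪)) where
  seq := noiseSigma N U
  mono' := by
    intro s t hst
    refine sup_le (sup_le ?_ ?_) ?_
    · exact le_sup_left.trans' le_sup_left
    · refine iSup_le fun x => iSup_le fun r => iSup_le fun hr => ?_
      exact (noiseSigma_N_measurable N U x (hr.trans hst)).comap_le
    · refine iSup_le fun x => iSup_le fun k => ?_
      have hA : MeasurableSet[noiseSigma N U t]
          {w : Config × 𝒪 | ArrivedBefore (fun r => N x r w.2) k s} :=
        measurableSet_arrivedBefore (N := fun r (w : Config × 𝒪) => N x r w.2)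
          (fun w => (h.poisson x).mono w.2) k s
          (fun r hr => noiseSigma_N_measurable N U x (hr.le.trans hst))
      have hR : Measurable[noiseSigma N U t]
          fun w : Config × 𝒪 => revealedMark N U x k t w.2 := by
        rw [measurable_iff_comap_le]
        refine le_trans ?_ le_sup_right
        exact le_iSup_of_le x (le_iSup_of_le k (le_refl _))
      have : (fun w : Config × 𝒪 => revealedMark N U x k s w.2) =
          Set.indicator {w : Config × 𝒪 | ArrivedBefore (fun r => N x r w.2) k s}
            (fun w => revealedMark N U x k t w.2) := by
        ext w
        by_cases hw : ArrivedBefore (fun r => N x r w.2) k s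
        · have hw' : ArrivedBefore (fun r => N x r w.2) k t := by
            obtain ⟨r, hr, hk⟩ := hw
            exact ⟨r, hr.trans_le hst, hk⟩
          simp [revealedMark, hw, hw']
        · simp [revealedMark, hw]
      rw [this]
      exact (hR.indicator hA).comap_le
  le' := by
    intro t
    refine sup_le (sup_le ?_ ?_) ?_
    · exact measurable_fst.comap_le
    · refine iSup_le fun x => iSup_le fun r => iSup_le fun _ => ?_
      exact (((h.poisson x).measurable r).comp measurable_snd).comap_le
    · refine iSup_le fun x => iSup_le fun k => Measurable.comap_le ?_
      refine Measurable.comp (g := revealedMark N U x k t) ?_ measurable_snd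
      refine Measurable.ite ?_ (h.measurable_U x k) measurable_const
      exact (MeasurableSet.const _).inter
        (measurableSet_arrivedBefore (h.poisson x).mono k t fun s _ => (h.poisson x).measurable s)

/-! ### The dynamics on half lines, as a function of the noise -/

/-- The time of the `k`-th jump of a counting path, `k ≥ 1`. -/
def jumpTime (n : ℝ≥0 → ℕ) (k : ℕ) : ℝ≥0 := sInf {s | k ≤ n s}

/-- `z` is the first site to the right of `y` whose spin is opposite to the one at `y`. -/
def IsFirstOpposite (σ : Config) (y z : ℤ) : Prop :=
  y < z ∧ σ z = -σ y ∧ ∀ w, y < w → w < z → σ w = σ y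

open Classical in
/-- Exchange the spin at `y` with the first opposite spin to its right. As the two spins are
opposite, both are flipped. (If there is no opposite spin to the right of `y`, then only the spin
at `y` is flipped; the restriction of the rule to `(-∞, R]` is thus autonomous for every `R`.) -/
def exchange (σ : Config) (y : ℤ) : Config :=
  fun x => if x = y ∨ IsFirstOpposite σ y x then -σ x else σ x

open Classical in
/-- The update at an arrival at `y` whose uniform variable has the value `v`. -/
def update (lam : ℝ) (σ : Config) (y : ℤ) (v : ℝ) : Config :=
  if (σ y = 1 ∧ v < lam) ∨ (σ y = -1 ∧ lam < v) then exchange σ y else σ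

open Classical in
/-- The arrivals up to time `t` at the sites of `[-L, R]`, as triples (time, site, number of the
arrival at that site), in chronological order. -/
def arrivals (n : ℤ → ℝ≥0 → ℕ) (L : ℕ) (R : ℤ) (t : ℝ≥0) : List (ℝ≥0 ×ₗ (ℤ ×ₗ ℕ)) :=
  ((Finset.Icc (-(L : ℤ)) R).biUnion fun y =>
    (Finset.Icc 1 (n y t)).image fun k => toLex (jumpTime (n y) k, toLex (y, k))).sort (· ≤ ·)

/-- The configuration at time `t` when all arrivals at the sites of `[-L, R]` are carried out in
their order. -/
def windowState (lam : ℝ) (n : ℤ → ℝ≥0 → ℕ) (u : ℤ → ℕ → ℝ) (σ₀ : Config) (L : ℕ) (R : ℤ)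
    (t : ℝ≥0) : Config :=
  (arrivals n L R t).foldl
    (fun σ e =>
      let y := (ofLex (ofLex e).2).1
      let k := (ofLex (ofLex e).2).2
      update lam σ y (u y k)) σ₀

/-- The process `σ^L` on `[-L, ∞)`, frozen to the left of `-L`. The spin at `x` is not influenced
by arrivals to the right of `x`, hence only the arrivals in `[-L, x]` enter. -/
def halfLineProcess (lam : ℝ) (n : ℤ → ℝ≥0 → ℕ) (u : ℤ → ℕ → ℝ) (σ₀ : Config) (L : ℕ)
    (t : ℝ≥0) : Config :=
  fun x => windowState lam n u σ₀ L x t x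

open Classical in
/-- The pointwise limit of `σ^L` as `L → ∞` (with the value `-1` where there is no limit). -/
def limitProcess (lam : ℝ) (n : ℤ → ℝ≥0 → ℕ) (u : ℤ → ℕ → ℝ) (σ₀ : Config) (t : ℝ≥0) : Config :=
  fun x => if ∀ᶠ L : ℕ in atTop, halfLineProcess lam n u σ₀ L t x = 1 then 1 else -1

/-- `σ^L` on the sample space `Config × 𝒪`. -/
def halfLine {𝒪 : Type*} (lam : ℝ) (N : ℤ → ℝ≥0 → 𝒪 → ℕ) (U : ℤ → ℕ → 𝒪 → ℝ) (L : ℕ)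
    (t : ℝ≥0) (w : Config × 𝒪) : Config :=
  halfLineProcess lam (fun x s => N x s w.2) (fun x k => U x k w.2) w.1 L t

/-- The limiting process `σ_t` on the sample space `Config × 𝒪`. -/
def fullLine {𝒪 : Type*} (lam : ℝ) (N : ℤ → ℝ≥0 → 𝒪 → ℕ) (U : ℤ → ℕ → 𝒪 → ℝ)
    (t : ℝ≥0) (w : Config × 𝒪) : Config :=
  limitProcess lam (fun x s => N x s w.2) (fun x k => U x k w.2) w.1 t

/-! ### Stationary Markov processes -/

/-- `X` is a stationary (time-homogeneous) Markov process with respect to the filtration `F`, with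
invariant distribution `π`. Adaptedness is meant up to null sets. -/
structure IsStationaryMarkov {Ω S : Type*} {m : MeasurableSpace Ω} [MeasurableSpace S]
    (Q : Measure Ω) (F : Filtration ℝ≥0 m) (X : ℝ≥0 → Ω → S) (π : Measure S) : Prop where
  measurable : ∀ t, Measurable (X t)
  adapted : ∀ t, ∃ Y : Ω → S, Measurable[F t] Y ∧ X t =ᵐ[Q] Y
  stationary : ∀ s, Q.map (fun ω t => X (s + t) ω) = Q.map (fun ω t => X t ω)
  law : ∀ t, Q.map (X t) = π
  markov : ∃ κ : ℝ≥0 → Kernel S S, ∀ t, IsMarkovKernel (κ t) ∧ Kernel.Invariant (κ t) π ∧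
    ∀ s A, MeasurableSet A →
      Q⟦X (s + t) ⁻¹' A | F s⟧ =ᵐ[Q] fun ω => (κ t (X s ω)).real A

/-! ### The stochastic differential equation -/

/-- An arrival with uniform variable `v` is counted by `N_{y,η}`: `v ≤ λ₊` for `η = 1` and
`v > λ₊` for `η = -1`. -/
def HasMark (lam : ℝ) (η : ℤˣ) (v : ℝ) : Prop := (η = 1 ∧ v ≤ lam) ∨ (η = -1 ∧ lam < v)

open Classical in
/-- `∫_{(t₁, t₂]} g dN_{y,η}`, where `N_{y,η}` is the thinning of the counting path `n` by the marks
`u`: the jumps of `n` in `(t₁, t₂]` are those with number in `(n(t₁), n(t₂)]`. -/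
def thinnedIntegral (lam : ℝ) (n : ℝ≥0 → ℕ) (u : ℕ → ℝ) (η : ℤˣ) (g : ℝ≥0 → ℝ) (t₁ t₂ : ℝ≥0) :
    ℝ :=
  ∑ j ∈ Finset.Ioc (n t₁) (n t₂), if HasMark lam η (u j) then g (jumpTime n j) else 0

open Classical in
/-- The indicator `χ^η_{[a,b]}` that all spins in `[a, b]` are equal to `η`. -/
def chi (η : ℤˣ) (a b : ℤ) (σ : Config) : ℝ := if ∀ z, a ≤ z → z ≤ b → σ z = η then 1 else 0

/-- `∫_{(t₁, t₂]} χ^η_{[y,x-1]}(σ_{t-}) χ^{-η}_x(σ_{t-}) dN_{y,η}(t)`, for `y < x`. -/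
def gainTerm (lam : ℝ) (n : ℤ → ℝ≥0 → ℕ) (u : ℤ → ℕ → ℝ) (σ : ℝ≥0 → Config) (x : ℤ)
    (t₁ t₂ : ℝ≥0) (η : ℤˣ) (y : ℤ) : ℝ :=
  thinnedIntegral lam (n y) (u y) η
    (fun t => chi η y (x - 1) (Function.leftLim σ t) * chi (-η) x x (Function.leftLim σ t)) t₁ t₂

/-- `∫_{(t₁, t₂]} χ^η_x(σ_{t-}) dN_{x,η}(t)`. -/
def lossTerm (lam : ℝ) (n : ℤ → ℝ≥0 → ℕ) (u : ℤ → ℕ → ℝ) (σ : ℝ≥0 → Config) (x : ℤ)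
    (t₁ t₂ : ℝ≥0) (η : ℤˣ) : ℝ :=
  thinnedIntegral lam (n x) (u x) η (fun t => chi η x x (Function.leftLim σ t)) t₁ t₂

/-- The path `σ` satisfies the infinite-range equation: for all `x` and `t₁ < t₂` the right-hand
side is absolutely summable and equal to the increment of the spin at `x`. -/
def SatisfiesSDE (lam : ℝ) (n : ℤ → ℝ≥0 → ℕ) (u : ℤ → ℕ → ℝ) (σ : ℝ≥0 → Config) : Prop :=
  ∀ (x : ℤ) (t₁ t₂ : ℝ≥0), t₁ < t₂ →
    (∀ η : ℤˣ, Summable fun y : Set.Iio x => |gainTerm lam n u σ x t₁ t₂ η y|) ∧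
    (((σ t₂ x : ℤ) : ℝ) - ((σ t₁ x : ℤ) : ℝ) =
      ∑ η : ℤˣ, 2 * ((η : ℤ) : ℝ) *
        ((∑' y : Set.Iio x, gainTerm lam n u σ x t₁ t₂ η y) - lossTerm lam n u σ x t₁ t₂ η))

end ToomInterface

end

open ToomInterface

/-!
Fix `A` with `max(p, 1 - p) ^ A ≤ 1 / 2048`. The proof rests on a bound for the density of the
half-line processes with respect to the Bernoulli measure, and on barriers that keep information
from travelling in from `-∞`.

**Density.** An exchange of the spin `η` at `y` with the first opposite spin, at `z`, preserves
Bernoulli measure and leaves behind a block of spins `η` that ends at `z` and is preceded by `-η`.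
Such a block determines `y` from `z`. Hence the total gain from exchanges inside a window is at most
the total loss, and only the exchanges that leave the window to the right create mass, at a bounded
total rate (`sum_lintegral_exchange_le`, `sum_lintegral_update_le`). Iteration over short time steps
gives a bound `exp (D t + 1)` for the density at time `t` that depends neither on the window nor on
`L` (`densityBound_windowState`). In particular long constant stretches of spins are exponentially
unlikely.

**Barriers.** An exchange started to the left of a stretch that contains both signs ends in it or
before it. If moreover there are no arrivals in the stretch, two evolutions with the same noise that
agree to its right continue to do so (`agree_step`). Time is cut into finitely many coarse slots, so
short that a block of `A k + 1` sites has no arrivals during one of them with probability of the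
order of `(3 / 4) ^ k` at least; among `2 ^ k` candidates there is then such a block with high
probability. Barriers for successive slots are chosen further and further to the right, within
distance `4 ^ k / 2` of the site `-4 ^ k` (`agree_of_barriers`). By the Borel–Cantelli lemma all this
works at all large scales `k` (`Good`, `ae_eventually_good`), so that the processes with
`4 ^ k ≤ L ≤ 4 ^ (k + 1)` agree to the right of `-4 ^ k / 2`, and by chaining the scales
the processes converge (`eventually_forall_halfLine_eq_limit`).

**Consequences.** Locally the limit is a process with finitely many arrivals, hence it is càdlàg,
and only arrivals at distance `O(k)` contribute to the equation at a given site, which reduces it to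
a finite sum (`satisfiesSDE_limitProcess`). The law at time `t` is shift invariant and, by Fatou,
dominated by a multiple of Bernoulli measure; by the law of large numbers these laws coincide
(`eq_productBernoulli_of_dominated`). For the Markov property, the noise after time `s` is
independent of the data revealed up to time `s` and is again a driving noise (`Driven.shift`), and
the process restarted with it from `σ_s`, which is a Bernoulli configuration, is the original one: the
barriers apply to the comparison of the two (`limitProcess_add`). The kernels run the dynamics with a
fresh noise (`transitionKernel`).
-/

noncomputable section

namespace ToomInterface

section

/-! ### Counting paths and their arrivals -/

/-- A counting path: it starts at `0`, is nondecreasing and right-continuous. -/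
structure RegularPath (n : ℝ≥0 → ℕ) : Prop where
  zero : n 0 = 0
  mono : Monotone n
  rightCont : ∀ t, ContinuousWithinAt n (Set.Ici t) t

theorem IsRateOnePoisson.regularPath {𝒪 : Type*} [MeasurableSpace 𝒪] {P : Measure 𝒪}
    {N : ℝ≥0 → 𝒪 → ℕ} (h : IsRateOnePoisson P N) (ω : 𝒪) : RegularPath fun t => N t ω :=
  ⟨h.zero ω, h.mono ω, h.rightCont ω⟩

theorem RegularPath.eventually_eq_right {n : ℝ≥0 → ℕ} (hn : RegularPath n) (t : ℝ≥0) :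
    ∀ᶠ s in 𝓝[≥] t, n s = n t := by
  have := (hn.rightCont t)
  rw [ContinuousWithinAt, nhds_discrete, tendsto_pure] at this
  exact this

theorem jumpTime_le {n : ℝ≥0 → ℕ} {k : ℕ} {t : ℝ≥0} (h : k ≤ n t) : jumpTime n k ≤ t :=
  csInf_le' h

/-- By right-continuity the infimum in the definition of the jump time is attained. -/
theorem RegularPath.le_apply_jumpTime {n : ℝ≥0 → ℕ} (hn : RegularPath n) {k : ℕ} {T : ℝ≥0}
    (h : k ≤ n T) : k ≤ n (jumpTime n k) := by
  have hev := hn.eventually_eq_right (jumpTime n k)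
  rw [eventually_nhdsWithin_iff, Metric.eventually_nhds_iff] at hev
  obtain ⟨ε, hε, hev⟩ := hev
  have hlt : jumpTime n k < jumpTime n k + ⟨ε, hε.le⟩ :=
    lt_add_of_pos_right _ (show (0 : ℝ≥0) < ⟨ε, hε.le⟩ from hε)
  obtain ⟨s, hs, hs'⟩ := exists_lt_of_csInf_lt (s := {s | k ≤ n s}) ⟨T, h⟩ hlt
  have hle : jumpTime n k ≤ s := jumpTime_le hs
  have : n s = n (jumpTime n k) := by
    refine hev ?_ hle
    rw [NNReal.dist_eq, abs_of_nonneg (sub_nonneg.2 (NNReal.coe_le_coe.2 hle)), sub_lt_iff_lt_add']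
    exact NNReal.coe_lt_coe.2 hs'
  exact this ▸ hs

theorem RegularPath.jumpTime_le_iff {n : ℝ≥0 → ℕ} (hn : RegularPath n) {k : ℕ} {T t : ℝ≥0}
    (h : k ≤ n T) : jumpTime n k ≤ t ↔ k ≤ n t :=
  ⟨fun h' => (hn.le_apply_jumpTime h).trans (hn.mono h'), jumpTime_le⟩

theorem RegularPath.lt_jumpTime_iff {n : ℝ≥0 → ℕ} (hn : RegularPath n) {k : ℕ} {T t : ℝ≥0}
    (h : k ≤ n T) : t < jumpTime n k ↔ n t < k := by
  rw [← not_le, hn.jumpTime_le_iff h, not_le]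

theorem mem_arrivals {n : ℤ → ℝ≥0 → ℕ} {L : ℕ} {R : ℤ} {t : ℝ≥0} {e : ℝ≥0 ×ₗ (ℤ ×ₗ ℕ)} :
    e ∈ arrivals n L R t ↔ ∃ y k, (-(L : ℤ) ≤ y ∧ y ≤ R) ∧ (1 ≤ k ∧ k ≤ n y t) ∧
      e = toLex (jumpTime (n y) k, toLex (y, k)) := by
  simp only [arrivals, Finset.mem_sort, Finset.mem_biUnion, Finset.mem_image, Finset.mem_Icc]
  constructor
  · rintro ⟨y, hy, k, hk, rfl⟩; exact ⟨y, k, hy, hk, rfl⟩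
  · rintro ⟨y, k, hy, hk, rfl⟩; exact ⟨y, hy, k, hk, rfl⟩

open Classical in
/-- The arrivals at the sites of `[-L, R]` during `(a, b]`, in chronological order. -/
def newArrivals (n : ℤ → ℝ≥0 → ℕ) (L : ℕ) (R : ℤ) (a b : ℝ≥0) : List (ℝ≥0 ×ₗ (ℤ ×ₗ ℕ)) :=
  ((Finset.Icc (-(L : ℤ)) R).biUnion fun y =>
    (Finset.Ioc (n y a) (n y b)).image fun k => toLex (jumpTime (n y) k, toLex (y, k))).sort (· ≤ ·)

theorem mem_newArrivals {n : ℤ → ℝ≥0 → ℕ} {L : ℕ} {R : ℤ} {a b : ℝ≥0}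
    {e : ℝ≥0 ×ₗ (ℤ ×ₗ ℕ)} :
    e ∈ newArrivals n L R a b ↔ ∃ y k, (-(L : ℤ) ≤ y ∧ y ≤ R) ∧ (n y a < k ∧ k ≤ n y b) ∧
      e = toLex (jumpTime (n y) k, toLex (y, k)) := by
  simp only [newArrivals, Finset.mem_sort, Finset.mem_biUnion, Finset.mem_image, Finset.mem_Icc,
    Finset.mem_Ioc]
  constructor
  · rintro ⟨y, hy, k, hk, rfl⟩; exact ⟨y, k, hy, hk, rfl⟩
  · rintro ⟨y, k, hy, hk, rfl⟩; exact ⟨y, hy, k, hk, rfl⟩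

/-- A sorted duplicate-free list is determined by its members. -/
theorem sort_eq_of_mem_iff {α : Type*} [LinearOrder α] {s : Finset α} {l : List α}
    (hl : l.Nodup) (hs : l.Pairwise (· ≤ ·)) (h : ∀ e, e ∈ s ↔ e ∈ l) : s.sort (· ≤ ·) = l := by
  classical
  have : s = l.toFinset := by ext e; simp [h]
  rw [this]
  exact (List.toFinset_sort _ hl).2 hs

theorem arrivals_eq_of_mem_iff {n : ℤ → ℝ≥0 → ℕ} {L : ℕ} {R : ℤ} {t : ℝ≥0}
    {l : List (ℝ≥0 ×ₗ (ℤ ×ₗ ℕ))} (hl : l.Nodup) (hs : l.Pairwise (· ≤ ·))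
    (h : ∀ e, e ∈ l ↔ e ∈ arrivals n L R t) : arrivals n L R t = l := by
  refine sort_eq_of_mem_iff hl hs fun e => ?_
  rw [h]; simp [arrivals]

theorem newArrivals_eq_of_mem_iff {n : ℤ → ℝ≥0 → ℕ} {L : ℕ} {R : ℤ} {a b : ℝ≥0}
    {l : List (ℝ≥0 ×ₗ (ℤ ×ₗ ℕ))} (hl : l.Nodup) (hs : l.Pairwise (· ≤ ·))
    (h : ∀ e, e ∈ l ↔ e ∈ newArrivals n L R a b) : newArrivals n L R a b = l := by
  refine sort_eq_of_mem_iff hl hs fun e => ?_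
  rw [h]; simp [newArrivals]

theorem arrivals_nodup (n : ℤ → ℝ≥0 → ℕ) (L : ℕ) (R : ℤ) (t : ℝ≥0) : (arrivals n L R t).Nodup :=
  Finset.sort_nodup _ _

theorem arrivals_sorted (n : ℤ → ℝ≥0 → ℕ) (L : ℕ) (R : ℤ) (t : ℝ≥0) :
    (arrivals n L R t).Pairwise (· ≤ ·) :=
  Finset.pairwise_sort _ _

theorem arrivals_append {n : ℤ → ℝ≥0 → ℕ} (hn : ∀ y, RegularPath (n y)) (L : ℕ) (R : ℤ)
    {a b : ℝ≥0} (hab : a ≤ b) :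
    arrivals n L R b = arrivals n L R a ++ newArrivals n L R a b := by
  have hlt : ∀ e ∈ arrivals n L R a, ∀ e' ∈ newArrivals n L R a b, e < e' := by
    intro e he e' he'
    obtain ⟨y, k, -, hk, rfl⟩ := mem_arrivals.1 he
    obtain ⟨y', k', -, hk', rfl⟩ := mem_newArrivals.1 he'
    refine Prod.Lex.toLex_lt_toLex.2 (Or.inl ?_)
    exact (jumpTime_le hk.2).trans_lt (((hn y').lt_jumpTime_iff hk'.2).2 hk'.1)
  refine arrivals_eq_of_mem_iff ?_ ?_ fun e => ?_
  · refine List.nodup_append.2 ⟨arrivals_nodup .., Finset.sort_nodup _ _, ?_⟩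
    intro e he e' he' heq
    exact (hlt e he e' he').ne heq
  · exact List.pairwise_append.2 ⟨arrivals_sorted .., Finset.pairwise_sort _ _,
      fun e he e' he' => (hlt e he e' he').le⟩
  · rw [List.mem_append, mem_arrivals, mem_arrivals, mem_newArrivals]
    constructor
    · rintro (⟨y, k, hy, hk, rfl⟩ | ⟨y, k, hy, hk, rfl⟩)
      · exact ⟨y, k, hy, ⟨hk.1, hk.2.trans ((hn y).mono hab)⟩, rfl⟩
      · exact ⟨y, k, hy, ⟨Nat.one_le_iff_ne_zero.2 (by omega), hk.2⟩, rfl⟩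
    · rintro ⟨y, k, hy, hk, rfl⟩
      by_cases hka : k ≤ n y a
      · exact Or.inl ⟨y, k, hy, ⟨hk.1, hka⟩, rfl⟩
      · exact Or.inr ⟨y, k, hy, ⟨not_le.1 hka, hk.2⟩, rfl⟩

/-- The effect of one arrival `(time, site, number)` on a configuration. -/
def applyArrival (lam : ℝ) (u : ℤ → ℕ → ℝ) (σ : Config) (e : ℝ≥0 ×ₗ (ℤ ×ₗ ℕ)) : Config :=
  update lam σ (ofLex (ofLex e).2).1 (u (ofLex (ofLex e).2).1 (ofLex (ofLex e).2).2)

theorem windowState_eq_foldl (lam : ℝ) (n : ℤ → ℝ≥0 → ℕ) (u : ℤ → ℕ → ℝ) (σ₀ : Config) (L : ℕ)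
    (R : ℤ) (t : ℝ≥0) :
    windowState lam n u σ₀ L R t = (arrivals n L R t).foldl (applyArrival lam u) σ₀ := rfl

theorem windowState_append (lam : ℝ) {n : ℤ → ℝ≥0 → ℕ} (hn : ∀ y, RegularPath (n y))
    (u : ℤ → ℕ → ℝ) (σ₀ : Config) (L : ℕ) (R : ℤ) {a b : ℝ≥0} (hab : a ≤ b) :
    windowState lam n u σ₀ L R b =
      (newArrivals n L R a b).foldl (applyArrival lam u) (windowState lam n u σ₀ L R a) := by
  rw [windowState_eq_foldl, arrivals_append hn L R hab, List.foldl_append, windowState_eq_foldl]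

theorem windowState_zero (lam : ℝ) {n : ℤ → ℝ≥0 → ℕ} (hn : ∀ y, RegularPath (n y))
    (u : ℤ → ℕ → ℝ) (σ₀ : Config) (L : ℕ) (R : ℤ) : windowState lam n u σ₀ L R 0 = σ₀ := by
  have : arrivals n L R 0 = [] := by
    refine List.eq_nil_iff_forall_not_mem.2 fun e he => ?_
    obtain ⟨y, k, -, hk, -⟩ := mem_arrivals.1 he
    rw [(hn y).zero] at hk
    omega
  rw [windowState_eq_foldl, this]; rfl

theorem windowState_eq_of_no_arrival (lam : ℝ) (n : ℤ → ℝ≥0 → ℕ) (u : ℤ → ℕ → ℝ) (σ₀ : Config)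
    (L : ℕ) (R : ℤ) {a b : ℝ≥0} (h : ∀ y, -(L : ℤ) ≤ y → y ≤ R → n y a = n y b) :
    windowState lam n u σ₀ L R b = windowState lam n u σ₀ L R a := by
  have : arrivals n L R b = arrivals n L R a := by
    refine arrivals_eq_of_mem_iff (arrivals_nodup ..) (arrivals_sorted ..) fun e => ?_
    rw [mem_arrivals, mem_arrivals]
    constructor
    · rintro ⟨y, k, hy, hk, rfl⟩; exact ⟨y, k, hy, (h y hy.1 hy.2) ▸ hk, rfl⟩
    · rintro ⟨y, k, hy, hk, rfl⟩; exact ⟨y, k, hy, (h y hy.1 hy.2).symm ▸ hk, rfl⟩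
  rw [windowState_eq_foldl, this, windowState_eq_foldl]

/-- A time interval with exactly one arrival in the window amounts to one update, by the mark of
that arrival. -/
theorem windowState_of_single_arrival (lam : ℝ) {n : ℤ → ℝ≥0 → ℕ} (hn : ∀ y, RegularPath (n y))
    (u : ℤ → ℕ → ℝ) (σ₀ : Config) (L : ℕ) (R : ℤ) {a b : ℝ≥0} (hab : a ≤ b) {y : ℤ}
    (hy : -(L : ℤ) ≤ y ∧ y ≤ R) (hy1 : n y b = n y a + 1)
    (h : ∀ z, -(L : ℤ) ≤ z → z ≤ R → z ≠ y → n z b = n z a) :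
    windowState lam n u σ₀ L R b =
      update lam (windowState lam n u σ₀ L R a) y (u y (n y b)) := by
  have : newArrivals n L R a b = [toLex (jumpTime (n y) (n y b), toLex (y, n y b))] := by
    refine newArrivals_eq_of_mem_iff (by simp) (by simp) fun e => ?_
    rw [mem_newArrivals, List.mem_singleton]
    constructor
    · rintro rfl; exact ⟨y, _, hy, ⟨by omega, le_rfl⟩, rfl⟩
    · rintro ⟨z, k, hz, hk, rfl⟩
      have : z = y := by
        by_contra hne
        have := h z hz.1 hz.2 hne
        omega
      subst this
      have : k = n z b := by omega
      rw [this]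
  rw [windowState_append lam hn u σ₀ L R hab, this]
  rfl

/-! ### The shift of the noise in time -/

/-- The counting path of the arrivals after time `s`. -/
def shiftPath (n : ℤ → ℝ≥0 → ℕ) (s : ℝ≥0) : ℤ → ℝ≥0 → ℕ := fun y t => n y (s + t) - n y s

/-- If `c y` arrivals at `y` have been used, then the `k`-th remaining one has number `c y + k`. The
index `0` does not belong to an arrival; it is kept fixed, so that the renumbering is injective and
avoids the numbers `1, …, c y`. -/
def shiftIndex (c : ℤ → ℕ) (y : ℤ) (k : ℕ) : ℕ := if k = 0 then 0 else c y + k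

theorem RegularPath.shift {n : ℤ → ℝ≥0 → ℕ} (hn : ∀ y, RegularPath (n y)) (s : ℝ≥0) (y : ℤ) :
    RegularPath (shiftPath n s y) := by
  refine ⟨by simp [shiftPath], fun a b hab => ?_, fun t => ?_⟩
  · exact Nat.sub_le_sub_right ((hn y).mono (add_le_add_right hab s)) _
  · rw [ContinuousWithinAt, nhds_discrete ℕ, tendsto_pure]
    have h := (hn y).eventually_eq_right (s + t)
    have hc : Tendsto (fun r => s + r) (𝓝[≥] t) (𝓝[≥] (s + t)) := by
      refine tendsto_nhdsWithin_iff.2 ⟨?_, ?_⟩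
      · exact ((continuous_const.add continuous_id).tendsto t).mono_left nhdsWithin_le_nhds
      · filter_upwards [self_mem_nhdsWithin] with r hr
        exact add_le_add_right (show t ≤ r from hr) s
    filter_upwards [hc.eventually h] with r hr
    simp [shiftPath, hr]

theorem jumpTime_shift {n : ℤ → ℝ≥0 → ℕ} (hn : ∀ y, RegularPath (n y)) {s t : ℝ≥0} {y : ℤ} {k : ℕ}
    (hk1 : 1 ≤ k) (hk : k ≤ shiftPath n s y t) :
    jumpTime (n y) (n y s + k) = s + jumpTime (shiftPath n s y) k := by
  have hns : n y s ≤ n y (s + t) := (hn y).mono le_self_add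
  have hk' : n y s + k ≤ n y (s + t) := by simp only [shiftPath] at hk; omega
  refine le_antisymm ?_ ?_
  · rw [(hn y).jumpTime_le_iff hk']
    have := (RegularPath.shift hn s y).le_apply_jumpTime hk
    have h2 : n y s ≤ n y (s + jumpTime (shiftPath n s y) k) := (hn y).mono le_self_add
    simp only [shiftPath] at this h2 ⊢
    omega
  · have hlt : s < jumpTime (n y) (n y s + k) := ((hn y).lt_jumpTime_iff hk').2 (by omega)
    obtain ⟨r, hr⟩ := exists_add_of_le hlt.le
    rw [hr]
    refine add_le_add_right (jumpTime_le ?_) s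
    have := (hn y).le_apply_jumpTime hk'
    rw [hr] at this
    simp only [shiftPath]
    omega

/-- The flow property on a finite window: restart at time `s` with the paths and the marks after
`s`. -/
theorem windowState_add (lam : ℝ) {n : ℤ → ℝ≥0 → ℕ} (hn : ∀ y, RegularPath (n y))
    (u : ℤ → ℕ → ℝ) (σ₀ : Config) (L : ℕ) (R : ℤ) (s t : ℝ≥0) :
    windowState lam n u σ₀ L R (s + t) =
      windowState lam (shiftPath n s) (fun y k => u y (shiftIndex (fun y => n y s) y k))
        (windowState lam n u σ₀ L R s) L R t := by
  set f : ℝ≥0 ×ₗ (ℤ ×ₗ ℕ) → ℝ≥0 ×ₗ (ℤ ×ₗ ℕ) := fun e =>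
    toLex (s + (ofLex e).1, toLex ((ofLex (ofLex e).2).1,
      n (ofLex (ofLex e).2).1 s + (ofLex (ofLex e).2).2)) with hf
  have hmono : StrictMono f := by
    rintro ⟨r, y, k⟩ ⟨r', y', k'⟩ h
    change toLex (r, toLex (y, k)) < toLex (r', toLex (y', k')) at h
    change toLex (s + r, toLex (y, n y s + k)) < toLex (s + r', toLex (y', n y' s + k'))
    simp only [Prod.Lex.toLex_lt_toLex] at h ⊢
    rcases h with h | ⟨rfl, h | ⟨rfl, h⟩⟩
    · exact Or.inl (by gcongr)
    · exact Or.inr ⟨rfl, Or.inl h⟩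
    · exact Or.inr ⟨rfl, Or.inr ⟨rfl, by omega⟩⟩
  have hnew : newArrivals n L R s (s + t) = (arrivals (shiftPath n s) L R t).map f := by
    refine newArrivals_eq_of_mem_iff ((arrivals_nodup ..).map hmono.injective) ?_ fun e => ?_
    · exact List.Pairwise.map f (fun a b hab => hmono.monotone hab) (arrivals_sorted ..)
    · rw [List.mem_map, mem_newArrivals]
      constructor
      · rintro ⟨e, he, rfl⟩
        obtain ⟨y, k, hy, hk, rfl⟩ := mem_arrivals.1 he
        refine ⟨y, n y s + k, hy, ⟨by omega, ?_⟩, ?_⟩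
        · have := hk.2
          simp only [shiftPath] at this
          omega
        · rw [jumpTime_shift hn hk.1 hk.2]; rfl
      · rintro ⟨y, k, hy, hk, rfl⟩
        have hk' : k - n y s ≤ shiftPath n s y t := by simp only [shiftPath]; omega
        refine ⟨_, mem_arrivals.2 ⟨y, k - n y s, hy, ⟨by omega, hk'⟩, rfl⟩, ?_⟩
        have := jumpTime_shift hn (show 1 ≤ k - n y s by omega) hk'
        rw [show n y s + (k - n y s) = k by omega] at this
        rw [this]
        change toLex (_, toLex (y, n y s + (k - n y s))) = _
        rw [show n y s + (k - n y s) = k by omega]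
        rfl
  rw [windowState_append lam hn u σ₀ L R (le_self_add : s ≤ s + t), hnew, List.foldl_map,
    windowState_eq_foldl lam (shiftPath n s)]
  refine List.foldl_ext _ _ _ fun σ e he => ?_
  obtain ⟨y, k, hy, hk, rfl⟩ := mem_arrivals.1 he
  change update lam σ y (u y (n y s + k)) = update lam σ y (u y (shiftIndex (fun y => n y s) y k))
  rw [shiftIndex, if_neg (by omega)]

/-! ### Locality of the dynamics -/

/-- An update does not act to the left of its site: spins are exchanged with spins further right. -/
theorem update_apply_of_lt (lam : ℝ) (σ : Config) {x y : ℤ} (v : ℝ) (h : x < y) :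
    update lam σ y v x = σ x := by
  unfold update
  split_ifs
  · refine if_neg ?_
    rintro (rfl | hx)
    · exact lt_irrefl _ h
    · exact lt_asymm h hx.1
  · rfl

/-- The spin at `x` after an update at `y ≤ x` is a function of the spins in `[y, x]`. -/
theorem update_apply_congr (lam : ℝ) {σ σ' : Config} {x y : ℤ} (v : ℝ) (hyx : y ≤ x)
    (h : ∀ z, y ≤ z → z ≤ x → σ z = σ' z) : update lam σ y v x = update lam σ' y v x := by
  have hy : σ y = σ' y := h y le_rfl hyx
  have hx : σ x = σ' x := h x hyx le_rfl
  have hopp : IsFirstOpposite σ y x ↔ IsFirstOpposite σ' y x := by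
    unfold IsFirstOpposite
    rw [hy, hx]
    refine and_congr_right fun _ => and_congr_right fun _ => forall_congr' fun w => ?_
    refine forall_congr' fun h1 => forall_congr' fun h2 => ?_
    rw [h w h1.le h2.le]
  unfold update
  rw [hy]
  split_ifs
  · unfold exchange
    rw [hx]
    classical
    exact if_congr (or_congr_right hopp) rfl rfl
  · exact hx

theorem update_agree_of_agree (lam : ℝ) {σ σ' : Config} (y : ℤ) (v : ℝ) {c d : ℤ} (hc : c ≤ y)
    (h : ∀ z, c ≤ z → z ≤ d → σ z = σ' z) :
    ∀ z, c ≤ z → z ≤ d → update lam σ y v z = update lam σ' y v z := by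
  intro z hz hzd
  by_cases hyz : y ≤ z
  · exact update_apply_congr lam v hyz fun w h1 h2 => h w (hc.trans h1) (h2.trans hzd)
  · rw [update_apply_of_lt lam _ v (not_le.1 hyz), update_apply_of_lt lam _ v (not_le.1 hyz)]
    exact h z hz hzd

/-- All spins in `[c, d]` are equal. -/
def IsConstOn (σ : Config) (c d : ℤ) : Prop := ∀ z, c ≤ z → z ≤ d → σ z = σ c

/-- An exchange starting to the left of a non-constant interval ends inside of it at the latest. -/
theorem update_apply_of_not_isConstOn (lam : ℝ) {σ : Config} {x y c d : ℤ} (v : ℝ) (hyc : y ≤ c)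
    (hcd : c ≤ d) (hdx : d < x) (h : ¬ IsConstOn σ c d) : update lam σ y v x = σ x := by
  unfold update
  split_ifs
  · refine if_neg ?_
    rintro (rfl | hx)
    · omega
    · have hconst : ∀ z, c ≤ z → z ≤ d → σ z = σ y := by
        intro z h1 h2
        rcases (hyc.trans h1).eq_or_lt with rfl | h3
        · rfl
        · exact hx.2.2 z h3 (h2.trans_lt hdx)
      exact h fun z h1 h2 => (hconst z h1 h2).trans (hconst c le_rfl hcd).symm
  · rfl

theorem foldl_agree_filter (lam : ℝ) (u : ℤ → ℕ → ℝ) (R : ℤ) (l : List (ℝ≥0 ×ₗ (ℤ ×ₗ ℕ))) :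
    ∀ σ σ' : Config, (∀ z ≤ R, σ z = σ' z) → ∀ z ≤ R,
      l.foldl (applyArrival lam u) σ z =
        (l.filter fun e => (ofLex (ofLex e).2).1 ≤ R).foldl (applyArrival lam u) σ' z := by
  induction l with
  | nil => intro σ σ' h; simpa using h
  | cons e l ih =>
    intro σ σ' h z hz
    by_cases he : (ofLex (ofLex e).2).1 ≤ R
    · rw [List.filter_cons_of_pos (by simpa using he), List.foldl_cons, List.foldl_cons]
      refine ih _ _ (fun w hw => ?_) z hz
      exact update_agree_of_agree lam _ _ (min_le_left _ w) (d := R)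
        (fun z _ hz => h z hz) w (min_le_right _ _) hw
    · rw [List.filter_cons_of_neg (by simpa using he), List.foldl_cons]
      refine ih _ _ (fun w hw => ?_) z hz
      rw [applyArrival, update_apply_of_lt lam _ _ (hw.trans_lt (not_le.1 he))]
      exact h w hw

/-- The restriction of the dynamics to `(-∞, R]` does not feel the arrivals to the right of `R`. -/
theorem windowState_apply_of_le (lam : ℝ) (n : ℤ → ℝ≥0 → ℕ) (u : ℤ → ℕ → ℝ) (σ₀ : Config) (L : ℕ)
    {R R' : ℤ} (hR : R ≤ R') (t : ℝ≥0) {x : ℤ} (hx : x ≤ R) :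
    windowState lam n u σ₀ L R' t x = windowState lam n u σ₀ L R t x := by
  have : arrivals n L R t = (arrivals n L R' t).filter fun e => (ofLex (ofLex e).2).1 ≤ R := by
    refine arrivals_eq_of_mem_iff ((arrivals_nodup ..).filter _) ((arrivals_sorted ..).filter _)
      fun e => ?_
    rw [List.mem_filter, mem_arrivals, mem_arrivals]
    constructor
    · rintro ⟨⟨y, k, hy, hk, rfl⟩, h⟩
      have h : y ≤ R := of_decide_eq_true h
      exact ⟨y, k, ⟨hy.1, h⟩, hk, rfl⟩
    · rintro ⟨y, k, hy, hk, rfl⟩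
      exact ⟨⟨y, k, ⟨hy.1, hy.2.trans hR⟩, hk, rfl⟩, decide_eq_true hy.2⟩
  rw [windowState_eq_foldl, windowState_eq_foldl, this]
  exact foldl_agree_filter lam u R _ _ _ (fun _ _ => rfl) x hx

theorem halfLineProcess_eq_windowState (lam : ℝ) (n : ℤ → ℝ≥0 → ℕ) (u : ℤ → ℕ → ℝ) (σ₀ : Config)
    (L : ℕ) {x R : ℤ} (hx : x ≤ R) (t : ℝ≥0) :
    halfLineProcess lam n u σ₀ L t x = windowState lam n u σ₀ L R t x :=
  (windowState_apply_of_le lam n u σ₀ L hx t le_rfl).symm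

/-! ### The shift of the noise in space -/

theorem isFirstOpposite_shift (σ : Config) (j y x : ℤ) :
    IsFirstOpposite (fun z => σ (z + j)) y x ↔ IsFirstOpposite σ (y + j) (x + j) := by
  unfold IsFirstOpposite
  refine and_congr (by omega) (and_congr_right fun _ => ?_)
  constructor
  · intro h w h1 h2
    have := h (w - j) (by omega) (by omega)
    simpa using this
  · intro h w h1 h2
    exact h (w + j) (by omega) (by omega)

theorem update_shift (lam : ℝ) (σ : Config) (j y : ℤ) (v : ℝ) :
    update lam (fun z => σ (z + j)) y v = fun x => update lam σ (y + j) v (x + j) := by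
  funext x
  unfold update
  split_ifs
  · unfold exchange
    classical
    exact if_congr (or_congr (add_left_inj (j : ℤ)).symm (isFirstOpposite_shift σ j y x)) rfl rfl
  · rfl

/-- The dynamics commute with spatial translations, if the frozen boundary is translated as well. -/
theorem windowState_shift (lam : ℝ) (n : ℤ → ℝ≥0 → ℕ) (u : ℤ → ℕ → ℝ) (σ₀ : Config) (L j : ℕ)
    (R : ℤ) (t : ℝ≥0) :
    windowState lam (fun y => n (y + j)) (fun y => u (y + j)) (fun z => σ₀ (z + j)) (L + j) R t =
      fun x => windowState lam n u σ₀ L (R + j) t (x + j) := by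
  set f : ℝ≥0 ×ₗ (ℤ ×ₗ ℕ) → ℝ≥0 ×ₗ (ℤ ×ₗ ℕ) := fun e =>
    toLex ((ofLex e).1, toLex ((ofLex (ofLex e).2).1 + j, (ofLex (ofLex e).2).2)) with hf
  have hmono : StrictMono f := by
    rintro ⟨r, y, k⟩ ⟨r', y', k'⟩ h
    change toLex (r, toLex (y, k)) < toLex (r', toLex (y', k')) at h
    change toLex (r, toLex (y + (j : ℤ), k)) < toLex (r', toLex (y' + (j : ℤ), k'))
    simp only [Prod.Lex.toLex_lt_toLex] at h ⊢
    rcases h with h | ⟨rfl, h | ⟨rfl, h⟩⟩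
    · exact Or.inl h
    · exact Or.inr ⟨rfl, Or.inl (by omega)⟩
    · exact Or.inr ⟨rfl, Or.inr ⟨rfl, h⟩⟩
  have harr : arrivals n L (R + j) t = (arrivals (fun y => n (y + j)) (L + j) R t).map f := by
    refine arrivals_eq_of_mem_iff ((arrivals_nodup ..).map hmono.injective) ?_ fun e => ?_
    · exact List.Pairwise.map f (fun a b hab => hmono.monotone hab) (arrivals_sorted ..)
    · rw [List.mem_map, mem_arrivals]
      constructor
      · rintro ⟨e, he, rfl⟩
        obtain ⟨y, k, hy, hk, rfl⟩ := mem_arrivals.1 he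
        exact ⟨y + j, k, ⟨by push_cast at hy; omega, by omega⟩, hk, rfl⟩
      · rintro ⟨y, k, hy, hk, rfl⟩
        refine ⟨toLex (jumpTime (n y) k, toLex (y - j, k)), mem_arrivals.2
          ⟨y - j, k, ⟨by push_cast; omega, by omega⟩, ?_, ?_⟩, ?_⟩
        · simpa using hk
        · simp
        · change toLex (_, toLex (y - j + (j : ℤ), k)) = _
          simp
  rw [windowState_eq_foldl, windowState_eq_foldl, harr, List.foldl_map]
  have key : ∀ (l : List (ℝ≥0 ×ₗ (ℤ ×ₗ ℕ))) (σ : Config),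
      l.foldl (applyArrival lam fun y => u (y + j)) (fun z => σ (z + j)) =
        fun x => l.foldl (fun σ e => applyArrival lam u σ (f e)) σ (x + j) := by
    intro l
    induction l with
    | nil => intro σ; rfl
    | cons e l ih =>
      intro σ
      rw [List.foldl_cons, List.foldl_cons, ← ih]
      congr 1
      exact update_shift lam σ j _ _
  exact key _ _

theorem halfLineProcess_shift (lam : ℝ) (n : ℤ → ℝ≥0 → ℕ) (u : ℤ → ℕ → ℝ) (σ₀ : Config) (L j : ℕ)
    (t : ℝ≥0) (x : ℤ) :
    halfLineProcess lam (fun y => n (y + j)) (fun y => u (y + j)) (fun z => σ₀ (z + j)) (L + j) t x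
      = halfLineProcess lam n u σ₀ L t (x + j) := by
  unfold halfLineProcess
  rw [windowState_shift]

theorem limitProcess_shift (lam : ℝ) (n : ℤ → ℝ≥0 → ℕ) (u : ℤ → ℕ → ℝ) (σ₀ : Config) (j : ℕ)
    (t : ℝ≥0) (x : ℤ) :
    limitProcess lam (fun y => n (y + j)) (fun y => u (y + j)) (fun z => σ₀ (z + j)) t x
      = limitProcess lam n u σ₀ t (x + j) := by
  classical
  have h : (∀ᶠ L : ℕ in atTop, halfLineProcess lam (fun y => n (y + j)) (fun y => u (y + j))
      (fun z => σ₀ (z + j)) L t x = 1) ↔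
      ∀ᶠ L : ℕ in atTop, halfLineProcess lam n u σ₀ L t (x + j) = 1 := by
    rw [← map_add_atTop_eq_nat j, eventually_map, map_add_atTop_eq_nat]
    simp only [halfLineProcess_shift]
  simp only [limitProcess, h]

end

section

/-! ### Measurability of the dynamics -/

instance : DiscreteMeasurableSpace ℤˣ := by
  have : MeasurableSingletonClass ℤˣ := ⟨fun a => by
    have h : MeasurableSet ((Units.val : ℤˣ → ℤ) ⁻¹' {(a : ℤ)}) :=
      ⟨_, measurableSet_singleton _, rfl⟩
    have h2 : (Units.val : ℤˣ → ℤ) ⁻¹' {(a : ℤ)} = {a} := by ext b; simp [Units.ext_iff]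
    rwa [h2] at h⟩
  infer_instance

theorem measurableSet_isFirstOpposite {α : Type*} {m : MeasurableSpace α} {τ : α → Config}
    (hτ : ∀ x, Measurable fun a => τ a x) (y x : ℤ) :
    MeasurableSet {a | IsFirstOpposite (τ a) y x} := by
  unfold IsFirstOpposite
  refine (MeasurableSet.const _).inter ((measurableSet_eq_fun (hτ x)
    ((measurable_of_countable Neg.neg).comp (hτ y))).inter ?_)
  have : {a | ∀ w, y < w → w < x → τ a w = τ a y} =
      ⋂ w, ⋂ (_ : y < w), ⋂ (_ : w < x), {a | τ a w = τ a y} := by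
    ext a; simp
  change MeasurableSet {a | ∀ w, y < w → w < x → τ a w = τ a y}
  rw [this]
  exact MeasurableSet.iInter fun w => MeasurableSet.iInter fun _ => MeasurableSet.iInter fun _ =>
    measurableSet_eq_fun (hτ w) (hτ y)

theorem measurable_update {α : Type*} {m : MeasurableSpace α} (lam : ℝ) {τ : α → Config}
    {v : α → ℝ} (hτ : Measurable τ) (hv : Measurable v) (y : ℤ) :
    Measurable fun a => update lam (τ a) y (v a) := by
  have hτ' : ∀ x, Measurable fun a => τ a x := fun x => (measurable_pi_apply x).comp hτ
  unfold update
  refine Measurable.ite ?_ ?_ hτ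
  · refine MeasurableSet.union (MeasurableSet.inter ?_ ?_) (MeasurableSet.inter ?_ ?_)
    · exact (hτ' y) (measurableSet_singleton 1)
    · exact measurableSet_lt hv measurable_const
    · exact (hτ' y) (measurableSet_singleton (-1))
    · exact measurableSet_lt measurable_const hv
  · refine measurable_pi_lambda _ fun x => ?_
    unfold exchange
    refine Measurable.ite ?_ ((measurable_of_countable Neg.neg).comp (hτ' x)) (hτ' x)
    exact (MeasurableSet.const _).union (measurableSet_isFirstOpposite hτ' y x)

/-- The labelled arrival belonging to a site and a number. -/
def arrivalEvent (n : ℤ → ℝ≥0 → ℕ) (p : ℤ × ℕ) : ℝ≥0 ×ₗ (ℤ ×ₗ ℕ) :=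
  toLex (jumpTime (n p.1) p.2, toLex p)

/-- Arrival `p` happens strictly before arrival `q`, with a rational time not after `t` as a
witness. -/
def ArrivesBefore (n : ℤ → ℝ≥0 → ℕ) (t : ℝ≥0) (p q : ℤ × ℕ) : Prop :=
  ∃ r : ℚ, Real.toNNReal r ≤ t ∧ p.2 ≤ n p.1 (Real.toNNReal r) ∧ n q.1 (Real.toNNReal r) < q.2

/-- The rational times in the definition separate the two jump times. -/
theorem arrivesBefore_iff {n : ℤ → ℝ≥0 → ℕ} (hn : ∀ y, RegularPath (n y)) {t : ℝ≥0} {p q : ℤ × ℕ}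
    (hp : p.2 ≤ n p.1 t) (hq : q.2 ≤ n q.1 t) :
    ArrivesBefore n t p q ↔ jumpTime (n p.1) p.2 < jumpTime (n q.1) q.2 := by
  constructor
  · rintro ⟨r, -, h1, h2⟩
    exact (jumpTime_le h1).trans_lt (((hn _).lt_jumpTime_iff hq).2 h2)
  · intro h
    obtain ⟨r, h1, h2⟩ := exists_rat_btwn (NNReal.coe_lt_coe.2 h)
    have h0 : (0 : ℝ) ≤ r := (NNReal.coe_nonneg _).trans h1.le
    have h1' : jumpTime (n p.1) p.2 ≤ Real.toNNReal r := by
      rw [← NNReal.coe_le_coe, Real.coe_toNNReal _ h0]; exact h1.le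
    have h2' : Real.toNNReal r < jumpTime (n q.1) q.2 := by
      rw [← NNReal.coe_lt_coe, Real.coe_toNNReal _ h0]; exact h2
    exact ⟨r, h2'.le.trans (jumpTime_le hq), ((hn _).jumpTime_le_iff hp).1 h1',
      ((hn _).lt_jumpTime_iff hq).1 h2'⟩

/-- The order of the arrivals, expressed by countably many conditions on the values of the paths at
fixed times. The lexicographic tie-break decides between simultaneous arrivals. -/
theorem arrivals_eq_map_iff {n : ℤ → ℝ≥0 → ℕ} (hn : ∀ y, RegularPath (n y)) (L : ℕ) (R : ℤ)
    (t : ℝ≥0) (l : List (ℤ × ℕ)) :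
    arrivals n L R t = l.map (arrivalEvent n) ↔
      l.Nodup ∧ (∀ p : ℤ × ℕ, p ∈ l ↔ (-(L : ℤ) ≤ p.1 ∧ p.1 ≤ R) ∧ (1 ≤ p.2 ∧ p.2 ≤ n p.1 t)) ∧
        l.Pairwise fun p q =>
          ArrivesBefore n t p q ∨ (¬ ArrivesBefore n t q p ∧ toLex p ≤ toLex q) := by
  have hinj : Function.Injective (arrivalEvent n) := by
    intro p q h
    have := congrArg (fun e => ofLex (ofLex e).2) h
    exact this
  have hle : ∀ p q : ℤ × ℕ, p.2 ≤ n p.1 t → q.2 ≤ n q.1 t →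
      (arrivalEvent n p ≤ arrivalEvent n q ↔
        ArrivesBefore n t p q ∨ (¬ ArrivesBefore n t q p ∧ toLex p ≤ toLex q)) := by
    intro p q hp hq
    rw [arrivesBefore_iff hn hp hq, arrivesBefore_iff hn hq hp, arrivalEvent, arrivalEvent,
      Prod.Lex.toLex_le_toLex, not_lt]
    constructor
    · rintro (h | ⟨h, h'⟩)
      · exact Or.inl h
      · exact Or.inr ⟨h.le, h'⟩
    · rintro (h | ⟨h, h'⟩)
      · exact Or.inl h
      · rcases h.lt_or_eq with h | h
        · exact Or.inl h
        · exact Or.inr ⟨h, h'⟩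
  have hmem : ∀ p : ℤ × ℕ, arrivalEvent n p ∈ arrivals n L R t ↔
      (-(L : ℤ) ≤ p.1 ∧ p.1 ≤ R) ∧ (1 ≤ p.2 ∧ p.2 ≤ n p.1 t) := by
    intro p
    rw [mem_arrivals]
    constructor
    · rintro ⟨y, k, hy, hk, h⟩
      have : p = (y, k) := hinj h
      subst this
      exact ⟨hy, hk⟩
    · rintro ⟨hy, hk⟩; exact ⟨p.1, p.2, hy, hk, rfl⟩
  constructor
  · intro h
    have hm : ∀ p : ℤ × ℕ, p ∈ l ↔ (-(L : ℤ) ≤ p.1 ∧ p.1 ≤ R) ∧ (1 ≤ p.2 ∧ p.2 ≤ n p.1 t) := by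
      intro p
      rw [← hmem, h, List.mem_map_of_injective hinj]
    refine ⟨List.Nodup.of_map (arrivalEvent n) (h ▸ arrivals_nodup n L R t), hm, ?_⟩
    have hs := arrivals_sorted n L R t
    rw [h, List.pairwise_map] at hs
    exact hs.imp_of_mem fun {p q} hp hq h => (hle p q ((hm p).1 hp).2.2 ((hm q).1 hq).2.2).1 h
  · rintro ⟨h1, hm, h2⟩
    refine arrivals_eq_of_mem_iff (h1.map hinj) ?_ fun e => ?_
    · rw [List.pairwise_map]
      exact h2.imp_of_mem fun {p q} hp hq h => (hle p q ((hm p).1 hp).2.2 ((hm q).1 hq).2.2).2 h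
    · rw [List.mem_map]
      constructor
      · rintro ⟨p, hp, rfl⟩; exact (hmem p).2 ((hm p).1 hp)
      · intro he
        obtain ⟨y, k, hy, hk, rfl⟩ := mem_arrivals.1 he
        exact ⟨(y, k), (hm _).2 ⟨hy, hk⟩, rfl⟩

theorem exists_arrivals_eq_map (n : ℤ → ℝ≥0 → ℕ) (L : ℕ) (R : ℤ) (t : ℝ≥0) :
    ∃ l : List (ℤ × ℕ), arrivals n L R t = l.map (arrivalEvent n) := by
  refine ⟨(arrivals n L R t).map fun e => ofLex (ofLex e).2, ?_⟩
  rw [List.map_map]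
  have : ∀ e ∈ arrivals n L R t, (arrivalEvent n ∘ fun e => ofLex (ofLex e).2) e = e := by
    intro e he
    obtain ⟨y, k, -, -, rfl⟩ := mem_arrivals.1 he
    rfl
  rw [List.map_congr_left this, List.map_id']

/-- The state on a window is measurable with respect to any `σ`-algebra that makes the paths up to
the present time, the marks and the initial configuration measurable: there are countably many
possible orders of the arrivals, and for each of them the state is a finite composition of updates.
-/
theorem measurable_windowState {α : Type*} {m : MeasurableSpace α} (lam : ℝ)
    {n : α → ℤ → ℝ≥0 → ℕ} {u : α → ℤ → ℕ → ℝ} {σ : α → Config} (L : ℕ) (R : ℤ) (t : ℝ≥0)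
    (hn : ∀ a y, RegularPath (n a y)) (hnm : ∀ y, ∀ r ≤ t, Measurable fun a => n a y r)
    (hu : ∀ y k, Measurable fun a => u a y k) (hσ : Measurable σ) :
    Measurable fun a => windowState lam (n a) (u a) (σ a) L R t := by
  have hset : ∀ l : List (ℤ × ℕ),
      MeasurableSet {a | arrivals (n a) L R t = l.map (arrivalEvent (n a))} := by
    intro l
    have hB : ∀ p q : ℤ × ℕ, MeasurableSet {a | ArrivesBefore (n a) t p q} := by
      intro p q
      have : {a | ArrivesBefore (n a) t p q} = ⋃ r : ℚ, ⋃ (_ : Real.toNNReal r ≤ t),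
          {a | p.2 ≤ n a p.1 (Real.toNNReal r)} ∩ {a | n a q.1 (Real.toNNReal r) < q.2} := by
        ext a; simp [ArrivesBefore, and_left_comm]
      rw [this]
      refine MeasurableSet.iUnion fun r => MeasurableSet.iUnion fun hr => ?_
      exact (measurableSet_le measurable_const (hnm _ _ hr)).inter
        (measurableSet_lt (hnm _ _ hr) measurable_const)
    simp only [arrivals_eq_map_iff (hn _)]
    refine (MeasurableSet.const _).inter (MeasurableSet.inter ?_ ?_)
    · have : {a | ∀ p : ℤ × ℕ, p ∈ l ↔ (-(L : ℤ) ≤ p.1 ∧ p.1 ≤ R) ∧ (1 ≤ p.2 ∧ p.2 ≤ n a p.1 t)} =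
          ⋂ p : ℤ × ℕ, {a | p ∈ l ↔ (-(L : ℤ) ≤ p.1 ∧ p.1 ≤ R) ∧ (1 ≤ p.2 ∧ p.2 ≤ n a p.1 t)} := by
        ext a; simp
      change MeasurableSet {a | ∀ p : ℤ × ℕ, _}
      rw [this]
      refine MeasurableSet.iInter fun p => ?_
      exact hnm p.1 t le_rfl (MeasurableSet.of_discrete
        (s := {c | p ∈ l ↔ (-(L : ℤ) ≤ p.1 ∧ p.1 ≤ R) ∧ (1 ≤ p.2 ∧ p.2 ≤ c)}))
    · change MeasurableSet {a | l.Pairwise _}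
      induction l with
      | nil => simp
      | cons p l ih =>
        simp only [List.pairwise_cons]
        refine MeasurableSet.inter ?_ ih
        have : {a | ∀ q ∈ l, ArrivesBefore (n a) t p q ∨
            (¬ ArrivesBefore (n a) t q p ∧ toLex p ≤ toLex q)} = ⋂ q, ⋂ (_ : q ∈ l),
            {a | ArrivesBefore (n a) t p q ∨
              (¬ ArrivesBefore (n a) t q p ∧ toLex p ≤ toLex q)} := by
          ext a; simp
        change MeasurableSet {a | ∀ q ∈ l, _}
        rw [this]
        refine MeasurableSet.iInter fun q => MeasurableSet.iInter fun _ => ?_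
        exact (hB p q).union ((hB q p).compl.inter (MeasurableSet.const _))
  have hfold : ∀ (l : List (ℤ × ℕ)) (τ : α → Config), Measurable τ →
      Measurable fun a => l.foldl (fun σ p => update lam σ p.1 (u a p.1 p.2)) (τ a) := by
    intro l
    induction l with
    | nil => intro τ hτ; exact hτ
    | cons p l ih =>
      intro τ hτ
      exact ih _ (measurable_update lam hτ (hu p.1 p.2) p.1)
  intro B hB
  have : (fun a => windowState lam (n a) (u a) (σ a) L R t) ⁻¹' B =
      ⋃ l : List (ℤ × ℕ), {a | arrivals (n a) L R t = l.map (arrivalEvent (n a))} ∩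
        (fun a => l.foldl (fun σ p => update lam σ p.1 (u a p.1 p.2)) (σ a)) ⁻¹' B := by
    have hw : ∀ a (l : List (ℤ × ℕ)), arrivals (n a) L R t = l.map (arrivalEvent (n a)) →
        windowState lam (n a) (u a) (σ a) L R t =
          l.foldl (fun σ p => update lam σ p.1 (u a p.1 p.2)) (σ a) := by
      intro a l h
      rw [windowState_eq_foldl, h, List.foldl_map]
      rfl
    ext a
    simp only [Set.mem_preimage, Set.mem_iUnion, Set.mem_inter_iff, Set.mem_ofPred_eq]
    constructor
    · intro h
      obtain ⟨l, hl⟩ := exists_arrivals_eq_map (n a) L R t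
      exact ⟨l, hl, hw a l hl ▸ h⟩
    · rintro ⟨l, hl, h⟩
      exact hw a l hl ▸ h
  rw [this]
  exact MeasurableSet.iUnion fun l => (hset l).inter (hfold l σ hσ hB)

theorem measurable_limitProcess {α : Type*} {m : MeasurableSpace α} (lam : ℝ)
    {n : α → ℤ → ℝ≥0 → ℕ} {u : α → ℤ → ℕ → ℝ} {σ : α → Config} (t : ℝ≥0)
    (hn : ∀ a y, RegularPath (n a y)) (hnm : ∀ y, ∀ r ≤ t, Measurable fun a => n a y r)
    (hu : ∀ y k, Measurable fun a => u a y k) (hσ : Measurable σ) :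
    Measurable fun a => limitProcess lam (n a) (u a) (σ a) t := by
  refine measurable_pi_lambda _ fun x => ?_
  unfold limitProcess
  refine Measurable.ite ?_ measurable_const measurable_const
  have : {a | ∀ᶠ L : ℕ in atTop, halfLineProcess lam (n a) (u a) (σ a) L t x = 1} =
      ⋃ L₀ : ℕ, ⋂ L : ℕ, ⋂ (_ : L₀ ≤ L), {a | halfLineProcess lam (n a) (u a) (σ a) L t x = 1} := by
    ext a; simp [eventually_atTop]
  rw [this]
  refine MeasurableSet.iUnion fun L₀ => MeasurableSet.iInter fun L =>
    MeasurableSet.iInter fun _ => ?_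
  exact (measurable_pi_apply x).comp (measurable_windowState lam L x t hn hnm hu hσ)
    (measurableSet_singleton 1)

/-! ### Regularization of paths -/

/-- A counting path reconstructed from the values of `n` at rational times. It equals `n` when `n`
is a counting path, and it is a counting path and a measurable function of `n` for every `n`. -/
def regularize (n : ℝ≥0 → ℕ) (t : ℝ≥0) : ℕ :=
  (⨅ q : {q : ℚ // t < Real.toNNReal q}, n (Real.toNNReal q)) -
    ⨅ q : {q : ℚ // 0 < Real.toNNReal q}, n (Real.toNNReal q)

theorem exists_toNNReal_btwn {s t : ℝ≥0} (h : s < t) : ∃ q : ℚ, s < Real.toNNReal q ∧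
    Real.toNNReal q < t := by
  obtain ⟨r, h1, h2⟩ := exists_rat_btwn (NNReal.coe_lt_coe.2 h)
  have h0 : (0 : ℝ) ≤ r := (NNReal.coe_nonneg _).trans h1.le
  refine ⟨r, ?_, ?_⟩
  · rw [← NNReal.coe_lt_coe, Real.coe_toNNReal _ h0]; exact h1
  · rw [← NNReal.coe_lt_coe, Real.coe_toNNReal _ h0]; exact h2

instance (t : ℝ≥0) : Nonempty {q : ℚ // t < Real.toNNReal q} := by
  obtain ⟨q, hq, -⟩ := exists_toNNReal_btwn (lt_add_one t)
  exact ⟨⟨q, hq⟩⟩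

theorem regularPath_regularize (n : ℝ≥0 → ℕ) : RegularPath (regularize n) := by
  set f : ℝ≥0 → ℕ := fun t => ⨅ q : {q : ℚ // t < Real.toNNReal q}, n (Real.toNNReal q) with hf
  have hmono : Monotone f := by
    intro s t hst
    refine le_ciInf fun q => ?_
    exact ciInf_le' (fun q : {q : ℚ // s < Real.toNNReal q} => n (Real.toNNReal q))
      ⟨q.1, hst.trans_lt q.2⟩
  have hright : ∀ t, ∀ᶠ s in 𝓝[≥] t, f s = f t := by
    intro t
    obtain ⟨q, hq⟩ := ciInf_mem fun q : {q : ℚ // t < Real.toNNReal q} => n (Real.toNNReal q)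
    have : ∀ᶠ s in 𝓝[≥] t, s < Real.toNNReal q :=
      nhdsWithin_le_nhds (Iio_mem_nhds q.2)
    filter_upwards [this, self_mem_nhdsWithin] with s hs hts
    refine le_antisymm ?_ (hmono hts)
    calc f s ≤ n (Real.toNNReal q) :=
          ciInf_le' (fun q : {q : ℚ // s < Real.toNNReal q} => n (Real.toNNReal q)) ⟨q.1, hs⟩
      _ = f t := hq
  refine ⟨Nat.sub_self _, fun s t hst => Nat.sub_le_sub_right (hmono hst) _, fun t => ?_⟩
  rw [ContinuousWithinAt, nhds_discrete ℕ, tendsto_pure]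
  filter_upwards [hright t] with s hs
  exact congrArg (· - f 0) hs

theorem regularize_eq {n : ℝ≥0 → ℕ} (hn : RegularPath n) : regularize n = n := by
  have key : ∀ t, ⨅ q : {q : ℚ // t < Real.toNNReal q}, n (Real.toNNReal q) = n t := by
    intro t
    refine le_antisymm ?_ (le_ciInf fun q => hn.mono q.2.le)
    have h := hn.eventually_eq_right t
    have h2 : ∀ᶠ s in 𝓝[>] t, n s = n t := h.filter_mono (nhdsWithin_mono t Set.Ioi_subset_Ici_self)
    obtain ⟨b, hb, hsub⟩ := (mem_nhdsGT_iff_exists_Ioo_subset' (lt_add_one t)).1 h2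
    obtain ⟨q, hq1, hq2⟩ := exists_toNNReal_btwn hb
    calc _ ≤ n (Real.toNNReal q) :=
          ciInf_le' (fun q : {q : ℚ // t < Real.toNNReal q} => n (Real.toNNReal q)) ⟨q, hq1⟩
      _ = n t := hsub ⟨hq1, hq2⟩
  funext t
  rw [regularize, key, key, hn.zero, Nat.sub_zero]

theorem measurable_regularize (t : ℝ≥0) : Measurable fun n : ℝ≥0 → ℕ => regularize n t := by
  have h : ∀ t : ℝ≥0, Measurable fun n : ℝ≥0 → ℕ =>
      ⨅ q : {q : ℚ // t < Real.toNNReal q}, n (Real.toNNReal q) := fun t =>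
    Measurable.iInf fun q => measurable_pi_apply _
  exact (h t).sub (h 0)

/-- Initial configuration, counting paths and marks: all the data that determine the dynamics. -/
abbrev InputSpace : Type := Config × (ℤ → ℝ≥0 → ℕ) × (ℤ → ℕ → ℝ)

/-- The state on a window as a measurable function of the input. -/
def windowMap (lam : ℝ) (L : ℕ) (R : ℤ) (t : ℝ≥0) (z : InputSpace) : Config :=
  windowState lam (fun y => regularize (z.2.1 y)) z.2.2 z.1 L R t

/-- The limiting process at time `t` as a measurable function of the input. -/
def limitMap (lam : ℝ) (t : ℝ≥0) (z : InputSpace) : Config :=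
  limitProcess lam (fun y => regularize (z.2.1 y)) z.2.2 z.1 t

theorem measurable_windowMap (lam : ℝ) (L : ℕ) (R : ℤ) (t : ℝ≥0) :
    Measurable (windowMap lam L R t) := by
  refine measurable_windowState lam L R t (fun a y => regularPath_regularize _) (fun y r _ => ?_)
    (fun y k => ?_) measurable_fst
  · exact (measurable_regularize r).comp (by fun_prop)
  · fun_prop

theorem measurable_limitMap (lam : ℝ) (t : ℝ≥0) : Measurable (limitMap lam t) := by
  refine measurable_limitProcess lam t (fun a y => regularPath_regularize _) (fun y r _ => ?_)
    (fun y k => ?_) measurable_fst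
  · exact (measurable_regularize r).comp (by fun_prop)
  · fun_prop

theorem windowMap_eq (lam : ℝ) (L : ℕ) (R : ℤ) (t : ℝ≥0) {n : ℤ → ℝ≥0 → ℕ}
    (hn : ∀ y, RegularPath (n y)) (u : ℤ → ℕ → ℝ) (σ : Config) :
    windowMap lam L R t (σ, n, u) = windowState lam n u σ L R t := by
  have : (fun y => regularize (n y)) = n := funext fun y => regularize_eq (hn y)
  simp only [windowMap, this]

theorem limitMap_eq (lam : ℝ) (t : ℝ≥0) {n : ℤ → ℝ≥0 → ℕ}
    (hn : ∀ y, RegularPath (n y)) (u : ℤ → ℕ → ℝ) (σ : Config) :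
    limitMap lam t (σ, n, u) = limitProcess lam n u σ t := by
  have : (fun y => regularize (n y)) = n := funext fun y => regularize_eq (hn y)
  simp only [limitMap, this]

end

section

/-! ### Independence and laws of the driving noise -/

/-- Finitely many times are visited by a monotone sequence, as needed to apply the independence of
increments. -/
theorem exists_monotone_cover {T : Type*} [LinearOrder T] [Inhabited T] (K : Finset T) :
    ∃ (m : ℕ) (t : ℕ → T), Monotone t ∧ (∀ i < m, t i ∈ K) ∧ ∀ k ∈ K, ∃ i < m, t i = k := by
  induction K using Finset.induction_on_max with
  | empty => exact ⟨0, fun _ => default, monotone_const, by simp, by simp⟩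
  | insert a K ha ih =>
    obtain ⟨m, t, ht, hm, hK⟩ := ih
    refine ⟨m + 1, fun i => if i < m then t i else a, fun i j hij => ?_, fun i hi => ?_,
      fun k hk => ?_⟩
    · dsimp only
      split_ifs with h1 h2
      · exact ht hij
      · exact (ha _ (hm i h1)).le
      · omega
      · exact le_rfl
    · dsimp only
      split_ifs with h1
      · exact Finset.mem_insert_of_mem (hm i h1)
      · exact Finset.mem_insert_self _ _
    · rcases Finset.mem_insert.1 hk with rfl | hk
      · exact ⟨m, by omega, by simp⟩
      · obtain ⟨i, hi, rfl⟩ := hK k hk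
        exact ⟨i, by omega, by simp [hi]⟩

section Poisson

variable {𝒪 : Type*} [MeasurableSpace 𝒪] {P : Measure 𝒪} {N : ℝ≥0 → 𝒪 → ℕ}

theorem IsRateOnePoisson.measurable_path (h : IsRateOnePoisson P N) :
    Measurable fun ω t => N t ω :=
  measurable_pi_lambda _ h.measurable

theorem IsRateOnePoisson.sum_increments (h : IsRateOnePoisson P N) {t : ℕ → ℝ≥0} (ht : Monotone t)
    {i j : ℕ} (hij : i ≤ j) (ω : 𝒪) :
    ∑ l ∈ Finset.Ico i j, (N (t (l + 1)) ω - N (t l) ω) = N (t j) ω - N (t i) ω := by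
  have hm : Monotone fun l => N (t l) ω := (h.mono ω).comp ht
  induction j, hij using Nat.le_induction with
  | base => simp
  | succ j hij ih =>
    rw [Finset.sum_Ico_succ_top hij, ih]
    have h1 : N (t i) ω ≤ N (t j) ω := hm hij
    have h2 : N (t j) ω ≤ N (t (j + 1)) ω := hm (Nat.le_succ j)
    omega

/-- The finite-dimensional distributions are those of sums of independent Poisson increments. -/
theorem IsRateOnePoisson.map_restrict_eq [IsProbabilityMeasure P] (h : IsRateOnePoisson P N)
    {t : ℕ → ℝ≥0} (ht : Monotone t) (ht0 : t 0 = 0) (I : Finset ℝ≥0) (idx : ℝ≥0 → ℕ)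
    (hidx : ∀ r ∈ I, t (idx r) = r) :
    P.map (fun ω => I.restrict fun t => N t ω) =
      (Measure.infinitePi fun i => poissonMeasure (t (i + 1) - t i)).map
        fun (ξ : ℕ → ℕ) (r : I) => ∑ l ∈ Finset.Ico 0 (idx r), ξ l := by
  have hm : ∀ i, Measurable fun ω => N (t (i + 1)) ω - N (t i) ω := fun i =>
    (h.measurable _).sub (h.measurable _)
  have h1 := (h.indepIncrements.nat ht).map_fun_eq_infinitePi_map
    (X := fun i ω => N (t (i + 1)) ω - N (t i) ω) hm
  have h2 : (fun i => P.map (fun ω => N (t (i + 1)) ω - N (t i) ω)) =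
      fun i => poissonMeasure (t (i + 1) - t i) :=
    funext fun i => h.law _ _ (ht (Nat.le_succ i))
  rw [h2] at h1
  rw [← h1, Measure.map_map]
  · congr 1
    funext ω
    funext r
    simp only [Function.comp]
    rw [h.sum_increments ht (Nat.zero_le _), ht0, h.zero, hidx r r.2, Nat.sub_zero]
    rfl
  · refine measurable_pi_lambda _ fun r => ?_
    exact Finset.measurable_sum _ fun i _ => measurable_pi_apply i
  · exact measurable_pi_lambda _ hm

/-- All Poisson processes of rate one have the same law on the space of paths. -/
theorem IsRateOnePoisson.map_path_eq {𝒪' : Type*} [MeasurableSpace 𝒪'] {P' : Measure 𝒪'}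
    {N' : ℝ≥0 → 𝒪' → ℕ} [IsProbabilityMeasure P] [IsProbabilityMeasure P']
    (h : IsRateOnePoisson P N) (h' : IsRateOnePoisson P' N') :
    P.map (fun ω t => N t ω) = P'.map (fun ω t => N' t ω) := by
  have key : ∀ I : Finset ℝ≥0, P.map (fun ω => I.restrict fun t => N t ω) =
      P'.map (fun ω => I.restrict fun t => N' t ω) := by
    intro I
    obtain ⟨m, t, ht, -, hK⟩ := exists_monotone_cover (insert 0 I)
    have ht0 : t 0 = 0 := by
      obtain ⟨i, -, hi⟩ := hK 0 (Finset.mem_insert_self _ _)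
      exact le_antisymm (hi ▸ ht (Nat.zero_le i)) zero_le
    choose! idx _ hidx using fun k (hk : k ∈ insert 0 I) => hK k hk
    have hidx' : ∀ r ∈ I, t (idx r) = r := fun r hr => hidx r (Finset.mem_insert_of_mem hr)
    rw [h.map_restrict_eq ht ht0 I idx hidx', h'.map_restrict_eq ht ht0 I idx hidx']
  have h1 := isProjectiveLimit_map (P := P) (X := N) h.measurable_path.aemeasurable
  have h2 := isProjectiveLimit_map (P := P') (X := N') h'.measurable_path.aemeasurable
  simp_rw [← key] at h2
  exact h1.unique h2

/-- The path of a Poisson process up to time `s` is independent of its increments after `s`. -/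
theorem IsRateOnePoisson.indepFun_stop_shift [IsProbabilityMeasure P] (h : IsRateOnePoisson P N)
    (s : ℝ≥0) :
    IndepFun (fun ω r => N (min r s) ω) (fun ω r => N (s + r) ω - N s ω) P := by
  refine IndepFun.process_indepFun_process (fun r => h.measurable _)
    (fun r => (h.measurable _).sub (h.measurable _)) fun I J => ?_
  obtain ⟨m, t, ht, -, hK⟩ := exists_monotone_cover
    (insert 0 (insert s (I.image (fun r => min r s) ∪ J.image (fun r => s + r))))
  have ht0 : t 0 = 0 := by
    obtain ⟨i, -, hi⟩ := hK 0 (Finset.mem_insert_self _ _)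
    exact le_antisymm (hi ▸ ht (Nat.zero_le i)) zero_le
  choose! idx hlt hidx using fun k hk => hK k hk
  set b := idx s with hb
  have hbs : t b = s := hidx s (by simp)
  have hI : ∀ r ∈ I, t (min (idx (min r s)) b) = min r s := by
    intro r hr
    have h1 : t (idx (min r s)) = min r s :=
      hidx _ (by simp only [Finset.mem_insert, Finset.mem_union, Finset.mem_image]; grind)
    rw [ht.map_min, h1, hbs, min_assoc, min_self]
  have hJ : ∀ r ∈ J, t (max (idx (s + r)) b) = s + r := by
    intro r hr
    have h1 : t (idx (s + r)) = s + r :=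
      hidx _ (by simp only [Finset.mem_insert, Finset.mem_union, Finset.mem_image]; grind)
    rw [ht.map_max, h1, hbs, max_eq_left le_self_add]
  have hind := (h.indepIncrements.nat ht).indepFun_finset (Finset.range b)
    (Finset.Ico b (m + b)) (by
      rw [Finset.disjoint_left]; intro i hi; simp at hi ⊢; omega)
    (fun i => (h.measurable _).sub (h.measurable _))
  set G₁ : (Finset.range b → ℕ) → I → ℕ := fun ξ r =>
    ∑ l : Finset.range b, if l.1 < idx (min r.1 s) then ξ l else 0 with hG₁
  set G₂ : (Finset.Ico b (m + b) → ℕ) → J → ℕ := fun ξ r =>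
    ∑ l : Finset.Ico b (m + b), if l.1 < idx (s + r.1) then ξ l else 0 with hG₂
  have hcomp := hind.comp (φ := G₁) (ψ := G₂) (measurable_of_countable _)
    (measurable_of_countable _)
  convert hcomp using 1
  · funext ω r
    simp only [hG₁, Function.comp]
    rw [Finset.sum_coe_sort (Finset.range b)
      (fun l => if l < idx (min r.1 s) then N (t (l + 1)) ω - N (t l) ω else 0),
      ← Finset.sum_filter]
    have : (Finset.range b).filter (fun l => l < idx (min r.1 s)) =
        Finset.Ico 0 (min (idx (min r.1 s)) b) := by
      ext l; simp; omega
    rw [this, h.sum_increments ht (Nat.zero_le _), hI r r.2, ht0, h.zero, Nat.sub_zero]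
  · funext ω r
    simp only [hG₂, Function.comp]
    rw [Finset.sum_coe_sort (Finset.Ico b (m + b))
      (fun l => if l < idx (s + r.1) then N (t (l + 1)) ω - N (t l) ω else 0),
      ← Finset.sum_filter]
    have hl : idx (s + r.1) < m :=
      hlt _ (by simp only [Finset.mem_insert, Finset.mem_union, Finset.mem_image]; grind)
    have : (Finset.Ico b (m + b)).filter (fun l => l < idx (s + r.1)) =
        Finset.Ico b (max (idx (s + r.1)) b) := by
      ext l; simp; omega
    rw [this, h.sum_increments ht (le_max_right _ _), hJ r r.2, hbs]

/-- The increments after a fixed time form again a Poisson process of rate one. -/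
theorem IsRateOnePoisson.shift (h : IsRateOnePoisson P N) (s : ℝ≥0) :
    IsRateOnePoisson P fun t ω => N (s + t) ω - N s ω where
  measurable t := (h.measurable _).sub (h.measurable _)
  zero ω := by simp
  mono ω := (RegularPath.shift (n := fun _ t => N t ω) (fun _ => h.regularPath ω) s 0).mono
  rightCont ω :=
    (RegularPath.shift (n := fun _ t => N t ω) (fun _ => h.regularPath ω) s 0).rightCont
  indepIncrements := by
    intro n t ht
    have := h.indepIncrements n (fun i => s + t i) fun i j hij => add_le_add_right (ht hij) s
    convert this using 3 with i ω
    have h1 : N s ω ≤ N (s + t i.castSucc) ω := h.mono ω le_self_add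
    dsimp only
    omega
  law r t hrt := by
    have := h.law (s + r) (s + t) (add_le_add_right hrt s)
    rw [add_tsub_add_eq_tsub_left] at this
    rw [← this]
    congr 1
    funext ω
    have h1 : N s ω ≤ N (s + r) ω := h.mono ω le_self_add
    omega

end Poisson

theorem iIndepFun_bool {𝒪 β : Type*} [MeasurableSpace 𝒪] [MeasurableSpace β] {P : Measure 𝒪}
    [IsProbabilityMeasure P] {f : Bool → 𝒪 → β} (h : IndepFun (f true) (f false) P) :
    iIndepFun f P := by
  rw [iIndepFun_iff_measure_inter_preimage_eq_mul]
  intro S sets hsets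
  have h1 := h.measure_inter_preimage_eq_mul (sets true) (sets false)
  have hS : S = ∅ ∨ S = {true} ∨ S = {false} ∨ S = {true, false} := by
    clear hsets; revert S; decide
  rcases hS with rfl | rfl | rfl | rfl
  · simp
  · simp
  · simp
  · rw [Finset.prod_pair (by decide)]
    rw [← h1 (hsets _ (by simp)) (hsets _ (by simp))]
    congr 1
    ext ω; simp [and_comm]

/-- Independence of two families, from the independence of the pairs and within the pairs. -/
theorem indepFun_families {𝒪 β ι : Type*} [MeasurableSpace 𝒪] [MeasurableSpace β] {P : Measure 𝒪}
    [IsProbabilityMeasure P] {f g : ι → 𝒪 → β} (hf : ∀ i, Measurable (f i))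
    (hg : ∀ i, Measurable (g i)) (hfg : ∀ i, IndepFun (f i) (g i) P)
    (h : iIndepFun (fun i ω => (f i ω, g i ω)) P) :
    IndepFun (fun ω i => f i ω) (fun ω i => g i ω) P := by
  set Y : ι → Bool → 𝒪 → β := fun i b => if b then f i else g i with hY
  have hYm : ∀ i b, Measurable (Y i b) := by
    intro i b; cases b
    · exact hg i
    · exact hf i
  have h1 : iIndepFun (fun i ω b => Y i b ω) P := by
    have := h.comp (fun _ (p : β × β) (b : Bool) => if b then p.1 else p.2) (fun i => by
      refine measurable_pi_lambda _ fun b => ?_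
      cases b
      · exact measurable_snd
      · exact measurable_fst)
    convert this using 3 with i ω
    funext b
    cases b <;> rfl
  have h2 := iIndepFun_uncurry' hYm h1 fun i => iIndepFun_bool (hfg i)
  refine IndepFun.process_indepFun_process hf hg fun I J => ?_
  classical
  have h3 := h2.indepFun_finset (I ×ˢ {true}) (J ×ˢ {false}) (by
    rw [Finset.disjoint_left]; rintro ⟨i, b⟩ hi hj; simp at hi hj; simp [hi.2] at hj)
    (fun p => hYm p.1 p.2)
  have hi : ∀ i : I, (i.1, true) ∈ I ×ˢ ({true} : Finset Bool) := fun i => by simp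
  have hj : ∀ j : J, (j.1, false) ∈ J ×ˢ ({false} : Finset Bool) := fun j => by simp
  exact h3.comp (φ := fun ξ (i : I) => ξ ⟨(i.1, true), hi i⟩)
    (ψ := fun ξ (j : J) => ξ ⟨(j.1, false), hj j⟩)
    (measurable_pi_lambda _ fun i => measurable_pi_apply _)
    (measurable_pi_lambda _ fun i => measurable_pi_apply _)

/-- If `X` is independent of the pair `(A, B)`, and `A` of `B`, then `(X, A)` is independent
of `B`. -/
theorem indepFun_prodMk_left {𝒪 α β γ : Type*} [MeasurableSpace 𝒪] [MeasurableSpace α]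
    [MeasurableSpace β] [MeasurableSpace γ] {P : Measure 𝒪} [IsProbabilityMeasure P]
    {X : 𝒪 → α} {A : 𝒪 → β} {B : 𝒪 → γ} (hX : Measurable X) (hA : Measurable A)
    (hB : Measurable B) (h : IndepFun X (fun ω => (A ω, B ω)) P) (h' : IndepFun A B P) :
    IndepFun (fun ω => (X ω, A ω)) B P := by
  have hXA : IndepFun X A P := h.comp measurable_id measurable_fst
  rw [indepFun_iff_map_prod_eq_prod_map_map (hX.prodMk hA).aemeasurable hB.aemeasurable]
  rw [indepFun_iff_map_prod_eq_prod_map_map hX.aemeasurable (hA.prodMk hB).aemeasurable,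
    (indepFun_iff_map_prod_eq_prod_map_map hA.aemeasurable hB.aemeasurable).1 h'] at h
  rw [(indepFun_iff_map_prod_eq_prod_map_map hX.aemeasurable hA.aemeasurable).1 hXA]
  have := Measure.isProbabilityMeasure_map (μ := P) hX.aemeasurable
  have := Measure.isProbabilityMeasure_map (μ := P) hA.aemeasurable
  have := Measure.isProbabilityMeasure_map (μ := P) hB.aemeasurable
  apply (MeasurableEquiv.prodAssoc (α := α) (β := β) (γ := γ)).map_measurableEquiv_injective
  rw [Measure.prodAssoc_prod, ← h,
    Measure.map_map MeasurableEquiv.prodAssoc.measurable ((hX.prodMk hA).prodMk hB)]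
  rfl

end

section

/-! ### The noise after a fixed time -/

section Noise

variable {𝒪 : Type*} [MeasurableSpace 𝒪] {P : Measure 𝒪} {N : ℤ → ℝ≥0 → 𝒪 → ℕ}
  {U : ℤ → ℕ → 𝒪 → ℝ}

theorem IsDrivingNoise.regular (h : IsDrivingNoise P N U) (ω : 𝒪) (y : ℤ) :
    RegularPath fun t => N y t ω := (h.poisson y).regularPath ω

theorem IsDrivingNoise.measurable_N (h : IsDrivingNoise P N U) :
    Measurable fun ω (x : ℤ) (t : ℝ≥0) => N x t ω :=
  measurable_pi_lambda _ fun x => (h.poisson x).measurable_path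

theorem IsDrivingNoise.measurable_U' (h : IsDrivingNoise P N U) :
    Measurable fun ω (x : ℤ) (k : ℕ) => U x k ω :=
  measurable_pi_lambda _ fun x => measurable_pi_lambda _ fun k => h.measurable_U x k

/-- The law of a family of independent marks which are uniform on `[0, 1]`. -/
def markLaw : Measure (ℤ → ℕ → ℝ) :=
  (Measure.infinitePi fun _ : ℤ × ℕ => (volume : Measure ℝ).restrict (Set.Icc 0 1)).map
    fun w x k => w (x, k)

instance : IsProbabilityMeasure ((volume : Measure ℝ).restrict (Set.Icc 0 1)) :=
  ⟨by simp⟩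

theorem measurable_curry_marks : Measurable fun (w : ℤ × ℕ → ℝ) (x : ℤ) (k : ℕ) => w (x, k) :=
  measurable_pi_lambda _ fun _ => measurable_pi_lambda _ fun _ => measurable_pi_apply _

instance : IsProbabilityMeasure markLaw :=
  Measure.isProbabilityMeasure_map measurable_curry_marks.aemeasurable

theorem IsDrivingNoise.map_U_uncurried (h : IsDrivingNoise P N U) :
    P.map (fun ω (i : ℤ × ℕ) => U i.1 i.2 ω) =
      Measure.infinitePi fun _ : ℤ × ℕ => (volume : Measure ℝ).restrict (Set.Icc 0 1) := by
  have := h.indep_U.map_fun_eq_infinitePi_map fun i : ℤ × ℕ => h.measurable_U i.1 i.2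
  rw [this]
  congr 1
  funext i
  exact h.uniform i.1 i.2

theorem measurable_uncurried (h : IsDrivingNoise P N U) :
    Measurable fun ω (i : ℤ × ℕ) => U i.1 i.2 ω :=
  measurable_pi_lambda _ fun i => h.measurable_U i.1 i.2

theorem IsDrivingNoise.map_U (h : IsDrivingNoise P N U) :
    P.map (fun ω x k => U x k ω) = markLaw := by
  rw [markLaw, ← h.map_U_uncurried, Measure.map_map measurable_curry_marks (measurable_uncurried h)]
  rfl

theorem shiftIndex_injective (c : ℤ → ℕ) :
    Function.Injective fun i : ℤ × ℕ => (i.1, shiftIndex c i.1 i.2) := by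
  rintro ⟨x, k⟩ ⟨x', k'⟩ h
  simp only [Prod.mk.injEq, shiftIndex] at h
  obtain ⟨rfl, h⟩ := h
  split_ifs at h <;> simp <;> omega

/-- Removing finitely many marks per site does not change the law of the marks. -/
theorem IsDrivingNoise.map_shiftIndex (h : IsDrivingNoise P N U) (c : ℤ → ℕ) :
    P.map (fun ω x k => U x (shiftIndex c x k) ω) = markLaw := by
  have h1 := Measure.map_infinitePi_infinitePi_of_inj
    (P := fun _ : ℤ × ℕ => (volume : Measure ℝ).restrict (Set.Icc 0 1)) (shiftIndex_injective c)
  rw [markLaw, ← h1, ← h.map_U_uncurried, Measure.map_map _ (measurable_uncurried h),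
    Measure.map_map measurable_curry_marks]
  · rfl
  · exact Measurable.comp (by fun_prop) (measurable_uncurried h)
  · fun_prop

open Classical in
/-- The marks of the first `c y` arrivals at every site `y`, the others being set to `0`. -/
def firstMarks (c : ℤ → ℕ) (u : ℤ → ℕ → ℝ) (y : ℤ) (k : ℕ) : ℝ :=
  if 1 ≤ k ∧ k ≤ c y then u y k else 0

theorem comap_marks_le {α : Type*} {m : MeasurableSpace α} {V : α → ℤ → ℕ → ℝ}
    (h : ∀ x k, Measurable fun a => V a x k) : MeasurableSpace.comap V inferInstance ≤ m :=
  Measurable.comap_le (measurable_pi_lambda _ fun x => measurable_pi_lambda _ fun k => h x k)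

/-- The first `c x` marks at the sites `x` are independent of the later ones, for deterministic `c`.
-/
theorem IsDrivingNoise.indepFun_firstMarks (h : IsDrivingNoise P N U) (c : ℤ → ℕ) :
    IndepFun (fun ω => firstMarks c fun x k => U x k ω) (fun ω x k => U x (shiftIndex c x k) ω)
      P := by
  set S : Set (ℤ × ℕ) := {i | 1 ≤ i.2 ∧ i.2 ≤ c i.1} with hS
  have hI := indep_iSup_of_disjoint
    (m := fun i : ℤ × ℕ => MeasurableSpace.comap (U i.1 i.2) inferInstance)
    (fun i => (h.measurable_U i.1 i.2).comap_le) h.indep_U (disjoint_compl_right (a := S))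
  refine indep_of_indep_of_le_left (indep_of_indep_of_le_right hI ?_) ?_
  · refine comap_marks_le fun x k => ?_
    have hmem : (x, shiftIndex c x k) ∈ Sᶜ := by
      simp only [hS, Set.mem_compl_iff, Set.mem_ofPred_eq, shiftIndex]
      split_ifs <;> omega
    exact measurable_iff_comap_le.2 (le_iSup₂_of_le (f := fun (i : ℤ × ℕ) (_ : i ∈ Sᶜ) =>
      MeasurableSpace.comap (U i.1 i.2) inferInstance) _ hmem le_rfl)
  · refine comap_marks_le fun x k => ?_
    unfold firstMarks
    split_ifs with hk
    · have hmem : (x, k) ∈ S := hk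
      exact measurable_iff_comap_le.2 (le_iSup₂_of_le (f := fun (i : ℤ × ℕ) (_ : i ∈ S) =>
        MeasurableSpace.comap (U i.1 i.2) inferInstance) _ hmem le_rfl)
    · exact measurable_const

/-- The counting paths stopped at time `s`. -/
def stopPath (n : ℤ → ℝ≥0 → ℕ) (s : ℝ≥0) : ℤ → ℝ≥0 → ℕ := fun y r => n y (min r s)

theorem IsDrivingNoise.indepFun_stopPath_shiftPath [IsProbabilityMeasure P]
    (h : IsDrivingNoise P N U) (s : ℝ≥0) :
    IndepFun (fun ω => stopPath (fun x t => N x t ω) s) (fun ω => shiftPath (fun x t => N x t ω) s)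
      P := by
  refine indepFun_families (f := fun y ω r => N y (min r s) ω)
    (g := fun y ω r => N y (s + r) ω - N y s ω) (fun y => ?_) (fun y => ?_)
    (fun y => (h.poisson y).indepFun_stop_shift s) ?_
  · exact measurable_pi_lambda _ fun r => (h.poisson y).measurable _
  · exact measurable_pi_lambda _ fun r =>
      ((h.poisson y).measurable _).sub ((h.poisson y).measurable _)
  · exact h.indep_N.comp (fun _ n => (fun r => n (min r s), fun r => n (s + r) - n s)) fun _ =>
      Measurable.prodMk (measurable_pi_lambda _ fun r => measurable_pi_apply _)
        (measurable_pi_lambda _ fun r => (measurable_pi_apply _).sub (measurable_pi_apply _))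

theorem measurable_shiftPath (s : ℝ≥0) : Measurable fun n : ℤ → ℝ≥0 → ℕ => shiftPath n s :=
  measurable_pi_lambda _ fun y => measurable_pi_lambda _ fun t =>
    Measurable.sub (by fun_prop) (by fun_prop)

theorem measurable_stopPath (s : ℝ≥0) : Measurable fun n : ℤ → ℝ≥0 → ℕ => stopPath n s :=
  measurable_pi_lambda _ fun y => measurable_pi_lambda _ fun t =>
    (measurable_pi_apply (min t s)).comp (measurable_pi_apply y)

theorem measurable_firstMarks :
    Measurable fun z : (ℤ → ℕ) × (ℤ → ℕ → ℝ) => firstMarks z.1 z.2 := by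
  refine measurable_pi_lambda _ fun y => measurable_pi_lambda _ fun k => ?_
  unfold firstMarks
  refine Measurable.ite ?_ (by fun_prop) measurable_const
  exact (MeasurableSet.const _).inter (measurableSet_le measurable_const
    ((measurable_pi_apply y).comp measurable_fst))

theorem measurable_shiftMarks :
    Measurable fun z : (ℤ → ℕ) × (ℤ → ℕ → ℝ) => fun (y : ℤ) (k : ℕ) =>
      z.2 y (shiftIndex z.1 y k) := by
  refine measurable_pi_lambda _ fun y => measurable_pi_lambda _ fun k => ?_
  have h1 : Measurable fun q : ℕ × (ℕ → ℝ) => q.2 q.1 :=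
    measurable_from_prod_countable_right fun a => measurable_pi_apply a
  have h2 : Measurable fun z : (ℤ → ℕ) × (ℤ → ℕ → ℝ) => shiftIndex z.1 y k := by
    unfold shiftIndex
    split_ifs
    · exact measurable_const
    · exact Measurable.add (by fun_prop) measurable_const
  exact h1.comp (h2.prodMk (by fun_prop))

/-- The law of all counting paths does not depend on the realization of the noise. -/
theorem IsDrivingNoise.map_N_eq {𝒪' : Type*} [MeasurableSpace 𝒪'] {P' : Measure 𝒪'}
    {N' : ℤ → ℝ≥0 → 𝒪' → ℕ} [IsProbabilityMeasure P] [IsProbabilityMeasure P']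
    (h : ∀ x, IsRateOnePoisson P (N x)) (hi : iIndepFun (fun x ω t => N x t ω) P)
    (h' : ∀ x, IsRateOnePoisson P' (N' x)) (hi' : iIndepFun (fun x ω t => N' x t ω) P') :
    P.map (fun ω x t => N x t ω) = P'.map (fun ω x t => N' x t ω) := by
  rw [hi.map_fun_eq_infinitePi_map fun x => (h x).measurable_path,
    hi'.map_fun_eq_infinitePi_map fun x => (h' x).measurable_path]
  congr 1
  funext x
  exact (h x).map_path_eq (h' x)

end Noise

/-- An initial configuration `X` together with a driving noise that is independent of it. -/
structure Driven {Ω : Type*} [MeasurableSpace Ω] (Q : Measure Ω) (X : Ω → Config)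
    (N : ℤ → ℝ≥0 → Ω → ℕ) (U : ℤ → ℕ → Ω → ℝ) : Prop where
  noise : IsDrivingNoise Q N U
  measurable : Measurable X
  indep : IndepFun X (fun ω => (fun (x : ℤ) (t : ℝ≥0) => N x t ω, fun (x : ℤ) (k : ℕ) => U x k ω)) Q

section Driven

variable {Ω : Type*} [MeasurableSpace Ω] {Q : Measure Ω} {X : Ω → Config}
    {N : ℤ → ℝ≥0 → Ω → ℕ} {U : ℤ → ℕ → Ω → ℝ}

/-- The data revealed up to time `s`: initial configuration, stopped paths, marks of the arrivals
up to time `s`. -/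
def pastInput (s : ℝ≥0) (z : InputSpace) : InputSpace :=
  (z.1, stopPath z.2.1 s, firstMarks (fun y => z.2.1 y s) z.2.2)

/-- The paths and the marks after time `s`. -/
def futureNoise (s : ℝ≥0) (z : (ℤ → ℝ≥0 → ℕ) × (ℤ → ℕ → ℝ)) : (ℤ → ℝ≥0 → ℕ) × (ℤ → ℕ → ℝ) :=
  (shiftPath z.1 s, fun y k => z.2 y (shiftIndex (fun y => z.1 y s) y k))

theorem measurable_pastInput (s : ℝ≥0) : Measurable (pastInput s) := by
  unfold pastInput
  refine measurable_fst.prodMk (((measurable_stopPath s).comp (by fun_prop)).prodMk ?_)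
  exact measurable_firstMarks.comp (Measurable.prodMk
    (measurable_pi_lambda _ fun y => by fun_prop) (by fun_prop))

theorem measurable_futureNoise (s : ℝ≥0) : Measurable (futureNoise s) := by
  unfold futureNoise
  refine ((measurable_shiftPath s).comp (by fun_prop)).prodMk ?_
  exact measurable_shiftMarks.comp (Measurable.prodMk
    (measurable_pi_lambda _ fun y => by fun_prop) (by fun_prop))

/-- The input data of the dynamics at a sample point. -/
def input (X : Ω → Config) (N : ℤ → ℝ≥0 → Ω → ℕ) (U : ℤ → ℕ → Ω → ℝ) (ω : Ω) : InputSpace :=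
  (X ω, fun x t => N x t ω, fun x k => U x k ω)

theorem Driven.measurable_input (h : Driven Q X N U) : Measurable (input X N U) :=
  h.measurable.prodMk (h.noise.measurable_N.prodMk h.noise.measurable_U')

/-- The law of the noise. -/
theorem IsDrivingNoise.map_noise [IsProbabilityMeasure Q] (h : IsDrivingNoise Q N U) :
    Q.map (fun ω => (fun (x : ℤ) (t : ℝ≥0) => N x t ω, fun (x : ℤ) (k : ℕ) => U x k ω)) =
      (Q.map fun ω (x : ℤ) (t : ℝ≥0) => N x t ω).prod markLaw := by
  rw [(indepFun_iff_map_prod_eq_prod_map_map h.measurable_N.aemeasurable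
    h.measurable_U'.aemeasurable).1 h.indep_N_U, h.map_U]

/-- The joint law of the past and of the noise after time `s`. -/
theorem Driven.measure_past_inter_future [IsProbabilityMeasure Q] (h : Driven Q X N U) (s : ℝ≥0)
    {A : Set InputSpace} (hA : MeasurableSet A) {B : Set ((ℤ → ℝ≥0 → ℕ) × (ℤ → ℕ → ℝ))}
    (hB : MeasurableSet B) :
    Q ((fun ω => pastInput s (input X N U ω)) ⁻¹' A ∩
        (fun ω => futureNoise s (input X N U ω).2) ⁻¹' B) =
      Q ((fun ω => pastInput s (input X N U ω)) ⁻¹' A) *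
        ((Q.map fun ω (x : ℤ) (t : ℝ≥0) => N x t ω).prod markLaw) B := by
  have hNm := h.noise.measurable_N
  have hUm := h.noise.measurable_U'
  have := Measure.isProbabilityMeasure_map (μ := Q) hNm.aemeasurable
  set νN : Measure (ℤ → ℝ≥0 → ℕ) := Q.map fun ω (x : ℤ) (t : ℝ≥0) => N x t ω with hνN
  -- the marks are independent of the initial configuration and the paths
  have hXN_U : IndepFun (fun ω => (X ω, fun (x : ℤ) (t : ℝ≥0) => N x t ω))
      (fun ω (x : ℤ) (k : ℕ) => U x k ω) Q :=
    indepFun_prodMk_left h.measurable hNm hUm h.indep h.noise.indep_N_U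
  have hX_N : IndepFun X (fun ω (x : ℤ) (t : ℝ≥0) => N x t ω) Q :=
    h.indep.comp measurable_id measurable_fst
  -- the initial configuration and the stopped paths are independent of the later increments
  have hstop_m : Measurable fun ω => stopPath (fun x t => N x t ω) s :=
    (measurable_stopPath s).comp hNm
  have hshift_m : Measurable fun ω => shiftPath (fun x t => N x t ω) s :=
    (measurable_shiftPath s).comp hNm
  have hXs : IndepFun (fun ω => (X ω, stopPath (fun x t => N x t ω) s))
      (fun ω => shiftPath (fun x t => N x t ω) s) Q :=
    indepFun_prodMk_left h.measurable hstop_m hshift_m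
      (hX_N.comp measurable_id ((measurable_stopPath s).prodMk (measurable_shiftPath s)))
      (h.noise.indepFun_stopPath_shiftPath s)
  -- the law of the shifted paths
  have hlaw_shift : Q.map (fun ω => shiftPath (fun x t => N x t ω) s) = νN := by
    refine IsDrivingNoise.map_N_eq (N := fun x t ω => N x (s + t) ω - N x s ω)
      (fun x => (h.noise.poisson x).shift s) ?_ h.noise.poisson h.noise.indep_N
    exact h.noise.indep_N.comp (fun _ n t => n (s + t) - n s) fun _ =>
      measurable_pi_lambda _ fun r => (measurable_pi_apply _).sub (measurable_pi_apply _)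
  set FA : Set (Config × (ℤ → ℝ≥0 → ℕ) × (ℤ → ℕ → ℝ)) :=
    {z | (z.1, z.2.1, firstMarks (fun y => z.2.1 y s) z.2.2) ∈ A} with hFA
  have hFAm : MeasurableSet FA := by
    refine Measurable.prodMk measurable_fst (Measurable.prodMk (by fun_prop) ?_) hA
    exact measurable_firstMarks.comp (Measurable.prodMk
      (measurable_pi_lambda _ fun y => by fun_prop) (by fun_prop))
  set α : Config × (ℤ → ℝ≥0 → ℕ) → ℝ≥0∞ := fun z => markLaw {u | (z.1, z.2, u) ∈ FA} with hα
  have hαm : Measurable α := by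
    have h1 : MeasurableSet {q : (Config × (ℤ → ℝ≥0 → ℕ)) × (ℤ → ℕ → ℝ) |
        (q.1.1, q.1.2, q.2) ∈ FA} := by
      exact (Measurable.prodMk (by fun_prop) (by fun_prop) : Measurable
        fun q : (Config × (ℤ → ℝ≥0 → ℕ)) × (ℤ → ℕ → ℝ) => (q.1.1, q.1.2, q.2)) hFAm
    exact measurable_measure_prodMk_left h1
  set β : (ℤ → ℝ≥0 → ℕ) → ℝ≥0∞ := fun n => markLaw (Prod.mk n ⁻¹' B) with hβ
  have hβm : Measurable β := measurable_measure_prodMk_left hB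
  -- the event as a set of pairs (initial configuration and paths, marks)
  have key : ∀ {B : Set ((ℤ → ℝ≥0 → ℕ) × (ℤ → ℕ → ℝ))}, MeasurableSet B →
      Q ((fun ω => pastInput s (input X N U ω)) ⁻¹' A ∩
        (fun ω => futureNoise s (input X N U ω).2) ⁻¹' B) =
      (∫⁻ ω, α (X ω, stopPath (fun x t => N x t ω) s) ∂Q) * (νN.prod markLaw) B := by
    intro B hB
    have hβm : Measurable fun n => markLaw (Prod.mk n ⁻¹' B) := measurable_measure_prodMk_left hB
    set C : Set ((Config × (ℤ → ℝ≥0 → ℕ)) × (ℤ → ℕ → ℝ)) :=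
      {q | pastInput s (q.1.1, q.1.2, q.2) ∈ A ∧ futureNoise s (q.1.2, q.2) ∈ B} with hC
    have hCm : MeasurableSet C := by
      refine MeasurableSet.inter ?_ ?_
      · exact ((measurable_pastInput s).comp (by fun_prop : Measurable
          fun q : (Config × (ℤ → ℝ≥0 → ℕ)) × (ℤ → ℕ → ℝ) => (q.1.1, q.1.2, q.2))) hA
      · exact ((measurable_futureNoise s).comp (by fun_prop : Measurable
          fun q : (Config × (ℤ → ℝ≥0 → ℕ)) × (ℤ → ℕ → ℝ) => (q.1.2, q.2))) hB
    have hXNm : Measurable fun ω => (X ω, fun (x : ℤ) (t : ℝ≥0) => N x t ω) :=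
      h.measurable.prodMk hNm
    have h1 := (indepFun_iff_map_prod_eq_prod_map_map hXNm.aemeasurable hUm.aemeasurable).1 hXN_U
    have h2 : Q ((fun ω => pastInput s (input X N U ω)) ⁻¹' A ∩
        (fun ω => futureNoise s (input X N U ω).2) ⁻¹' B) =
        Q.map (fun ω => ((X ω, fun (x : ℤ) (t : ℝ≥0) => N x t ω),
          fun (x : ℤ) (k : ℕ) => U x k ω)) C := by
      rw [Measure.map_apply (hXNm.prodMk hUm) hCm]
      rfl
    rw [h2, h1, h.noise.map_U, Measure.prod_apply hCm,
      lintegral_map (measurable_measure_prodMk_left hCm) hXNm]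
    have h3 : ∀ ω, markLaw (Prod.mk (X ω, fun (x : ℤ) (t : ℝ≥0) => N x t ω) ⁻¹' C) =
        α (X ω, stopPath (fun x t => N x t ω) s) *
          markLaw (Prod.mk (shiftPath (fun x t => N x t ω) s) ⁻¹' B) := by
      intro ω
      set c : ℤ → ℕ := fun y => N y s ω with hc
      have hi := h.noise.indepFun_firstMarks c
      have hm1 : Measurable fun u : ℤ → ℕ → ℝ => firstMarks c u :=
        measurable_firstMarks.comp (by fun_prop : Measurable fun u : ℤ → ℕ → ℝ => (c, u))
      have hm2 : Measurable fun (u : ℤ → ℕ → ℝ) (x : ℤ) (k : ℕ) => u x (shiftIndex c x k) := by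
        fun_prop
      have hA' : MeasurableSet {v : ℤ → ℕ → ℝ | (X ω, stopPath (fun x t => N x t ω) s, v) ∈ A} :=
        (by fun_prop : Measurable fun v : ℤ → ℕ → ℝ =>
          (X ω, stopPath (fun x t => N x t ω) s, v)) hA
      have hB' : MeasurableSet (Prod.mk (shiftPath (fun x t => N x t ω) s) ⁻¹' B) :=
        measurable_prodMk_left hB
      have e1 := hi.measure_inter_preimage_eq_mul _ _ hA' hB'
      have e2 : markLaw (Prod.mk (X ω, fun (x : ℤ) (t : ℝ≥0) => N x t ω) ⁻¹' C) =
          Q ((fun ω => firstMarks c fun x k => U x k ω) ⁻¹'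
              {v | (X ω, stopPath (fun x t => N x t ω) s, v) ∈ A} ∩
            (fun ω x k => U x (shiftIndex c x k) ω) ⁻¹'
              (Prod.mk (shiftPath (fun x t => N x t ω) s) ⁻¹' B)) := by
        rw [← h.noise.map_U, Measure.map_apply hUm (measurable_prodMk_left hCm)]
        rfl
      have e3 : α (X ω, stopPath (fun x t => N x t ω) s) =
          Q ((fun ω => firstMarks c fun x k => U x k ω) ⁻¹'
              {v | (X ω, stopPath (fun x t => N x t ω) s, v) ∈ A}) := by
        have : MeasurableSet {u : ℤ → ℕ → ℝ | (X ω, stopPath (fun x t => N x t ω) s, u) ∈ FA} :=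
          (by fun_prop : Measurable fun v : ℤ → ℕ → ℝ =>
            (X ω, stopPath (fun x t => N x t ω) s, v)) hFAm
        simp only [hα]
        rw [← h.noise.map_U, Measure.map_apply hUm this]
        have hc' : (fun y => stopPath (fun x t => N x t ω) s y s) = c := by
          funext y; simp [stopPath, hc]
        change Q {ω' | (X ω, stopPath (fun x t => N x t ω) s, firstMarks
          (fun y => stopPath (fun x t => N x t ω) s y s) (fun x k => U x k ω')) ∈ A} = _
        rw [hc']
        rfl
      have e4 : markLaw (Prod.mk (shiftPath (fun x t => N x t ω) s) ⁻¹' B) =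
          Q ((fun ω x k => U x (shiftIndex c x k) ω) ⁻¹'
              (Prod.mk (shiftPath (fun x t => N x t ω) s) ⁻¹' B)) := by
        rw [← h.noise.map_shiftIndex c, Measure.map_apply _ hB']
        exact hm2.comp hUm
      rw [e2, e1, ← e3, ← e4]
    simp_rw [h3]
    have h4 := lintegral_mul_eq_lintegral_mul_lintegral_of_indepFun (μ := Q)
      (f := fun ω => α (X ω, stopPath (fun x t => N x t ω) s))
      (g := fun ω => markLaw (Prod.mk (shiftPath (fun x t => N x t ω) s) ⁻¹' B))
      (hαm.comp (h.measurable.prodMk hstop_m)) (hβm.comp hshift_m) (hXs.comp hαm hβm)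
    simp only [Pi.mul_apply] at h4
    rw [h4]
    congr 1
    rw [Measure.prod_apply hB, ← hlaw_shift, lintegral_map hβm hshift_m]
  have h1 := key MeasurableSet.univ
  simp only [Set.preimage_univ, Set.inter_univ, measure_univ, mul_one] at h1
  rw [key hB, h1]

theorem Driven.indepFun_past_future [IsProbabilityMeasure Q] (h : Driven Q X N U) (s : ℝ≥0) :
    IndepFun (fun ω => pastInput s (input X N U ω))
      (fun ω => futureNoise s (input X N U ω).2) Q := by
  rw [indepFun_iff_measure_inter_preimage_eq_mul]
  intro A B hA hB
  have h1 := h.measure_past_inter_future s MeasurableSet.univ hB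
  simp only [Set.preimage_univ, Set.univ_inter, measure_univ, one_mul] at h1
  rw [h.measure_past_inter_future s hA hB, h1]

/-- The noise after a fixed time has the law of the original noise. -/
theorem Driven.map_futureNoise [IsProbabilityMeasure Q] (h : Driven Q X N U) (s : ℝ≥0) :
    Q.map (fun ω => futureNoise s (input X N U ω).2) =
      (Q.map fun ω (x : ℤ) (t : ℝ≥0) => N x t ω).prod markLaw := by
  ext B hB
  have h1 := h.measure_past_inter_future s MeasurableSet.univ hB
  simp only [Set.preimage_univ, Set.univ_inter, measure_univ, one_mul] at h1
  rw [Measure.map_apply _ hB, h1]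
  exact (measurable_futureNoise s).comp h.measurable_input.snd

/-- The counting processes after time `s`. -/
def shiftN (N : ℤ → ℝ≥0 → Ω → ℕ) (s : ℝ≥0) : ℤ → ℝ≥0 → Ω → ℕ :=
  fun x t ω => N x (s + t) ω - N x s ω

/-- The marks of the arrivals after time `s`. -/
def shiftU (N : ℤ → ℝ≥0 → Ω → ℕ) (U : ℤ → ℕ → Ω → ℝ) (s : ℝ≥0) : ℤ → ℕ → Ω → ℝ :=
  fun x k ω => U x (shiftIndex (fun y => N y s ω) x k) ω

/-- The Markov property of the noise: after time `s` it is again a driving noise, independent of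
everything that is a function of the past. -/
theorem Driven.shift [IsProbabilityMeasure Q] (h : Driven Q X N U) (s : ℝ≥0)
    {F : InputSpace → Config} (hF : Measurable F) :
    Driven Q (fun ω => F (pastInput s (input X N U ω))) (shiftN N s) (shiftU N U s) := by
  have hfm : Measurable fun ω => futureNoise s (input X N U ω).2 :=
    (measurable_futureNoise s).comp h.measurable_input.snd
  have hUm : Measurable fun ω x k => shiftU N U s x k ω := hfm.snd
  have hlaw := h.map_futureNoise s
  have hNm := h.noise.measurable_N
  have := Measure.isProbabilityMeasure_map (μ := Q) hNm.aemeasurable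
  have hlawU : Q.map (fun ω x k => shiftU N U s x k ω) = markLaw := by
    have h1 : Q.map (fun ω x k => shiftU N U s x k ω) =
        (Q.map (fun ω => futureNoise s (input X N U ω).2)).map Prod.snd := by
      rw [Measure.map_map measurable_snd hfm]; rfl
    rw [h1, hlaw, Measure.map_snd_prod, measure_univ, one_smul]
  have hlawN :
      Q.map (fun ω x t => shiftN N s x t ω) = Q.map fun ω (x : ℤ) (t : ℝ≥0) => N x t ω := by
    have h1 : Q.map (fun ω x t => shiftN N s x t ω) =
        (Q.map (fun ω => futureNoise s (input X N U ω).2)).map Prod.fst := by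
      rw [Measure.map_map measurable_fst hfm]; rfl
    rw [h1, hlaw, Measure.map_fst_prod, measure_univ, one_smul]
  have hUx : ∀ x k, Measurable (shiftU N U s x k) := fun x k =>
    (measurable_pi_apply k).comp ((measurable_pi_apply x).comp hUm)
  have hunc : Q.map (fun ω (i : ℤ × ℕ) => shiftU N U s i.1 i.2 ω) =
      Measure.infinitePi fun _ : ℤ × ℕ => (volume : Measure ℝ).restrict (Set.Icc 0 1) := by
    have hm : Measurable fun (u : ℤ → ℕ → ℝ) (i : ℤ × ℕ) => u i.1 i.2 := by fun_prop
    have h1 : Q.map (fun ω (i : ℤ × ℕ) => shiftU N U s i.1 i.2 ω) =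
        (Q.map (fun ω x k => shiftU N U s x k ω)).map fun u i => u i.1 i.2 := by
      rw [Measure.map_map hm hUm]; rfl
    rw [h1, hlawU, markLaw, Measure.map_map hm measurable_curry_marks]
    exact Measure.map_id
  have huni : ∀ x k, Q.map (shiftU N U s x k) = (volume : Measure ℝ).restrict (Set.Icc 0 1) := by
    intro x k
    have h1 : Q.map (shiftU N U s x k) =
        (Q.map (fun ω (i : ℤ × ℕ) => shiftU N U s i.1 i.2 ω)).map fun w => w (x, k) := by
      rw [Measure.map_map (measurable_pi_apply _) (measurable_pi_lambda _ fun i => hUx _ _)]; rfl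
    rw [h1, hunc, Measure.infinitePi_map_eval]
  refine ⟨⟨fun x => (h.noise.poisson x).shift s, hUx, huni, ?_, ?_, ?_⟩, ?_, ?_⟩
  · exact h.noise.indep_N.comp (fun _ n t => n (s + t) - n s) fun _ =>
      measurable_pi_lambda _ fun r => (measurable_pi_apply _).sub (measurable_pi_apply _)
  · rw [iIndepFun_iff_map_fun_eq_infinitePi_map fun i => hUx _ _, hunc]
    congr 1
    funext i
    exact (huni _ _).symm
  · refine (indepFun_iff_map_prod_eq_prod_map_map (f := fun ω x t => shiftN N s x t ω)
      hfm.fst.aemeasurable hUm.aemeasurable).2 ?_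
    rw [hlawU, hlawN]
    exact hlaw
  · exact hF.comp ((measurable_pastInput s).comp h.measurable_input)
  · exact (h.indepFun_past_future s).comp hF measurable_id

theorem Driven.map_input [IsProbabilityMeasure Q] (h : Driven Q X N U) :
    Q.map (input X N U) =
      (Q.map X).prod ((Q.map fun ω (x : ℤ) (t : ℝ≥0) => N x t ω).prod markLaw) := by
  rw [← h.noise.map_noise]
  exact (indepFun_iff_map_prod_eq_prod_map_map h.measurable.aemeasurable
    (h.noise.measurable_N.prodMk h.noise.measurable_U').aemeasurable).1 h.indep

/-- The law of the input data is determined by the law of the initial configuration. -/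
theorem Driven.map_input_eq {Ω' : Type*} [MeasurableSpace Ω'] {Q' : Measure Ω'}
    {X' : Ω' → Config} {N' : ℤ → ℝ≥0 → Ω' → ℕ} {U' : ℤ → ℕ → Ω' → ℝ} [IsProbabilityMeasure Q]
    [IsProbabilityMeasure Q'] (h : Driven Q X N U) (h' : Driven Q' X' N' U')
    (hX : Q.map X = Q'.map X') :
    Q.map (input X N U) = Q'.map (input X' N' U') := by
  rw [h.map_input, h'.map_input, hX,
    IsDrivingNoise.map_N_eq h.noise.poisson h.noise.indep_N h'.noise.poisson h'.noise.indep_N]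

theorem RegularPath.stopped {n : ℤ → ℝ≥0 → ℕ} (hn : ∀ y, RegularPath (n y)) (s : ℝ≥0) (y : ℤ) :
    RegularPath (stopPath n s y) := by
  refine ⟨by simp [stopPath, (hn y).zero], fun a b hab => (hn y).mono (min_le_min_right s hab),
    fun t => ?_⟩
  rw [ContinuousWithinAt, nhds_discrete ℕ, tendsto_pure]
  rcases lt_or_ge t s with h | h
  · filter_upwards [(hn y).eventually_eq_right t, nhdsWithin_le_nhds (Iio_mem_nhds h)] with r hr hr'
    simp only [stopPath]
    rw [min_eq_left (le_of_lt hr'), min_eq_left h.le, hr]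
  · filter_upwards [self_mem_nhdsWithin] with r hr
    simp only [stopPath]
    rw [min_eq_right h, min_eq_right (h.trans hr)]

/-- The state on a window at time `s` is a function of the data revealed up to time `s`. -/
theorem windowMap_pastInput (lam : ℝ) (L : ℕ) (R : ℤ) (s : ℝ≥0) {n : ℤ → ℝ≥0 → ℕ}
    (hn : ∀ y, RegularPath (n y)) (u : ℤ → ℕ → ℝ) (σ : Config) :
    windowMap lam L R s (pastInput s (σ, n, u)) = windowState lam n u σ L R s := by
  have hpre := RegularPath.stopped hn s
  rw [pastInput, windowMap_eq lam L R s hpre, windowState_eq_foldl, windowState_eq_foldl]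
  have hs : ∀ y, stopPath n s y s = n y s := fun y => by simp [stopPath]
  have hj : ∀ y k, k ≤ n y s → jumpTime (stopPath n s y) k = jumpTime (n y) k := by
    intro y k hk
    refine le_antisymm ?_ ?_
    · rw [(hpre y).jumpTime_le_iff ((hs y).symm ▸ hk)]
      simp only [stopPath]
      rw [min_eq_left (jumpTime_le hk)]
      exact (hn y).le_apply_jumpTime hk
    · rw [(hn y).jumpTime_le_iff hk]
      exact ((hpre y).le_apply_jumpTime ((hs y).symm ▸ hk)).trans ((hn y).mono (min_le_left _ _))
  have harr : arrivals (stopPath n s) L R s = arrivals n L R s := by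
    refine arrivals_eq_of_mem_iff (arrivals_nodup ..) (arrivals_sorted ..) fun e => ?_
    rw [mem_arrivals, mem_arrivals]
    constructor
    · rintro ⟨y, k, hy, hk, rfl⟩
      exact ⟨y, k, hy, by rwa [hs], by rw [hj y k hk.2]⟩
    · rintro ⟨y, k, hy, hk, rfl⟩
      rw [hs] at hk
      exact ⟨y, k, hy, hk, by rw [hj y k hk.2]⟩
  rw [harr]
  refine List.foldl_ext _ _ _ fun τ e he => ?_
  obtain ⟨y, k, hy, hk, rfl⟩ := mem_arrivals.1 he
  change update lam τ y (firstMarks (fun y => n y s) u y k) = update lam τ y (u y k)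
  rw [firstMarks, if_pos hk]

/-- The limiting process at time `s` is a function of the data revealed up to time `s`. -/
theorem limitMap_pastInput (lam : ℝ) (s : ℝ≥0) {n : ℤ → ℝ≥0 → ℕ}
    (hn : ∀ y, RegularPath (n y)) (u : ℤ → ℕ → ℝ) (σ : Config) :
    limitMap lam s (pastInput s (σ, n, u)) = limitProcess lam n u σ s := by
  have h : ∀ (L : ℕ) (x : ℤ), halfLineProcess lam (stopPath n s)
      (firstMarks (fun y => n y s) u) σ L s x = halfLineProcess lam n u σ L s x := by
    intro L x
    have := congrFun (windowMap_pastInput lam L x s hn u σ) x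
    rw [pastInput, windowMap_eq lam L x s (RegularPath.stopped hn s)] at this
    exact this
  rw [pastInput, limitMap_eq lam s (RegularPath.stopped hn s)]
  funext x
  classical
  unfold limitProcess
  exact if_congr (eventually_congr (Eventually.of_forall fun L => by dsimp only; rw [h])) rfl rfl

end Driven

end

section

/-! ### Bernoulli measure and the exchange dynamics -/

instance (p : unitInterval) : IsProbabilityMeasure (productBernoulli p) := by
  unfold productBernoulli; infer_instance

/-- The probability of the spin `η` under the Bernoulli measure. -/
def spinWeight (p : unitInterval) (η : ℤˣ) : ℝ≥0∞ := bernoulliMeasure (1 : ℤˣ) (-1) p {η}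

theorem spinWeight_ne_top (p : unitInterval) (η : ℤˣ) : spinWeight p η ≠ ∞ := measure_ne_top _ _

theorem spinWeight_one (p : unitInterval) : spinWeight p 1 = ENNReal.ofReal p := by
  classical
  rw [spinWeight, bernoulliMeasure_apply p (measurableSet_singleton _)]
  have : (-1 : ℤˣ) ≠ 1 := by decide
  simp only [Set.mem_singleton_iff, if_true, this, if_false]
  rw [← ENNReal.ofReal_coe_nnreal, unitInterval.coe_toNNReal]

theorem spinWeight_neg_one (p : unitInterval) : spinWeight p (-1) = ENNReal.ofReal (1 - p) := by
  classical
  rw [spinWeight, bernoulliMeasure_apply p (measurableSet_singleton _)]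
  have : (1 : ℤˣ) ≠ -1 := by decide
  simp only [Set.mem_singleton_iff, if_true, this, if_false]
  rw [← ENNReal.ofReal_coe_nnreal, unitInterval.coe_toNNReal, unitInterval.coe_symm_eq]

theorem spinWeight_ne_zero {p : unitInterval} (hp0 : 0 < p) (hp1 : p < 1) (η : ℤˣ) :
    spinWeight p η ≠ 0 := by
  rcases Int.units_eq_one_or η with rfl | rfl
  · rw [spinWeight_one]
    simpa using hp0
  · rw [spinWeight_neg_one]
    simpa using hp1

/-- Under Bernoulli measure, the spin at one site can be integrated out first. -/
theorem lintegral_productBernoulli_update (p : unitInterval) (y : ℤ) {f : Config → ℝ≥0∞}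
    (hf : Measurable f) :
    ∫⁻ σ, f σ ∂productBernoulli p =
      ∑ v : ℤˣ, spinWeight p v * ∫⁻ σ, f (Function.update σ y v) ∂productBernoulli p := by
  have hm : Measurable fun q : Config × ℤˣ => Function.update q.1 y q.2 := by
    refine measurable_pi_lambda _ fun x => ?_
    by_cases hx : x = y
    · subst hx; simpa using measurable_snd
    · simp only [Function.update_of_ne hx]
      exact (measurable_pi_apply x).comp measurable_fst
  have key : ((productBernoulli p).prod (bernoulliMeasure (1 : ℤˣ) (-1) p)).map
      (fun q : Config × ℤˣ => Function.update q.1 y q.2) = productBernoulli p := by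
    refine Measure.eq_infinitePi _ fun s t ht => ?_
    rw [Measure.map_apply hm (.pi s.countable_toSet fun _ _ => ht _)]
    have hset : (fun q : Config × ℤˣ => Function.update q.1 y q.2) ⁻¹' (Set.pi s t) =
        (Set.pi (s.erase y : Finset ℤ) t) ×ˢ (if y ∈ s then t y else Set.univ) := by
      ext ⟨σ, v⟩
      simp only [Set.mem_preimage, Set.mem_pi, Finset.mem_coe, Set.mem_prod, Finset.mem_erase]
      constructor
      · intro h
        refine ⟨fun i hi => ?_, ?_⟩
        · simpa [Function.update_of_ne hi.1] using h i hi.2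
        · split_ifs with hy
          · simpa using h y hy
          · trivial
      · rintro ⟨h1, h2⟩ i hi
        by_cases hiy : i = y
        · subst hiy; simpa [hi] using h2
        · simpa [Function.update_of_ne hiy] using h1 i ⟨hiy, hi⟩
    rw [hset, Measure.prod_prod, productBernoulli, Measure.infinitePi_pi _ fun i _ => ht i]
    split_ifs with hy
    · rw [mul_comm, Finset.mul_prod_erase s (fun i => bernoulliMeasure (1 : ℤˣ) (-1) p (t i)) hy]
    · rw [measure_univ, mul_one, Finset.erase_eq_of_notMem hy]
  conv_lhs => rw [← key]
  rw [lintegral_map hf hm,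
    lintegral_prod_symm (fun q : Config × ℤˣ => f (Function.update q.1 y q.2))
      (hf.comp hm).aemeasurable, lintegral_fintype]
  exact Finset.sum_congr rfl fun v _ => mul_comm _ _

/-- Flip the spin at `y`. -/
def flip (y : ℤ) (σ : Config) : Config := Function.update σ y (-σ y)

theorem flip_apply_self (y : ℤ) (σ : Config) : flip y σ y = -σ y := by simp [flip]

theorem flip_apply_of_ne {x y : ℤ} (h : x ≠ y) (σ : Config) : flip y σ x = σ x := by
  simp [flip, h]

theorem measurable_flip (y : ℤ) : Measurable (flip y) := by
  refine measurable_pi_lambda _ fun x => ?_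
  by_cases hx : x = y
  · subst hx
    simp only [flip_apply_self]
    exact (measurable_of_countable Neg.neg).comp (measurable_pi_apply x)
  · simp only [flip_apply_of_ne hx]
    exact measurable_pi_apply x

theorem neg_ne_self_unit (η : ℤˣ) : -η ≠ η := by
  rcases Int.units_eq_one_or η with rfl | rfl <;> decide

theorem ne_iff_eq_neg_unit {a b : ℤˣ} : a ≠ b ↔ a = -b := by
  rcases Int.units_eq_one_or a with rfl | rfl <;> rcases Int.units_eq_one_or b with rfl | rfl <;>
    decide

theorem measurableSet_spin_eq (x : ℤ) (η : ℤˣ) : MeasurableSet {σ : Config | σ x = η} :=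
  measurableSet_eq_fun (measurable_pi_apply x) measurable_const

theorem sum_units (f : ℤˣ → ℝ≥0∞) (η : ℤˣ) : ∑ v : ℤˣ, f v = f η + f (-η) := by
  have : (Finset.univ : Finset ℤˣ) = {η, -η} := by
    ext v
    simp only [Finset.mem_univ, Finset.mem_insert, Finset.mem_singleton, true_iff]
    by_cases h : v = η
    · exact Or.inl h
    · exact Or.inr (ne_iff_eq_neg_unit.1 h)
  rw [this, Finset.sum_pair (neg_ne_self_unit η).symm]

open Classical in
/-- The effect of a single spin flip on the Bernoulli measure. -/
theorem lintegral_flip (p : unitInterval) (y : ℤ) (η : ℤˣ) {f : Config → ℝ≥0∞} (hf : Measurable f) :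
    spinWeight p (-η) * ∫⁻ σ, (if σ y = η then f (flip y σ) else 0) ∂productBernoulli p =
      spinWeight p η * ∫⁻ σ, (if σ y = -η then f σ else 0) ∂productBernoulli p := by
  have hset := measurableSet_spin_eq y
  rw [lintegral_productBernoulli_update p y (f := fun σ => if σ y = η then f (flip y σ) else 0)
      (Measurable.ite (hset η) (hf.comp (measurable_flip y)) measurable_const),
    lintegral_productBernoulli_update p y (f := fun σ => if σ y = -η then f σ else 0)
      (Measurable.ite (hset (-η)) hf measurable_const),
    sum_units _ η, sum_units _ η]
  have h1 : ∀ (σ : Config) (v : ℤˣ), flip y (Function.update σ y v) = Function.update σ y (-v) := by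
    intro σ v; simp [flip]
  have h2 : η ≠ -η := (neg_ne_self_unit η).symm
  have h3 : -η ≠ η := neg_ne_self_unit η
  simp only [Function.update_self, h1, if_true, h2, h3, if_false, lintegral_zero, mul_zero,
    add_zero, zero_add]
  ring

/-- The spin at `y` is `-η` and it is followed by spins `η` up to `z`. -/
def PrecedesBlock (η : ℤˣ) (σ : Config) (y z : ℤ) : Prop :=
  σ y = -η ∧ ∀ w, y < w → w ≤ z → σ w = η

/-- A block of spins `η` ending at `z` is preceded by only one site. -/
theorem PrecedesBlock.unique {η : ℤˣ} {σ : Config} {y y' z : ℤ} (hy : y ≤ z) (hy' : y' ≤ z)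
    (h : PrecedesBlock η σ y z) (h' : PrecedesBlock η σ y' z) : y = y' := by
  rcases lt_trichotomy y y' with hlt | heq | hlt
  · have := h.2 y' hlt hy'
    rw [h'.1] at this
    exact absurd this (neg_ne_self_unit η)
  · exact heq
  · have := h'.2 y hlt hy
    rw [h.1] at this
    exact absurd this (neg_ne_self_unit η)

theorem measurableSet_precedesBlock (η : ℤˣ) (y z : ℤ) :
    MeasurableSet {σ | PrecedesBlock η σ y z} := by
  have : {σ : Config | PrecedesBlock η σ y z} =
      {σ | σ y = -η} ∩ ⋂ w, ⋂ (_ : y < w), ⋂ (_ : w ≤ z), {σ | σ w = η} := by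
    ext σ; simp [PrecedesBlock]
  rw [this]
  refine (measurableSet_spin_eq y _).inter ?_
  exact MeasurableSet.iInter fun w => MeasurableSet.iInter fun _ => MeasurableSet.iInter fun _ =>
    measurableSet_spin_eq w _

open Classical in
theorem sum_precedesBlock_le (η : ℤˣ) (σ : Config) (s : Finset ℤ) (z : ℤ) (hs : ∀ y ∈ s, y ≤ z) :
    ∑ y ∈ s, (if PrecedesBlock η σ y z then (1 : ℝ≥0∞) else 0) ≤ 1 := by
  rw [Finset.sum_boole]
  have : (s.filter fun y => PrecedesBlock η σ y z).card ≤ 1 := by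
    refine Finset.card_le_one.2 fun a ha b hb => ?_
    rw [Finset.mem_filter] at ha hb
    exact ha.2.unique (hs a ha.1) (hs b hb.1) hb.2
  exact_mod_cast this

open Classical in
/-- Exchanging a spin `η` at `y` with the first opposite spin, which is at `z`, maps Bernoulli
measure to itself; the new configuration has a block of spins `η` in `(y, z]`, preceded
by `-η`. -/
theorem lintegral_exchange_inside {p : unitInterval} (hp0 : 0 < p) (hp1 : p < 1) (η : ℤˣ)
    {y z : ℤ} (hyz : y < z) {g : Config → ℝ≥0∞} (hg : Measurable g) :
    ∫⁻ σ, (if σ y = η ∧ (∀ w, y < w → w < z → σ w = η) ∧ σ z = -η then g (flip z (flip y σ)) else 0)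
        ∂productBernoulli p =
      ∫⁻ σ, (if PrecedesBlock η σ y z then g σ else 0) ∂productBernoulli p := by
  have hmid : MeasurableSet {σ : Config | ∀ w, y < w → w < z → σ w = η} := by
    have : {σ : Config | ∀ w, y < w → w < z → σ w = η} =
        ⋂ w, ⋂ (_ : y < w), ⋂ (_ : w < z), {σ | σ w = η} := by ext σ; simp
    rw [this]
    exact MeasurableSet.iInter fun w => MeasurableSet.iInter fun _ => MeasurableSet.iInter fun _ =>
      measurableSet_spin_eq w _
  have hset := measurableSet_spin_eq
  have h1 := lintegral_flip p y η (f := fun τ =>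
    if (∀ w, y < w → w < z → τ w = η) ∧ τ z = -η then g (flip z τ) else 0)
    (Measurable.ite (hmid.inter (hset z (-η))) (hg.comp (measurable_flip z)) measurable_const)
  have h2 := lintegral_flip p z (-η) (f := fun ρ =>
    if ρ y = -η ∧ (∀ w, y < w → w < z → ρ w = η) then g ρ else 0)
    (Measurable.ite ((hset y (-η)).inter hmid) hg measurable_const)
  rw [neg_neg] at h2
  have e1 : ∀ σ : Config, (if σ y = η then
      (if (∀ w, y < w → w < z → flip y σ w = η) ∧ flip y σ z = -η then g (flip z (flip y σ)) else 0)
      else 0) = (if σ y = η ∧ (∀ w, y < w → w < z → σ w = η) ∧ σ z = -η then g (flip z (flip y σ))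
      else 0) := by
    intro σ
    have : (∀ w, y < w → w < z → flip y σ w = η) ↔ ∀ w, y < w → w < z → σ w = η :=
      forall_congr' fun w => forall_congr' fun hw => by rw [flip_apply_of_ne hw.ne']
    simp only [this, flip_apply_of_ne hyz.ne', ← ite_and]
  have e2 : ∀ σ : Config, (if σ y = -η then
      (if (∀ w, y < w → w < z → σ w = η) ∧ σ z = -η then g (flip z σ) else 0) else 0) =
      (if σ z = -η then (if flip z σ y = -η ∧ (∀ w, y < w → w < z → flip z σ w = η) then
        g (flip z σ) else 0) else 0) := by
    intro σ
    have : (∀ w, y < w → w < z → flip z σ w = η) ↔ ∀ w, y < w → w < z → σ w = η :=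
      forall_congr' fun w => forall_congr' fun _ => forall_congr' fun hw => by
        rw [flip_apply_of_ne hw.ne]
    simp only [this, flip_apply_of_ne hyz.ne, ← ite_and]
    exact if_congr (by tauto) rfl rfl
  have e3 : ∀ σ : Config, (if σ z = η then
      (if σ y = -η ∧ (∀ w, y < w → w < z → σ w = η) then g σ else 0) else 0) =
      if PrecedesBlock η σ y z then g σ else 0 := by
    intro σ
    rw [← ite_and]
    refine if_congr ?_ rfl rfl
    constructor
    · rintro ⟨h1, h2, h3⟩
      refine ⟨h2, fun w hw hwz => ?_⟩
      rcases hwz.eq_or_lt with rfl | h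
      · exact h1
      · exact h3 w hw h
    · rintro ⟨h1, h2⟩
      exact ⟨h2 z hyz le_rfl, h1, fun w hw hwz => h2 w hw hwz.le⟩
  simp only [e1] at h1
  simp only [e2] at h1
  simp only [e3] at h2
  rw [h2] at h1
  exact (ENNReal.mul_right_inj (spinWeight_ne_zero hp0 hp1 _) (spinWeight_ne_top _ _)).1 h1

open Classical in
/-- An exchange that leaves the window `(-∞, R]` to the right acts there as a single flip. -/
theorem lintegral_exchange_exit {p : unitInterval} (hp0 : 0 < p) (hp1 : p < 1) (η : ℤˣ)
    {y R : ℤ} {g : Config → ℝ≥0∞} (hg : Measurable g) :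
    ∫⁻ σ, (if σ y = η ∧ (∀ w, y < w → w ≤ R → σ w = η) then g (flip y σ) else 0)
        ∂productBernoulli p =
      spinWeight p η / spinWeight p (-η) *
        ∫⁻ σ, (if PrecedesBlock η σ y R then g σ else 0) ∂productBernoulli p := by
  have hmid : MeasurableSet {σ : Config | ∀ w, y < w → w ≤ R → σ w = η} := by
    have : {σ : Config | ∀ w, y < w → w ≤ R → σ w = η} =
        ⋂ w, ⋂ (_ : y < w), ⋂ (_ : w ≤ R), {σ | σ w = η} := by ext σ; simp
    rw [this]
    exact MeasurableSet.iInter fun w => MeasurableSet.iInter fun _ => MeasurableSet.iInter fun _ =>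
      measurableSet_spin_eq w _
  have h1 := lintegral_flip p y η (f := fun τ =>
    if (∀ w, y < w → w ≤ R → τ w = η) then g τ else 0) (Measurable.ite hmid hg measurable_const)
  have e1 : ∀ σ : Config, (if σ y = η then
      (if (∀ w, y < w → w ≤ R → flip y σ w = η) then g (flip y σ) else 0) else 0) =
      (if σ y = η ∧ (∀ w, y < w → w ≤ R → σ w = η) then g (flip y σ) else 0) := by
    intro σ
    have : (∀ w, y < w → w ≤ R → flip y σ w = η) ↔ ∀ w, y < w → w ≤ R → σ w = η :=
      forall_congr' fun w => forall_congr' fun hw => by rw [flip_apply_of_ne hw.ne']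
    simp only [this, ← ite_and]
  have e2 : ∀ σ : Config, (if σ y = -η then
      (if (∀ w, y < w → w ≤ R → σ w = η) then g σ else 0) else 0) =
      if PrecedesBlock η σ y R then g σ else 0 := by
    intro σ
    simp only [← ite_and]
    exact if_congr Iff.rfl rfl rfl
  simp only [e1, e2] at h1
  rw [ENNReal.div_eq_inv_mul, mul_assoc, ← h1, ← mul_assoc,
    ENNReal.inv_mul_cancel (spinWeight_ne_zero hp0 hp1 _) (spinWeight_ne_top _ _), one_mul]

open Classical in
/-- Summed over all sites of a window, the exchanges of spins `η` produce at most as much mass as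
there are spins `η` in the window, up to a boundary term which does not grow with the window. -/
theorem sum_lintegral_exchange_le {p : unitInterval} (hp0 : 0 < p) (hp1 : p < 1) (η : ℤˣ) (L : ℕ)
    (R : ℤ) {g : Config → ℝ≥0∞} (hg : Measurable g) (hgW : DependsOn g (Set.Icc (-(L : ℤ)) R)) :
    ∑ y ∈ Finset.Icc (-(L : ℤ)) R,
        ∫⁻ σ, (if σ y = η then g (exchange σ y) else 0) ∂productBernoulli p ≤
      ∑ y ∈ Finset.Icc (-(L : ℤ)) R, ∫⁻ σ, (if σ y = η then g σ else 0) ∂productBernoulli p +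
        spinWeight p η / spinWeight p (-η) * ∫⁻ σ, g σ ∂productBernoulli p := by
  set π := productBernoulli p with hπ
  set W := Finset.Icc (-(L : ℤ)) R with hW
  have hPm : ∀ y z, Measurable fun σ : Config => if PrecedesBlock η σ y z then g σ else 0 :=
    fun y z => Measurable.ite (measurableSet_precedesBlock η y z) hg measurable_const
  have hset := measurableSet_spin_eq
  have hinm : ∀ y z, Measurable fun σ : Config =>
      if σ y = η ∧ (∀ w, y < w → w < z → σ w = η) ∧ σ z = -η then g (flip z (flip y σ)) else 0 := by
    intro y z
    refine Measurable.ite ((hset y η).inter (MeasurableSet.inter ?_ (hset z (-η))))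
      (hg.comp ((measurable_flip z).comp (measurable_flip y))) measurable_const
    have : {σ : Config | ∀ w, y < w → w < z → σ w = η} =
        ⋂ w, ⋂ (_ : y < w), ⋂ (_ : w < z), {σ | σ w = η} := by ext σ; simp
    change MeasurableSet {σ : Config | ∀ w, y < w → w < z → σ w = η}
    rw [this]
    exact MeasurableSet.iInter fun w => MeasurableSet.iInter fun _ => MeasurableSet.iInter fun _ =>
      hset w η
  -- one site
  have hone : ∀ y ∈ W, ∫⁻ σ, (if σ y = η then g (exchange σ y) else 0) ∂π ≤
      ∑ z ∈ Finset.Ioc y R, ∫⁻ σ, (if PrecedesBlock η σ y z then g σ else 0) ∂π +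
        spinWeight p η / spinWeight p (-η) *
          ∫⁻ σ, (if PrecedesBlock η σ y R then g σ else 0) ∂π := by
    intro y hy
    rw [hW, Finset.mem_Icc] at hy
    -- according to the position of the first opposite spin, or to its absence from the window
    have hpt : ∀ σ : Config, (if σ y = η then g (exchange σ y) else 0) ≤
        ∑ z ∈ Finset.Ioc y R, (if σ y = η ∧ (∀ w, y < w → w < z → σ w = η) ∧ σ z = -η then
          g (flip z (flip y σ)) else 0) +
        (if σ y = η ∧ (∀ w, y < w → w ≤ R → σ w = η) then g (flip y σ) else 0) := by
      intro σ
      by_cases hσ : σ y = η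
      swap
      · rw [if_neg hσ]; exact zero_le
      rw [if_pos hσ]
      by_cases hall : ∀ w, y < w → w ≤ R → σ w = η
      · have : g (exchange σ y) = g (flip y σ) := by
          refine hgW fun x hx => ?_
          unfold exchange
          by_cases hxy : x = y
          · subst hxy; rw [if_pos (Or.inl rfl), flip_apply_self]
          · rw [if_neg, flip_apply_of_ne hxy]
            rintro (h | h)
            · exact hxy h
            · have := hall x h.1 hx.2
              rw [h.2.1, hσ] at this
              exact neg_ne_self_unit η this
        rw [if_pos ⟨hσ, hall⟩, this]
        exact le_add_self
      · push Not at hall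
        obtain ⟨w₀, hw₀⟩ := hall
        -- the first opposite spin
        obtain ⟨z, hz, hzmin⟩ : ∃ z, (y < z ∧ σ z ≠ η) ∧ ∀ w, y < w → w < z → σ w = η := by
          obtain ⟨z, hz, hmin⟩ := Int.exists_least_of_bdd (P := fun z => y < z ∧ σ z ≠ η)
            ⟨y, fun z hz => hz.1.le⟩ ⟨w₀, hw₀.1, hw₀.2.2⟩
          refine ⟨z, hz, fun w h1 h2 => ?_⟩
          by_contra h
          exact absurd (hmin w ⟨h1, h⟩) (not_le.2 h2)
        have hzR : z ≤ R := by
          by_contra h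
          exact hw₀.2.2 (hzmin w₀ hw₀.1 (hw₀.2.1.trans_lt (not_le.1 h)))
        have hzη : σ z = -η := ne_iff_eq_neg_unit.1 hz.2
        have hex : exchange σ y = flip z (flip y σ) := by
          funext x
          unfold exchange
          by_cases hxz : x = z
          · subst hxz
            rw [if_pos (Or.inr ⟨hz.1, by rw [hzη, hσ], fun w h1 h2 => by rw [hzmin w h1 h2, hσ]⟩),
              flip_apply_self, flip_apply_of_ne hz.1.ne']
          · rw [flip_apply_of_ne hxz]
            by_cases hxy : x = y
            · subst hxy; rw [if_pos (Or.inl rfl), flip_apply_self]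
            · rw [flip_apply_of_ne hxy, if_neg]
              rintro (h | h)
              · exact hxy h
              · rcases lt_or_gt_of_ne hxz with h' | h'
                · have := h.2.1
                  rw [hzmin x h.1 h', hσ] at this
                  exact neg_ne_self_unit η this.symm
                · have := h.2.2 z hz.1 h'
                  rw [hσ] at this
                  exact hz.2 this
        refine le_trans ?_ le_self_add
        refine le_trans ?_ (Finset.single_le_sum (fun _ _ => zero_le)
          (Finset.mem_Ioc.2 ⟨hz.1, hzR⟩))
        rw [if_pos ⟨hσ, hzmin, hzη⟩, hex]
    calc ∫⁻ σ, (if σ y = η then g (exchange σ y) else 0) ∂π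
        ≤ ∫⁻ σ, (∑ z ∈ Finset.Ioc y R, (if σ y = η ∧ (∀ w, y < w → w < z → σ w = η) ∧ σ z = -η then
          g (flip z (flip y σ)) else 0) +
        (if σ y = η ∧ (∀ w, y < w → w ≤ R → σ w = η) then g (flip y σ) else 0)) ∂π :=
          lintegral_mono hpt
      _ = _ := by
          rw [lintegral_add_left (Finset.measurable_sum _ fun z _ => hinm y z),
            lintegral_finsetSum _ fun z _ => hinm y z, lintegral_exchange_exit hp0 hp1 η hg]
          congr 1
          refine Finset.sum_congr rfl fun z hz => ?_
          exact lintegral_exchange_inside hp0 hp1 η (Finset.mem_Ioc.1 hz).1 hg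
  refine (Finset.sum_le_sum hone).trans ?_
  rw [Finset.sum_add_distrib, ← Finset.mul_sum]
  -- for each `z`, at most one site precedes the block of spins `η` that ends at `z`
  gcongr ?_ + _ * ?_
  · have hswap : ∑ y ∈ W, ∑ z ∈ Finset.Ioc y R,
        ∫⁻ σ, (if PrecedesBlock η σ y z then g σ else 0) ∂π =
        ∑ z ∈ W, ∑ y ∈ Finset.Ico (-(L : ℤ)) z,
          ∫⁻ σ, (if PrecedesBlock η σ y z then g σ else 0) ∂π := by
      refine Finset.sum_comm' fun y z => ?_
      simp only [hW, Finset.mem_Icc, Finset.mem_Ioc, Finset.mem_Ico]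
      omega
    rw [hswap]
    refine Finset.sum_le_sum fun z hz => ?_
    rw [← lintegral_finsetSum _ fun y _ => hPm y z]
    refine lintegral_mono fun σ => ?_
    by_cases hσ : σ z = η
    · rw [if_pos hσ]
      have : ∀ y, (if PrecedesBlock η σ y z then g σ else 0) =
          (if PrecedesBlock η σ y z then 1 else 0) * g σ := fun y => by simp
      simp only [this]
      rw [← Finset.sum_mul]
      calc _ ≤ 1 * g σ := by
            gcongr
            exact sum_precedesBlock_le η σ _ z fun y hy => (Finset.mem_Ico.1 hy).2.le
        _ = g σ := one_mul _
    · rw [if_neg hσ]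
      refine (Finset.sum_eq_zero fun y hy => if_neg fun h => hσ ?_).le
      exact h.2 z (Finset.mem_Ico.1 hy).2 le_rfl
  · rw [← lintegral_finsetSum _ fun y _ => hPm y R]
    refine lintegral_mono fun σ => ?_
    have : ∀ y, (if PrecedesBlock η σ y R then g σ else 0) =
        (if PrecedesBlock η σ y R then 1 else 0) * g σ := fun y => by simp
    simp only [this]
    rw [← Finset.sum_mul]
    calc _ ≤ 1 * g σ := by
          gcongr
          exact sum_precedesBlock_le η σ _ R fun y hy => (Finset.mem_Icc.1 hy).2
      _ = g σ := one_mul _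

end

section

/-! ### Numbers of arrivals in a short time -/

section Counts

variable {𝒪 : Type*} [MeasurableSpace 𝒪] {P : Measure 𝒪} {N : ℤ → ℝ≥0 → 𝒪 → ℕ}
    {U : ℤ → ℕ → 𝒪 → ℝ}

theorem IsRateOnePoisson.map_eq {N : ℝ≥0 → 𝒪 → ℕ} (h : IsRateOnePoisson P N) (t : ℝ≥0) :
    P.map (N t) = poissonMeasure t := by
  have := h.law 0 t zero_le
  simpa [h.zero] using this

theorem IsDrivingNoise.measure_counts (h : IsDrivingNoise P N U) (W : Finset ℤ) (t : ℝ≥0)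
    (k : ℤ → ℕ) :
    P {ω | ∀ y ∈ W, N y t ω = k y} = ∏ y ∈ W, poissonMeasure t {k y} := by
  have hI : iIndepFun (fun y ω => N y t ω) P :=
    h.indep_N.comp (fun _ n => n t) fun _ => measurable_pi_apply t
  have := hI.measure_inter_preimage_eq_mul W (sets := fun y => {k y})
    fun y _ => measurableSet_singleton _
  have hset : {ω | ∀ y ∈ W, N y t ω = k y} = ⋂ y ∈ W, (fun ω => N y t ω) ⁻¹' {k y} := by
    ext ω; simp
  rw [hset, this]
  refine Finset.prod_congr rfl fun y _ => ?_
  rw [← (h.poisson y).map_eq t, Measure.map_apply ((h.poisson y).measurable t)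
    (measurableSet_singleton _)]

theorem IsDrivingNoise.measurableSet_counts (h : IsDrivingNoise P N U) (W : Finset ℤ) (t : ℝ≥0)
    (k : ℤ → ℕ) : MeasurableSet {ω | ∀ y ∈ W, N y t ω = k y} := by
  have : {ω | ∀ y ∈ W, N y t ω = k y} = ⋂ y ∈ W, (fun ω => N y t ω) ⁻¹' {k y} := by
    ext ω; simp
  rw [this]
  exact W.measurableSet_biInter fun y _ => (h.poisson y).measurable t (measurableSet_singleton _)

theorem IsDrivingNoise.measure_noArrival (h : IsDrivingNoise P N U) (W : Finset ℤ) (t : ℝ≥0) :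
    P {ω | ∀ y ∈ W, N y t ω = 0} = ENNReal.ofReal (Real.exp (-(W.card * t))) := by
  rw [h.measure_counts W t fun _ => 0]
  simp only [poissonMeasure_singleton, pow_zero, Nat.factorial_zero, Nat.cast_one, div_one, mul_one,
    Finset.prod_const]
  rw [← ENNReal.ofReal_pow (Real.exp_pos _).le, ← Real.exp_nat_mul]
  ring_nf

theorem IsDrivingNoise.measure_singleArrival (h : IsDrivingNoise P N U) {W : Finset ℤ} (t : ℝ≥0)
    {y : ℤ} (hy : y ∈ W) :
    P {ω | ∀ z ∈ W, N z t ω = if z = y then 1 else 0} =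
      t * ENNReal.ofReal (Real.exp (-(W.card * t))) := by
  rw [h.measure_counts W t fun z => if z = y then 1 else 0]
  have : ∀ z ∈ W, poissonMeasure t {if z = y then 1 else 0} =
      (if z = y then (t : ℝ≥0∞) else 1) * ENNReal.ofReal (Real.exp (-t)) := by
    intro z _
    split_ifs with hz
    · rw [poissonMeasure_singleton, pow_one, Nat.factorial_one, Nat.cast_one, div_one, mul_comm,
        ENNReal.ofReal_mul (p := (t : ℝ)) t.2, ENNReal.ofReal_coe_nnreal]
    · simp [poissonMeasure_singleton]
  rw [Finset.prod_congr rfl this, Finset.prod_mul_distrib, Finset.prod_ite_eq' W y, if_pos hy,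
    Finset.prod_const, ← ENNReal.ofReal_pow (Real.exp_pos _).le, ← Real.exp_nat_mul]
  ring_nf

theorem one_sub_exp_neg_mul_le {x : ℝ} (hx : 0 ≤ x) : 1 - Real.exp (-x) * (1 + x) ≤ x ^ 2 := by
  nlinarith [Real.add_one_le_exp (-x), mul_le_mul_of_nonneg_right (Real.add_one_le_exp (-x))
    (by linarith : 0 ≤ 1 + x)]

theorem exp_neg_mul_le_one {x : ℝ} : Real.exp (-x) * (1 + x) ≤ 1 := by
  rw [Real.exp_neg, inv_mul_le_iff₀ (Real.exp_pos _), mul_one, add_comm]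
  exact Real.add_one_le_exp x

/-- It is unlikely that a finite set of sites has two arrivals in a short time. -/
theorem IsDrivingNoise.measure_multi_le [IsProbabilityMeasure P] (h : IsDrivingNoise P N U)
    (W : Finset ℤ) (t : ℝ≥0) :
    P {ω | ¬ (∀ y ∈ W, N y t ω = 0) ∧
        ∀ y ∈ W, ¬ ∀ z ∈ W, N z t ω = if z = y then 1 else 0} ≤
      ENNReal.ofReal ((W.card * t) ^ 2) := by
  set A : Set 𝒪 := {ω | ∀ y ∈ W, N y t ω = 0} with hA
  set B : ℤ → Set 𝒪 := fun y => {ω | ∀ z ∈ W, N z t ω = if z = y then 1 else 0} with hB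
  have hAm : MeasurableSet A := h.measurableSet_counts W t fun _ => 0
  have hBm : ∀ y, MeasurableSet (B y) := fun y =>
    h.measurableSet_counts W t fun z => if z = y then 1 else 0
  have hBd : Set.PairwiseDisjoint (W : Set ℤ) B := by
    intro y hy z _ hyz
    refine Set.disjoint_left.2 fun ω h1 h2 => ?_
    have e1 := h1 y hy
    have e2 := h2 y hy
    rw [if_pos rfl] at e1
    rw [if_neg hyz, e1] at e2
    exact one_ne_zero e2
  have hAB : Disjoint A (⋃ y ∈ W, B y) := by
    refine Set.disjoint_left.2 fun ω h1 h2 => ?_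
    simp only [Set.mem_iUnion] at h2
    obtain ⟨y, hy, h2⟩ := h2
    have e1 := h1 y hy
    have e2 := h2 y hy
    rw [if_pos rfl, e1] at e2
    exact zero_ne_one e2
  have hset : {ω | ¬ (∀ y ∈ W, N y t ω = 0) ∧
        ∀ y ∈ W, ¬ ∀ z ∈ W, N z t ω = if z = y then 1 else 0} = (A ∪ ⋃ y ∈ W, B y)ᶜ := by
    ext ω; simp [hA, hB]
  have hu : MeasurableSet (⋃ y ∈ W, B y) := W.measurableSet_biUnion fun y _ => hBm y
  rw [hset, prob_compl_eq_one_sub (hAm.union hu), measure_union hAB hu,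
    measure_biUnion_finset hBd fun y _ => hBm y, h.measure_noArrival,
    Finset.sum_congr rfl fun y hy => h.measure_singleArrival t hy, Finset.sum_const, nsmul_eq_mul,
    tsub_le_iff_right]
  have e : ((W.card : ℝ≥0∞) * (t * ENNReal.ofReal (Real.exp (-(W.card * t))))) =
      ENNReal.ofReal (W.card * (t * Real.exp (-(W.card * t)))) := by
    rw [ENNReal.ofReal_mul (by positivity), ENNReal.ofReal_mul (by positivity)]
    simp
  rw [e, ← ENNReal.ofReal_add (by positivity) (by positivity),
    ← ENNReal.ofReal_add (by positivity) (by positivity), ENNReal.one_le_ofReal]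
  have := one_sub_exp_neg_mul_le (x := W.card * t) (by positivity)
  linarith

variable {X : 𝒪 → Config}

open Classical in
/-- The numbers of arrivals are independent of the initial configuration and of the marks. -/
theorem Driven.lintegral_counts [IsProbabilityMeasure P] (h : Driven P X N U) (W : Finset ℤ)
    (t : ℝ≥0) (k : ℤ → ℕ) {G : Config × (ℤ → ℕ → ℝ) → ℝ≥0∞} (hG : Measurable G) :
    ∫⁻ ω, (if ∀ y ∈ W, N y t ω = k y then G (X ω, fun x j => U x j ω) else 0) ∂P =
      P {ω | ∀ y ∈ W, N y t ω = k y} * ∫⁻ ω, G (X ω, fun x j => U x j ω) ∂P := by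
  have hswap := h.indep.comp measurable_id measurable_swap
  have hI : IndepFun (fun ω => (X ω, fun (x : ℤ) (j : ℕ) => U x j ω))
      (fun ω (x : ℤ) (t : ℝ≥0) => N x t ω) P :=
    indepFun_prodMk_left h.measurable h.noise.measurable_U' h.noise.measurable_N hswap
      h.noise.indep_N_U.symm
  have hcm : MeasurableSet {n : ℤ → ℝ≥0 → ℕ | ∀ y ∈ W, n y t = k y} := by
    have : {n : ℤ → ℝ≥0 → ℕ | ∀ y ∈ W, n y t = k y} =
        ⋂ y ∈ W, (fun n : ℤ → ℝ≥0 → ℕ => n y t) ⁻¹' {k y} := by ext n; simp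
    rw [this]
    refine W.measurableSet_biInter fun y _ => ?_
    exact (show Measurable fun n : ℤ → ℝ≥0 → ℕ => n y t by fun_prop) (measurableSet_singleton _)
  set φ : (ℤ → ℝ≥0 → ℕ) → ℝ≥0∞ := Set.indicator {n | ∀ y ∈ W, n y t = k y} 1 with hφ
  have hφm : Measurable φ := measurable_one.indicator hcm
  have hII := hI.comp hG hφm
  have := lintegral_mul_eq_lintegral_mul_lintegral_of_indepFun''
    (hG.comp (h.measurable.prodMk h.noise.measurable_U')).aemeasurable
    (hφm.comp h.noise.measurable_N).aemeasurable hII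
  have e1 : ∀ ω, (if ∀ y ∈ W, N y t ω = k y then G (X ω, fun x j => U x j ω) else 0) =
      (G ∘ fun ω => (X ω, fun x j => U x j ω)) ω * (φ ∘ fun ω x t => N x t ω) ω := by
    intro ω
    by_cases hω : ∀ y ∈ W, N y t ω = k y
    · simp only [if_pos hω, Function.comp_apply, hφ]
      rw [Set.indicator_of_mem (by exact hω)]; simp
    · simp only [if_neg hω, Function.comp_apply, hφ]
      rw [Set.indicator_of_notMem (by exact hω)]; simp
  have e2 : ∫⁻ ω, (φ ∘ fun ω x t => N x t ω) ω ∂P = P {ω | ∀ y ∈ W, N y t ω = k y} := by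
    rw [← lintegral_indicator_one (h.noise.measurableSet_counts W t k)]
    rfl
  rw [lintegral_congr e1, this, e2, mul_comm]
  rfl

/-- A single mark is uniform and independent of the initial configuration. -/
theorem Driven.lintegral_mark [IsProbabilityMeasure P] (h : Driven P X N U) (y : ℤ) (k : ℕ)
    {G : Config × ℝ → ℝ≥0∞} (hG : Measurable G) :
    ∫⁻ ω, G (X ω, U y k ω) ∂P =
      ∫⁻ ω, ∫⁻ v, G (X ω, v) ∂(volume : Measure ℝ).restrict (Set.Icc 0 1) ∂P := by
  have hI : IndepFun X (U y k) P := by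
    have hm : Measurable fun z : (ℤ → ℝ≥0 → ℕ) × (ℤ → ℕ → ℝ) => z.2 y k := by fun_prop
    exact h.indep.comp measurable_id hm
  have hm := (indepFun_iff_map_prod_eq_prod_map_map h.measurable.aemeasurable
    (h.noise.measurable_U y k).aemeasurable).1 hI
  rw [h.noise.uniform] at hm
  have := Measure.isProbabilityMeasure_map (μ := P) h.measurable.aemeasurable
  calc ∫⁻ ω, G (X ω, U y k ω) ∂P = ∫⁻ z, G z ∂(P.map fun ω => (X ω, U y k ω)) := by
        rw [lintegral_map hG (h.measurable.prodMk (h.noise.measurable_U y k))]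
    _ = _ := by
        rw [hm, lintegral_prod _ hG.aemeasurable, lintegral_map _ h.measurable]
        exact hG.lintegral_prod_right'

end Counts

/-! ### Averaging over the mark -/

/-- The probability that an arrival at a spin `η` causes an exchange. -/
def exchangeProb (lam : ℝ) (η : ℤˣ) : ℝ≥0∞ :=
  if η = 1 then ENNReal.ofReal lam else ENNReal.ofReal (1 - lam)

theorem exchangeProb_add {lam : ℝ} (h0 : 0 < lam) (h1 : lam < 1) (η : ℤˣ) :
    exchangeProb lam η + exchangeProb lam (-η) = 1 := by
  have hne : (-1 : ℤˣ) ≠ 1 := by decide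
  rcases Int.units_eq_one_or η with rfl | rfl
  · simp only [exchangeProb, if_true, if_neg hne]
    rw [← ENNReal.ofReal_add h0.le (by linarith)]; simp
  · simp only [exchangeProb, neg_neg, if_true, if_neg hne]
    rw [← ENNReal.ofReal_add (by linarith) h0.le]; simp

theorem volume_unit_Iio {a : ℝ} (h1 : a < 1) :
    (volume : Measure ℝ).restrict (Set.Icc 0 1) (Set.Iio a) = ENNReal.ofReal a := by
  rw [Measure.restrict_apply measurableSet_Iio]
  have : Set.Iio a ∩ Set.Icc 0 1 = Set.Ico 0 a := by ext x; simp; grind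
  rw [this, Real.volume_Ico, sub_zero]

theorem volume_unit_Ioi {a : ℝ} (h0 : 0 < a) :
    (volume : Measure ℝ).restrict (Set.Icc 0 1) (Set.Ioi a) = ENNReal.ofReal (1 - a) := by
  rw [Measure.restrict_apply measurableSet_Ioi]
  have : Set.Ioi a ∩ Set.Icc 0 1 = Set.Ioc a 1 := by ext x; simp; grind
  rw [this, Real.volume_Ioc]

/-- Averaged over the mark, an arrival at `y` causes an exchange with probability `exchangeProb`. -/
theorem lintegral_update_mark {lam : ℝ} (h0 : 0 < lam) (h1 : lam < 1) (g : Config → ℝ≥0∞)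
    (σ : Config) (y : ℤ) :
    ∫⁻ v, g (update lam σ y v) ∂(volume : Measure ℝ).restrict (Set.Icc 0 1) =
      exchangeProb lam (σ y) * g (exchange σ y) + exchangeProb lam (-σ y) * g σ := by
  classical
  have key : ∀ (A : Set ℝ) (η : ℤˣ), MeasurableSet A →
      (volume : Measure ℝ).restrict (Set.Icc 0 1) A = exchangeProb lam η →
      (∀ v, update lam σ y v = if v ∈ A then exchange σ y else σ) →
      ∫⁻ v, g (update lam σ y v) ∂(volume : Measure ℝ).restrict (Set.Icc 0 1) =
      exchangeProb lam η * g (exchange σ y) + exchangeProb lam (-η) * g σ := by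
    intro A η hA hvol hup
    have hc : (volume : Measure ℝ).restrict (Set.Icc 0 1) Aᶜ = exchangeProb lam (-η) := by
      rw [prob_compl_eq_one_sub hA, hvol, ← exchangeProb_add h0 h1 η]
      refine ENNReal.add_sub_cancel_left ?_
      unfold exchangeProb; split_ifs <;> exact ENNReal.ofReal_ne_top
    rw [← lintegral_add_compl _ hA, setLIntegral_congr_fun (g := fun _ => g (exchange σ y)) hA,
      setLIntegral_congr_fun (g := fun _ => g σ) hA.compl, setLIntegral_const, setLIntegral_const,
      hvol, hc, mul_comm, mul_comm (g σ)]
    · intro v hv; simp only [hup]; rw [if_neg hv]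
    · intro v hv; simp only [hup]; rw [if_pos hv]
  rcases Int.units_eq_one_or (σ y) with h | h
  · rw [h]
    refine key (Set.Iio lam) 1 measurableSet_Iio ?_ fun v => ?_
    · rw [volume_unit_Iio h1]; simp [exchangeProb]
    · unfold update; simp [h]
  · rw [h]
    have hne : (-1 : ℤˣ) ≠ 1 := by decide
    refine key (Set.Ioi lam) (-1) measurableSet_Ioi ?_ fun v => ?_
    · rw [volume_unit_Ioi h0]; simp [exchangeProb, hne]
    · unfold update; simp [h, hne]

/-- The total rate at which the boundary of a window creates mass. -/
def boundaryRate (lam : ℝ) (p : unitInterval) : ℝ≥0∞ :=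
  ∑ η : ℤˣ, exchangeProb lam η * (spinWeight p η / spinWeight p (-η))

theorem boundaryRate_ne_top (lam : ℝ) {p : unitInterval} (hp0 : 0 < p) (hp1 : p < 1) :
    boundaryRate lam p ≠ ∞ := by
  refine ENNReal.sum_ne_top.2 fun η _ => ENNReal.mul_ne_top ?_ ?_
  · unfold exchangeProb; split_ifs <;> exact ENNReal.ofReal_ne_top
  · exact ENNReal.div_ne_top (spinWeight_ne_top _ _) (spinWeight_ne_zero hp0 hp1 _)

theorem measurable_exchange (y : ℤ) : Measurable fun σ : Config => exchange σ y := by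
  have : (fun σ : Config => exchange σ y) = fun σ =>
      if σ y = 1 then update 1 σ y 0 else update 0 σ y 1 := by
    funext σ
    rcases Int.units_eq_one_or (σ y) with h | h <;> simp [update, h]
  rw [this]
  exact Measurable.ite (measurableSet_spin_eq y 1) (measurable_update 1 measurable_id
    measurable_const y) (measurable_update 0 measurable_id measurable_const y)

/-- The generator bound: an arrival at a uniformly chosen site of a window of `w` sites multiplies
the density with respect to Bernoulli measure by at most `1 + O(1 / w)`, on average. -/
theorem sum_lintegral_update_le {lam : ℝ} (h0 : 0 < lam) (h1 : lam < 1) {p : unitInterval}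
    (hp0 : 0 < p) (hp1 : p < 1) (L : ℕ) (R : ℤ) {g : Config → ℝ≥0∞} (hg : Measurable g)
    (hgW : DependsOn g (Set.Icc (-(L : ℤ)) R)) :
    ∑ y ∈ Finset.Icc (-(L : ℤ)) R, ∫⁻ σ, ∫⁻ v, g (update lam σ y v)
        ∂(volume : Measure ℝ).restrict (Set.Icc 0 1) ∂productBernoulli p ≤
      ((Finset.Icc (-(L : ℤ)) R).card + boundaryRate lam p) * ∫⁻ σ, g σ ∂productBernoulli p := by
  classical
  set π := productBernoulli p
  set W := Finset.Icc (-(L : ℤ)) R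
  set I : ℤˣ → ℤ → ℝ≥0∞ := fun η y => ∫⁻ σ, (if σ y = η then g σ else 0) ∂π with hI
  set J : ℤˣ → ℤ → ℝ≥0∞ := fun η y => ∫⁻ σ, (if σ y = η then g (exchange σ y) else 0) ∂π with hJ
  have hm1 : ∀ (η : ℤˣ) (y : ℤ), Measurable fun σ : Config => if σ y = η then g σ else 0 :=
    fun η y => Measurable.ite (measurableSet_spin_eq y η) hg measurable_const
  have hm2 : ∀ (η : ℤˣ) (y : ℤ), Measurable fun σ : Config =>
      if σ y = η then g (exchange σ y) else 0 := fun η y =>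
    Measurable.ite (measurableSet_spin_eq y η) (hg.comp (measurable_exchange y)) measurable_const
  have hsite : ∀ y, ∫⁻ σ, ∫⁻ v, g (update lam σ y v)
        ∂(volume : Measure ℝ).restrict (Set.Icc 0 1) ∂π =
      ∑ η : ℤˣ, (exchangeProb lam η * J η y + exchangeProb lam (-η) * I η y) := by
    intro y
    have e : ∀ σ : Config, ∫⁻ v, g (update lam σ y v) ∂(volume : Measure ℝ).restrict (Set.Icc 0 1) =
        ∑ η : ℤˣ, (exchangeProb lam η * (if σ y = η then g (exchange σ y) else 0) +
          exchangeProb lam (-η) * (if σ y = η then g σ else 0)) := by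
      intro σ
      rw [lintegral_update_mark h0 h1, sum_units _ (σ y)]
      simp [(neg_ne_self_unit (σ y)).symm]
    rw [lintegral_congr e, lintegral_finsetSum _ fun η _ =>
      show Measurable (fun σ : Config => exchangeProb lam η *
          (if σ y = η then g (exchange σ y) else 0) +
          exchangeProb lam (-η) * (if σ y = η then g σ else 0)) from
        ((hm2 η y).const_mul _).add ((hm1 η y).const_mul _)]
    refine Finset.sum_congr rfl fun η _ => ?_
    rw [lintegral_add_left ((hm2 η y).const_mul _), lintegral_const_mul _ (hm2 η y),
      lintegral_const_mul _ (hm1 η y)]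
  have hIsum : ∀ y, ∑ η : ℤˣ, I η y = ∫⁻ σ, g σ ∂π := by
    intro y
    simp only [hI]
    rw [← lintegral_finsetSum _ fun η _ => hm1 η y]
    refine lintegral_congr fun σ => ?_
    rw [sum_units _ (σ y)]
    simp [(neg_ne_self_unit (σ y)).symm]
  calc ∑ y ∈ W, ∫⁻ σ, ∫⁻ v, g (update lam σ y v)
        ∂(volume : Measure ℝ).restrict (Set.Icc 0 1) ∂π
      = ∑ η : ℤˣ, (exchangeProb lam η * ∑ y ∈ W, J η y +
          exchangeProb lam (-η) * ∑ y ∈ W, I η y) := by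
        rw [Finset.sum_congr rfl fun y _ => hsite y, Finset.sum_comm]
        simp only [Finset.sum_add_distrib, Finset.mul_sum]
    _ ≤ ∑ η : ℤˣ, (exchangeProb lam η * (∑ y ∈ W, I η y +
          spinWeight p η / spinWeight p (-η) * ∫⁻ σ, g σ ∂π) +
          exchangeProb lam (-η) * ∑ y ∈ W, I η y) := by
        gcongr with η _
        exact sum_lintegral_exchange_le hp0 hp1 η L R hg hgW
    _ = ∑ η : ℤˣ, (∑ y ∈ W, I η y + exchangeProb lam η *
          (spinWeight p η / spinWeight p (-η)) * ∫⁻ σ, g σ ∂π) := by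
        refine Finset.sum_congr rfl fun η _ => ?_
        calc _ = (exchangeProb lam η + exchangeProb lam (-η)) * ∑ y ∈ W, I η y +
              exchangeProb lam η * (spinWeight p η / spinWeight p (-η)) * ∫⁻ σ, g σ ∂π := by ring
          _ = _ := by rw [exchangeProb_add h0 h1, one_mul]
    _ = _ := by
        rw [Finset.sum_add_distrib, ← Finset.sum_mul, Finset.sum_comm,
          Finset.sum_congr rfl fun y _ => hIsum y, Finset.sum_const, nsmul_eq_mul, add_mul]
        rfl

end

section

/-! ### The density of the half-line process with respect to Bernoulli measure -/

/-- The probability of the less likely spin. -/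
def minWeight (p : unitInterval) : ℝ≥0∞ := min (spinWeight p 1) (spinWeight p (-1))

theorem minWeight_ne_zero {p : unitInterval} (hp0 : 0 < p) (hp1 : p < 1) : minWeight p ≠ 0 := by
  unfold minWeight
  rcases min_choice (spinWeight p 1) (spinWeight p (-1)) with h | h <;> rw [h] <;>
    exact spinWeight_ne_zero hp0 hp1 _

theorem minWeight_le (p : unitInterval) (η : ℤˣ) : minWeight p ≤ spinWeight p η := by
  rcases Int.units_eq_one_or η with rfl | rfl
  · exact min_le_left _ _
  · exact min_le_right _ _

theorem minWeight_ne_top (p : unitInterval) : minWeight p ≠ ∞ :=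
  ne_top_of_le_ne_top (spinWeight_ne_top p 1) (minWeight_le p 1)

/-- A function of finitely many spins is bounded by a multiple of its Bernoulli expectation. -/
theorem apply_le_lintegral {p : unitInterval} (hp0 : 0 < p) (hp1 : p < 1) (W : Finset ℤ)
    {g : Config → ℝ≥0∞} (hgW : DependsOn g W) (σ : Config) :
    g σ ≤ (minWeight p ^ W.card)⁻¹ * ∫⁻ τ, g τ ∂productBernoulli p := by
  have hbox : minWeight p ^ W.card ≤ productBernoulli p ((W : Set ℤ).pi fun y => {σ y}) := by
    rw [productBernoulli, Measure.infinitePi_pi _ fun y _ => measurableSet_singleton _,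
      ← Finset.prod_const]
    exact Finset.prod_le_prod' fun y _ => minWeight_le p (σ y)
  have hm : MeasurableSet ((W : Set ℤ).pi fun y => ({σ y} : Set ℤˣ)) :=
    .pi W.countable_toSet fun _ _ => measurableSet_singleton _
  have hle : g σ * minWeight p ^ W.card ≤ ∫⁻ τ, g τ ∂productBernoulli p := by
    calc g σ * minWeight p ^ W.card
        ≤ g σ * productBernoulli p ((W : Set ℤ).pi fun y => {σ y}) := by gcongr
      _ = ∫⁻ τ in (W : Set ℤ).pi fun y => {σ y}, g σ ∂productBernoulli p := by
          rw [setLIntegral_const]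
      _ = ∫⁻ τ in (W : Set ℤ).pi fun y => {σ y}, g τ ∂productBernoulli p := by
          refine setLIntegral_congr_fun hm fun τ hτ => hgW fun y hy => ?_
          exact (hτ y hy).symm
      _ ≤ _ := setLIntegral_le_lintegral _ _
  rw [mul_comm (_)⁻¹, ← div_eq_mul_inv, ENNReal.le_div_iff_mul_le]
  · exact hle
  · exact Or.inl (pow_ne_zero _ (minWeight_ne_zero hp0 hp1))
  · exact Or.inl (ENNReal.pow_ne_top (minWeight_ne_top p))

variable {Ω : Type*} [MeasurableSpace Ω] {Q : Measure Ω} {X : Ω → Config}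
    {N : ℤ → ℝ≥0 → Ω → ℕ} {U : ℤ → ℕ → Ω → ℝ}

/-- On the `σ`-algebra of the sites of `W`, the law of `X` has density at most `c` with respect to
the Bernoulli measure. -/
def DensityBound (Q : Measure Ω) (X : Ω → Config) (p : unitInterval) (W : Set ℤ) (c : ℝ≥0∞) :
    Prop :=
  ∀ g : Config → ℝ≥0∞, Measurable g → DependsOn g W →
    ∫⁻ ω, g (X ω) ∂Q ≤ c * ∫⁻ σ, g σ ∂productBernoulli p

/-- The constant in front of the quadratic error of one time step. -/
def stepError (p : unitInterval) (w : ℕ) : ℝ≥0∞ := (minWeight p ^ w)⁻¹ * (w : ℝ≥0∞) ^ 2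

theorem stepError_ne_top {p : unitInterval} (hp0 : 0 < p) (hp1 : p < 1) (w : ℕ) :
    stepError p w ≠ ∞ :=
  ENNReal.mul_ne_top (ENNReal.inv_ne_top.2 (pow_ne_zero _ (minWeight_ne_zero hp0 hp1)))
    (ENNReal.pow_ne_top (ENNReal.natCast_ne_top _))

theorem dependsOn_update {lam : ℝ} {g : Config → ℝ≥0∞} {L : ℕ} {R : ℤ}
    (hgW : DependsOn g (Set.Icc (-(L : ℤ)) R)) {y : ℤ} (hy : -(L : ℤ) ≤ y) (v : ℝ) :
    DependsOn (fun σ => g (update lam σ y v)) (Set.Icc (-(L : ℤ)) R) := by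
  intro σ σ' h
  refine hgW fun x hx => ?_
  exact update_agree_of_agree lam y v hy (fun z h1 h2 => h z ⟨h1, h2⟩) x hx.1 hx.2

open Classical in
/-- One short time step: up to an error of second order in its length `h`, the density grows at
most by the factor `1 + D h`, where `D` does not depend on the window. -/
theorem DensityBound.step [IsProbabilityMeasure Q] (hd : Driven Q X N U) {lam : ℝ} (h0 : 0 < lam)
    (h1 : lam < 1) {p : unitInterval} (hp0 : 0 < p) (hp1 : p < 1) (L : ℕ) (R : ℤ) {c : ℝ≥0∞}
    (hc : 1 ≤ c) (hX : DensityBound Q X p (Set.Icc (-(L : ℤ)) R) c) (h : ℝ≥0) :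
    DensityBound Q (fun ω => windowState lam (fun y t => N y t ω) (fun y k => U y k ω) (X ω) L R h)
      p (Set.Icc (-(L : ℤ)) R)
      (c * (1 + boundaryRate lam p * h +
        stepError p (Finset.Icc (-(L : ℤ)) R).card * (h : ℝ≥0∞) ^ 2)) := by
  intro g hg hgW
  set W := Finset.Icc (-(L : ℤ)) R with hW
  set π := productBernoulli p
  set w : ℕ := W.card with hw
  set B : ℝ≥0∞ := (minWeight p ^ w)⁻¹ * ∫⁻ τ, g τ ∂π with hB
  have hreg : ∀ ω y, RegularPath fun t => N y t ω := fun ω y => hd.noise.regular ω y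
  set A0 : Ω → Prop := fun ω => ∀ y ∈ W, N y h ω = 0 with hA0
  set A1 : ℤ → Ω → Prop := fun y ω => ∀ z ∈ W, N z h ω = if z = y then 1 else 0 with hA1
  set A2 : Ω → Prop := fun ω => ¬ A0 ω ∧ ∀ y ∈ W, ¬ A1 y ω with hA2
  have hA0m : MeasurableSet {ω | A0 ω} := hd.noise.measurableSet_counts W h fun _ => 0
  have hA1m : ∀ y, MeasurableSet {ω | A1 y ω} := fun y =>
    hd.noise.measurableSet_counts W h fun z => if z = y then 1 else 0
  have hA2m : MeasurableSet {ω | A2 ω} := by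
    have : {ω | A2 ω} = {ω | A0 ω}ᶜ ∩ ⋂ y ∈ W, {ω | A1 y ω}ᶜ := by ext ω; simp [hA2]
    rw [this]
    exact hA0m.compl.inter (W.measurableSet_biInter fun y _ => (hA1m y).compl)
  -- the three cases: no arrival, one arrival, several arrivals
  have hpt : ∀ ω, g (windowState lam (fun y t => N y t ω) (fun y k => U y k ω) (X ω) L R h) ≤
      (if A0 ω then g (X ω) else 0) +
        (∑ y ∈ W, (if A1 y ω then g (update lam (X ω) y (U y 1 ω)) else 0) +
          if A2 ω then B else 0) := by
    intro ω
    have hzero : windowState lam (fun y t => N y t ω) (fun y k => U y k ω) (X ω) L R 0 = X ω :=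
      windowState_zero lam (hreg ω) _ _ L R
    by_cases hω0 : A0 ω
    · have : windowState lam (fun y t => N y t ω) (fun y k => U y k ω) (X ω) L R h = X ω := by
        rw [windowState_eq_of_no_arrival lam _ _ _ L R (a := 0) (b := h), hzero]
        intro y hy1 hy2
        rw [(hreg ω y).zero, hω0 y (Finset.mem_Icc.2 ⟨hy1, hy2⟩)]
      rw [this, if_pos hω0]
      exact le_self_add
    · by_cases hω1 : ∃ y ∈ W, A1 y ω
      · obtain ⟨y, hy, hy1⟩ := hω1
        have hyW := Finset.mem_Icc.1 hy
        have e := hy1 y hy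
        rw [if_pos rfl] at e
        have : windowState lam (fun y t => N y t ω) (fun y k => U y k ω) (X ω) L R h =
            update lam (X ω) y (U y 1 ω) := by
          rw [windowState_of_single_arrival lam (hreg ω) (fun y k => U y k ω) (X ω) L R
            (zero_le (a := h)) hyW, hzero]
          · rw [e]
          · rw [e, (hreg ω y).zero]
          · intro z hz1 hz2 hz
            have := hy1 z (Finset.mem_Icc.2 ⟨hz1, hz2⟩)
            rw [if_neg hz] at this
            rw [this, (hreg ω z).zero]
        rw [this]
        refine le_trans ?_ le_add_self
        refine le_trans ?_ le_self_add
        refine le_trans ?_ (Finset.single_le_sum (fun _ _ => zero_le) hy)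
        rw [if_pos hy1]
      · have hω2 : A2 ω := ⟨hω0, fun y hy h => hω1 ⟨y, hy, h⟩⟩
        rw [if_pos hω2]
        refine le_trans ?_ le_add_self
        refine le_trans ?_ le_add_self
        exact apply_le_lintegral hp0 hp1 W (by rw [hW, Finset.coe_Icc]; exact hgW) _
  set a : ℝ≥0∞ := ENNReal.ofReal (Real.exp (-(w * h))) with ha
  have hm0 : Measurable fun ω => if A0 ω then g (X ω) else 0 :=
    Measurable.ite hA0m (hg.comp hd.measurable) measurable_const
  have hgu : ∀ y, Measurable fun z : Config × ℝ => g (update lam z.1 y z.2) := fun y =>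
    hg.comp (measurable_update lam measurable_fst measurable_snd y)
  have hm1 : ∀ y, Measurable fun ω => if A1 y ω then g (update lam (X ω) y (U y 1 ω)) else 0 :=
    fun y => Measurable.ite (hA1m y)
      ((hgu y).comp (hd.measurable.prodMk (hd.noise.measurable_U y 1))) measurable_const
  have hI0 : ∫⁻ ω, (if A0 ω then g (X ω) else 0) ∂Q ≤ a * (c * ∫⁻ σ, g σ ∂π) := by
    rw [hd.lintegral_counts W h (fun _ => 0) (G := fun z => g z.1) (hg.comp measurable_fst),
      hd.noise.measure_noArrival]
    gcongr
    exact hX g hg hgW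
  have hI1 : ∀ y ∈ W, ∫⁻ ω, (if A1 y ω then g (update lam (X ω) y (U y 1 ω)) else 0) ∂Q ≤
      h * a * (c * ∫⁻ σ, ∫⁻ v, g (update lam σ y v)
        ∂(volume : Measure ℝ).restrict (Set.Icc 0 1) ∂π) := by
    intro y hy
    rw [hd.lintegral_counts W h (fun z => if z = y then 1 else 0)
      (G := fun z => g (update lam z.1 y (z.2 y 1)))
      ((hgu y).comp (measurable_fst.prodMk (by fun_prop))),
      hd.noise.measure_singleArrival h hy, hd.lintegral_mark y 1 (hgu y)]
    gcongr
    refine hX (fun σ => ∫⁻ v, g (update lam σ y v) ∂(volume : Measure ℝ).restrict (Set.Icc 0 1))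
      (hgu y).lintegral_prod_right' ?_
    intro σ σ' hσ
    exact lintegral_congr fun v => dependsOn_update hgW (Finset.mem_Icc.1 hy).1 v hσ
  have hI2 : ∫⁻ ω, (if A2 ω then B else 0) ∂Q ≤ B * ((w : ℝ≥0∞) * h) ^ 2 := by
    have : (fun ω => if A2 ω then B else 0) = Set.indicator {ω | A2 ω} fun _ => B := by
      ext ω; simp [Set.indicator_apply]
    rw [this, lintegral_indicator_const hA2m]
    gcongr
    refine (hd.noise.measure_multi_le W h).trans ?_
    rw [ENNReal.ofReal_pow (by positivity), ENNReal.ofReal_mul (by positivity)]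
    simp [hw]
  have ha1 : a * (1 + h * w) ≤ 1 := by
    have e : (1 + (h : ℝ≥0∞) * w) = ENNReal.ofReal (1 + w * h) := by
      rw [ENNReal.ofReal_add one_pos.le (by positivity), ENNReal.ofReal_mul (by positivity)]
      simp [mul_comm]
    rw [e, ha, ← ENNReal.ofReal_mul (Real.exp_pos _).le, ← ENNReal.ofReal_one]
    exact ENNReal.ofReal_le_ofReal exp_neg_mul_le_one
  have ha2 : a ≤ 1 := by
    rw [ha, ← ENNReal.ofReal_one]
    exact ENNReal.ofReal_le_ofReal (Real.exp_le_one_iff.2 (by simp; positivity))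
  set I := ∫⁻ σ, g σ ∂π
  calc ∫⁻ ω, g (windowState lam (fun y t => N y t ω) (fun y k => U y k ω) (X ω) L R h) ∂Q
      ≤ ∫⁻ ω, ((if A0 ω then g (X ω) else 0) +
        (∑ y ∈ W, (if A1 y ω then g (update lam (X ω) y (U y 1 ω)) else 0) +
          if A2 ω then B else 0)) ∂Q := lintegral_mono hpt
    _ = ∫⁻ ω, (if A0 ω then g (X ω) else 0) ∂Q +
        (∑ y ∈ W, ∫⁻ ω, (if A1 y ω then g (update lam (X ω) y (U y 1 ω)) else 0) ∂Q +
          ∫⁻ ω, (if A2 ω then B else 0) ∂Q) := by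
        rw [lintegral_add_left hm0, lintegral_add_left (Finset.measurable_sum _ fun y _ => hm1 y),
          lintegral_finsetSum _ fun y _ => hm1 y]
    _ ≤ a * (c * I) + (∑ y ∈ W, h * a * (c * ∫⁻ σ, ∫⁻ v, g (update lam σ y v)
        ∂(volume : Measure ℝ).restrict (Set.Icc 0 1) ∂π) + B * ((w : ℝ≥0∞) * h) ^ 2) := by
        gcongr with y hy
        exact hI1 y hy
    _ ≤ a * (c * I) + (h * a * (c * ((w + boundaryRate lam p) * I)) +
          B * ((w : ℝ≥0∞) * h) ^ 2) := by
        rw [← Finset.mul_sum, ← Finset.mul_sum]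
        gcongr
        exact sum_lintegral_update_le h0 h1 hp0 hp1 L R hg hgW
    _ = c * I * (a * (1 + h * w)) + a * (c * I * (boundaryRate lam p * h)) +
          stepError p w * (h : ℝ≥0∞) ^ 2 * (1 * I) := by
        rw [hB, stepError]; ring
    _ ≤ c * I * 1 + 1 * (c * I * (boundaryRate lam p * h)) +
          stepError p w * (h : ℝ≥0∞) ^ 2 * (c * I) := by gcongr
    _ = _ := by ring

theorem DensityBound.mono {c c' : ℝ≥0∞} {p : unitInterval} {W : Set ℤ} (hcc : c ≤ c')
    (h : DensityBound Q X p W c) : DensityBound Q X p W c' :=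
  fun g hg hgW => (h g hg hgW).trans (by gcongr)

/-- Iteration over `m` time steps of length `h`. -/
theorem DensityBound.iterate {lam : ℝ} (h0 : 0 < lam) (h1 : lam < 1) {p : unitInterval}
    (hp0 : 0 < p) (hp1 : p < 1) (L : ℕ) (R : ℤ) (h : ℝ≥0) [IsProbabilityMeasure Q] (m : ℕ) :
    ∀ {X : Ω → Config} {N : ℤ → ℝ≥0 → Ω → ℕ} {U : ℤ → ℕ → Ω → ℝ} {c : ℝ≥0∞},
    Driven Q X N U → 1 ≤ c → DensityBound Q X p (Set.Icc (-(L : ℤ)) R) c →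
    DensityBound Q (fun ω => windowState lam (fun y t => N y t ω) (fun y k => U y k ω) (X ω) L R
      (m * h)) p (Set.Icc (-(L : ℤ)) R)
      (c * (1 + boundaryRate lam p * h +
        stepError p (Finset.Icc (-(L : ℤ)) R).card * (h : ℝ≥0∞) ^ 2) ^ m) := by
  induction m with
  | zero =>
    intro X N U c hd hc hX
    have : (fun ω => windowState lam (fun y t => N y t ω) (fun y k => U y k ω) (X ω) L R
        ((0 : ℕ) * h)) = X := by
      funext ω
      rw [Nat.cast_zero, zero_mul]
      exact windowState_zero lam (fun y => hd.noise.regular ω y) _ _ L R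
    rw [this, pow_zero, mul_one]
    exact hX
  | succ m ih =>
    intro X N U c hd hc hX
    have hX' := DensityBound.step hd h0 h1 hp0 hp1 L R hc hX h
    have hd' := hd.shift h (measurable_windowMap lam L R h)
    have hreg : ∀ ω y, RegularPath fun t => N y t ω := fun ω y => hd.noise.regular ω y
    have e1 : (fun ω => windowMap lam L R h (pastInput h (input X N U ω))) = fun ω =>
        windowState lam (fun y t => N y t ω) (fun y k => U y k ω) (X ω) L R h := by
      funext ω
      exact windowMap_pastInput lam L R h (hreg ω) _ _
    rw [e1] at hd'
    have hone : 1 ≤ 1 + boundaryRate lam p * h +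
        stepError p (Finset.Icc (-(L : ℤ)) R).card * (h : ℝ≥0∞) ^ 2 := by
      rw [add_assoc]; exact le_self_add
    have := ih hd' (hc.trans (le_mul_of_one_le_right' hone)) hX'
    have e2 : (fun ω => windowState lam (fun y t => N y t ω) (fun y k => U y k ω) (X ω) L R
        ((m + 1 : ℕ) * h)) = fun ω => windowState lam (fun y t => shiftN N h y t ω)
          (fun y k => shiftU N U h y k ω)
          (windowState lam (fun y t => N y t ω) (fun y k => U y k ω) (X ω) L R h) L R (m * h) := by
      funext ω
      have e3 : ((m + 1 : ℕ) : ℝ≥0) * h = h + m * h := by push_cast; ring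
      rw [e3]
      exact windowState_add lam (hreg ω) _ _ L R h (m * h)
    rw [e2, pow_succ', ← mul_assoc]
    exact this

/-- The rate at which the density of the half-line process can grow. -/
def densityRate (lam : ℝ) (p : unitInterval) : ℝ := (boundaryRate lam p).toReal

/-- The density of the half-line process, started from a Bernoulli configuration, on a window is
bounded uniformly in the window. -/
theorem densityBound_windowState [IsProbabilityMeasure Q] (hd : Driven Q X N U) {lam : ℝ}
    (h0 : 0 < lam) (h1 : lam < 1) {p : unitInterval} (hp0 : 0 < p) (hp1 : p < 1)
    (hX : Q.map X = productBernoulli p) (L : ℕ) (R : ℤ) (t : ℝ≥0) :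
    DensityBound Q (fun ω => windowState lam (fun y t => N y t ω) (fun y k => U y k ω) (X ω) L R t)
      p (Set.Icc (-(L : ℤ)) R) (ENNReal.ofReal (Real.exp (densityRate lam p * t + 1))) := by
  have hX1 : DensityBound Q X p (Set.Icc (-(L : ℤ)) R) 1 := by
    intro g hg _
    rw [one_mul, ← hX, lintegral_map hg hd.measurable]
  set κ : ℝ := (stepError p (Finset.Icc (-(L : ℤ)) R).card).toReal with hκ
  -- with `m` time steps the errors of second order sum up to `κ t ^ 2 / m ≤ 1`
  obtain ⟨m, hm⟩ := exists_nat_gt (κ * t ^ 2)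
  have hκ0 : 0 ≤ κ * t ^ 2 := by positivity
  have hm0 : 0 < (m : ℝ) := hκ0.trans_lt hm
  have hm0' : (m : ℝ≥0) ≠ 0 := by
    rw [Ne, Nat.cast_eq_zero]; rintro rfl; simp at hm0
  have := DensityBound.iterate h0 h1 hp0 hp1 L R (t / m) m hd le_rfl hX1
  rw [mul_div_cancel₀ t hm0', one_mul] at this
  refine this.mono ?_
  have hD0 : 0 ≤ densityRate lam p := ENNReal.toReal_nonneg
  have e : 1 + boundaryRate lam p * ((t / m : ℝ≥0) : ℝ≥0∞) +
      stepError p (Finset.Icc (-(L : ℤ)) R).card * ((t / m : ℝ≥0) : ℝ≥0∞) ^ 2 =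
      ENNReal.ofReal (1 + densityRate lam p * (t / m) + κ * (t / m) ^ 2) := by
    rw [ENNReal.ofReal_add (by positivity) (by positivity),
      ENNReal.ofReal_add (by positivity) (by positivity),
      ENNReal.ofReal_mul hD0, ENNReal.ofReal_mul (by positivity), densityRate, hκ,
      ENNReal.ofReal_toReal (boundaryRate_ne_top lam hp0 hp1),
      ENNReal.ofReal_toReal (stepError_ne_top hp0 hp1 _), ENNReal.ofReal_one,
      ENNReal.ofReal_pow (by positivity)]
    have : ENNReal.ofReal ((t : ℝ) / m) = ((t / m : ℝ≥0) : ℝ≥0∞) := by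
      rw [← ENNReal.ofReal_coe_nnreal]; push_cast; rfl
    rw [this]
  rw [e, ← ENNReal.ofReal_pow (by positivity)]
  refine ENNReal.ofReal_le_ofReal ?_
  calc (1 + densityRate lam p * (t / m) + κ * (t / m) ^ 2) ^ m
      ≤ (Real.exp (densityRate lam p * (t / m) + κ * (t / m) ^ 2)) ^ m := by
        gcongr
        have := Real.add_one_le_exp (densityRate lam p * (t / m) + κ * (t / m) ^ 2)
        linarith
    _ = Real.exp (densityRate lam p * t + κ * t ^ 2 / m) := by
        rw [← Real.exp_nat_mul]
        congr 1
        field_simp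
    _ ≤ _ := by
        gcongr
        rw [div_le_one hm0]
        exact hm.le

end

section

/-! ### Barriers -/

/-- The paths have at most one jump altogether in `(a, b]` at the sites of `W`. -/
def AtMostOneArrival (n : ℤ → ℝ≥0 → ℕ) (W : Finset ℤ) (a b : ℝ≥0) : Prop :=
  (∀ z ∈ W, n z b = n z a) ∨ ∃ y ∈ W, ∀ z ∈ W, n z b = n z a + if z = y then 1 else 0

theorem AtMostOneArrival.subset {n : ℤ → ℝ≥0 → ℕ} {W W' : Finset ℤ} {a b : ℝ≥0} (hW : W' ⊆ W)
    (h : AtMostOneArrival n W a b) : AtMostOneArrival n W' a b := by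
  rcases h with h | ⟨y, -, h⟩
  · exact Or.inl fun z hz => h z (hW hz)
  · by_cases hy : y ∈ W'
    · exact Or.inr ⟨y, hy, fun z hz => h z (hW hz)⟩
    · refine Or.inl fun z hz => ?_
      rw [h z (hW hz), if_neg, add_zero]
      rintro rfl
      exact hy hz

/-- If there is at most one arrival in `(a, b]`, then for each `t` in between there is none in `(a,
t]` or none in `(t, b]`. -/
theorem AtMostOneArrival.eq_left_or_right {n : ℤ → ℝ≥0 → ℕ} (hn : ∀ y, RegularPath (n y))
    {W : Finset ℤ} {a b t : ℝ≥0} (h : AtMostOneArrival n W a b) (hat : a ≤ t) (htb : t ≤ b) :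
    (∀ z ∈ W, n z t = n z a) ∨ ∀ z ∈ W, n z b = n z t := by
  have h1 : ∀ z, n z a ≤ n z t := fun z => (hn z).mono hat
  have h2 : ∀ z, n z t ≤ n z b := fun z => (hn z).mono htb
  rcases h with h | ⟨y, hy, h⟩
  · refine Or.inl fun z hz => ?_
    have := h1 z; have := h2 z; have := h z hz
    omega
  · have hz : ∀ z ∈ W, z ≠ y → n z t = n z a ∧ n z b = n z t := by
      intro z hz hzy
      have := h1 z; have := h2 z; have := h z hz
      rw [if_neg hzy] at this
      omega
    have hyy := h y hy
    rw [if_pos rfl] at hyy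
    have := h1 y; have := h2 y
    rcases (show n y t = n y a ∨ n y b = n y t by omega) with e | e
    · refine Or.inl fun z hz' => ?_
      by_cases hzy : z = y
      · rw [hzy, e]
      · exact (hz z hz' hzy).1
    · refine Or.inr fun z hz' => ?_
      by_cases hzy : z = y
      · rw [hzy, e]
      · exact (hz z hz' hzy).2

variable {lam : ℝ} {n : ℤ → ℝ≥0 → ℕ} {u : ℤ → ℕ → ℝ} {σ σ' : Config} {L L' : ℕ} {R : ℤ}

/-- In a time slot with at most one arrival the state is one of the states at the two ends. -/
theorem windowState_eq_left_or_right (hn : ∀ y, RegularPath (n y)) {W : Finset ℤ} {a b t : ℝ≥0}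
    (h : AtMostOneArrival n W a b) (hat : a ≤ t) (htb : t ≤ b) :
    (∀ (lam : ℝ) (u : ℤ → ℕ → ℝ) (σ : Config) (L : ℕ) (R : ℤ), Finset.Icc (-(L : ℤ)) R ⊆ W →
      windowState lam n u σ L R t = windowState lam n u σ L R a) ∨
    (∀ (lam : ℝ) (u : ℤ → ℕ → ℝ) (σ : Config) (L : ℕ) (R : ℤ), Finset.Icc (-(L : ℤ)) R ⊆ W →
      windowState lam n u σ L R t = windowState lam n u σ L R b) := by
  rcases h.eq_left_or_right hn hat htb with e | e
  · refine Or.inl fun lam u σ L R hW => ?_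
    refine windowState_eq_of_no_arrival lam n u σ L R fun y hy1 hy2 => ?_
    exact (e y (hW (Finset.mem_Icc.2 ⟨hy1, hy2⟩))).symm
  · refine Or.inr fun lam u σ L R hW => ?_
    refine (windowState_eq_of_no_arrival lam n u σ L R fun y hy1 hy2 => ?_).symm
    exact (e y (hW (Finset.mem_Icc.2 ⟨hy1, hy2⟩))).symm

/-- A block without arrivals on which neither configuration is constant is a barrier: the two
evolutions cannot become different to its right. -/
theorem agree_step (hn : ∀ y, RegularPath (n y)) {W : Finset ℤ} {a b : ℝ≥0} (hab : a ≤ b)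
    (h : AtMostOneArrival n W a b) (hL : Finset.Icc (-(L : ℤ)) R ⊆ W)
    (hL' : Finset.Icc (-(L' : ℤ)) R ⊆ W) {c d : ℤ} (hc : -(L : ℤ) ≤ c) (hc' : -(L' : ℤ) ≤ c)
    (hcd : c ≤ d) (hblock : ∀ y, c ≤ y → y ≤ d → n y a = n y b)
    (hS : ¬ IsConstOn (windowState lam n u σ L R a) c d)
    (hS' : ¬ IsConstOn (windowState lam n u σ' L' R a) c d)
    (hag : ∀ x, d < x → x ≤ R → windowState lam n u σ L R a x = windowState lam n u σ' L' R a x) :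
    ∀ x, d < x → x ≤ R → windowState lam n u σ L R b x = windowState lam n u σ' L' R b x := by
  have stay : ∀ (τ : Config) (ℓ : ℕ), Finset.Icc (-(ℓ : ℤ)) R ⊆ W →
      (∀ z ∈ Finset.Icc (-(ℓ : ℤ)) R, n z b = n z a) →
      windowState lam n u τ ℓ R b = windowState lam n u τ ℓ R a := by
    intro τ ℓ _ hz
    refine windowState_eq_of_no_arrival lam n u τ ℓ R fun y hy1 hy2 => ?_
    exact (hz y (Finset.mem_Icc.2 ⟨hy1, hy2⟩)).symm
  rcases h with h | ⟨y, hy, h⟩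
  · intro x hx hxR
    rw [stay σ L hL fun z hz => h z (hL hz), stay σ' L' hL' fun z hz => h z (hL' hz)]
    exact hag x hx hxR
  · have hyy := h y hy
    rw [if_pos rfl] at hyy
    have hstep : ∀ (τ : Config) (ℓ : ℕ), Finset.Icc (-(ℓ : ℤ)) R ⊆ W → -(ℓ : ℤ) ≤ y → y ≤ R →
        windowState lam n u τ ℓ R b = update lam (windowState lam n u τ ℓ R a) y (u y (n y b)) := by
      intro τ ℓ hℓ h1 h2
      refine windowState_of_single_arrival lam hn u τ ℓ R hab ⟨h1, h2⟩ hyy fun z hz1 hz2 hzy => ?_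
      rw [h z (hℓ (Finset.mem_Icc.2 ⟨hz1, hz2⟩)), if_neg hzy, add_zero]
    have hskip : ∀ (τ : Config) (ℓ : ℕ), Finset.Icc (-(ℓ : ℤ)) R ⊆ W → ¬ (-(ℓ : ℤ) ≤ y ∧ y ≤ R) →
        windowState lam n u τ ℓ R b = windowState lam n u τ ℓ R a := by
      intro τ ℓ hℓ hnot
      refine stay τ ℓ hℓ fun z hz => ?_
      rw [h z (hℓ hz), if_neg, add_zero]
      rintro rfl
      exact hnot (Finset.mem_Icc.1 hz)
    intro x hx hxR
    rcases lt_or_ge y c with hyc | hyc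
    · -- an arrival to the left of the block is stopped by the block
      have hleft : ∀ (τ : Config) (ℓ : ℕ), Finset.Icc (-(ℓ : ℤ)) R ⊆ W →
          ¬ IsConstOn (windowState lam n u τ ℓ R a) c d →
          windowState lam n u τ ℓ R b x = windowState lam n u τ ℓ R a x := by
        intro τ ℓ hℓ hnc
        by_cases hin : -(ℓ : ℤ) ≤ y ∧ y ≤ R
        · rw [hstep τ ℓ hℓ hin.1 hin.2]
          exact update_apply_of_not_isConstOn lam _ hyc.le hcd hx hnc
        · rw [hskip τ ℓ hℓ hin]
      rw [hleft σ L hL hS, hleft σ' L' hL' hS']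
      exact hag x hx hxR
    · rcases le_or_gt y d with hyd | hyd
      · -- there are no arrivals in the block
        have := hblock y hyc hyd
        omega
      · -- an arrival to the right of the block acts on spins that agree
        rcases le_or_gt y R with hyR | hyR
        · rw [hstep σ L hL (hc.trans hyc) hyR, hstep σ' L' hL' (hc'.trans hyc) hyR]
          exact update_agree_of_agree lam y _ (c := d + 1) (d := R) hyd
            (fun z hz1 hz2 => hag z hz1 hz2) x hx hxR
        · rw [hskip σ L hL fun h => (not_le.2 hyR) h.2, hskip σ' L' hL' fun h => (not_le.2 hyR) h.2]
          exact hag x hx hxR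

theorem exists_slot {h t : ℝ≥0} (hh : 0 < h) {I : ℕ} (hI : 0 < I) (ht : t ≤ I * h) :
    ∃ i < I, i * h ≤ t ∧ t ≤ (i + 1 : ℕ) * h := by
  rcases eq_or_lt_of_le ht with rfl | ht
  · refine ⟨I - 1, by omega, ?_, ?_⟩
    · gcongr; omega
    · gcongr; omega
  · refine ⟨⌊t / h⌋₊, ?_, ?_, ?_⟩
    · rw [Nat.floor_lt (by positivity), div_lt_iff₀ hh]; exact ht
    · rw [← le_div_iff₀ hh]; exact Nat.floor_le (by positivity)
    · rw [← div_le_iff₀ hh]; push_cast; exact (Nat.lt_floor_add_one _).le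

/-- Two evolutions with the same noise agree to the right of a succession of barriers which move
to the right from one coarse time slot to the next. A coarse slot consists of `g` slots of
length `h`. -/
theorem agree_of_barriers (hn : ∀ y, RegularPath (n y)) {W : Finset ℤ} {h : ℝ≥0} (hh : 0 < h)
    {g J K : ℕ} (hone : ∀ i < J * g, AtMostOneArrival n W (i * h) ((i + 1 : ℕ) * h))
    (hL : Finset.Icc (-(L : ℤ)) R ⊆ W) (hL' : Finset.Icc (-(L' : ℤ)) R ⊆ W) (hJg : 0 < J * g)
    {c : ℕ → ℤ} (hc : ∀ j < J, -(L : ℤ) ≤ c j) (hc' : ∀ j < J, -(L' : ℤ) ≤ c j)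
    (hcm : ∀ j, j + 1 < J → c j ≤ c (j + 1))
    (hblock : ∀ j < J, ∀ y, c j ≤ y → y ≤ c j + K →
      n y ((j * g : ℕ) * h) = n y (((j + 1) * g : ℕ) * h))
    (hS : ∀ j < J, ∀ i < J * g,
      ¬ IsConstOn (windowState lam n u σ L R (i * h)) (c j) (c j + K))
    (hS' : ∀ j < J, ∀ i < J * g,
      ¬ IsConstOn (windowState lam n u σ' L' R (i * h)) (c j) (c j + K))
    (hinit : ∀ x, c 0 ≤ x → x ≤ R → σ x = σ' x) {t : ℝ≥0} (ht : t ≤ (J * g : ℕ) * h) {x : ℤ}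
    (hx : ∀ j < J, c j + K < x) (hxR : x ≤ R) :
    windowState lam n u σ L R t x = windowState lam n u σ' L' R t x := by
  have hJ : 0 < J := Nat.pos_of_mul_pos_right hJg
  have hg : 0 < g := Nat.pos_of_mul_pos_left hJg
  have hmono : ∀ a b : ℕ, a ≤ b → (a : ℝ≥0) * h ≤ b * h := fun a b hab => by gcongr
  -- within one coarse slot
  have slot : ∀ j < J, (∀ x, c j + K < x → x ≤ R →
      windowState lam n u σ L R ((j * g : ℕ) * h) x =
        windowState lam n u σ' L' R ((j * g : ℕ) * h) x) →
      ∀ i ≤ g, ∀ x, c j + K < x → x ≤ R →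
      windowState lam n u σ L R ((j * g + i : ℕ) * h) x =
        windowState lam n u σ' L' R ((j * g + i : ℕ) * h) x := by
    intro j hj h0 i
    induction i with
    | zero => intro _; exact h0
    | succ i ih =>
      intro hi
      have hlt : j * g + i < J * g := by
        calc j * g + i < j * g + g := by omega
          _ = (j + 1) * g := by ring
          _ ≤ J * g := Nat.mul_le_mul_right g hj
      refine agree_step hn ?_ (hone _ hlt) hL hL' (hc j hj) (hc' j hj) (by omega) ?_
        (hS j hj _ hlt) (hS' j hj _ hlt) (ih (by omega))
      · exact hmono _ _ (by omega)
      · intro y hy1 hy2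
        have e := hblock j hj y hy1 hy2
        have e1 : n y ((j * g : ℕ) * h) ≤ n y ((j * g + i : ℕ) * h) :=
          (hn y).mono (hmono _ _ (by omega))
        have e2 : n y ((j * g + i : ℕ) * h) ≤ n y ((j * g + i + 1 : ℕ) * h) :=
          (hn y).mono (hmono _ _ (by omega))
        have e3 : n y ((j * g + i + 1 : ℕ) * h) ≤ n y (((j + 1) * g : ℕ) * h) := by
          refine (hn y).mono (hmono _ _ ?_)
          rw [add_mul, one_mul]; omega
        omega
  -- from one coarse slot to the next
  have coarse : ∀ j < J, ∀ x, c j + K < x → x ≤ R →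
      windowState lam n u σ L R ((j * g : ℕ) * h) x =
        windowState lam n u σ' L' R ((j * g : ℕ) * h) x := by
    intro j
    induction j with
    | zero =>
      intro _ x hx hxR
      rw [zero_mul, Nat.cast_zero, zero_mul, windowState_zero lam hn, windowState_zero lam hn]
      exact hinit x (by omega) hxR
    | succ j ih =>
      intro hj x hx hxR
      have := slot j (by omega) (ih (by omega)) g le_rfl x (by have := hcm j hj; omega) hxR
      rw [show (j + 1) * g = j * g + g by ring]
      exact this
  have grid : ∀ i ≤ J * g, windowState lam n u σ L R (i * h) x =
      windowState lam n u σ' L' R (i * h) x := by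
    intro i hi
    rcases eq_or_lt_of_le hi with rfl | hi
    · have := slot (J - 1) (by omega) (coarse _ (by omega)) g le_rfl x (hx _ (by omega)) hxR
      have e : (J - 1) * g + g = J * g := by
        obtain ⟨J', rfl⟩ : ∃ J', J = J' + 1 := ⟨J - 1, by omega⟩
        simp; ring
      rw [e] at this
      exact this
    · have hj : i / g < J := Nat.div_lt_of_lt_mul (by rw [mul_comm]; exact hi)
      have := slot (i / g) hj (coarse _ hj) (i % g) (Nat.mod_lt _ hg).le x (hx _ hj) hxR
      rw [Nat.div_add_mod'] at this
      exact this
  obtain ⟨i, hi, h1, h2⟩ := exists_slot hh hJg ht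
  rcases windowState_eq_left_or_right hn (hone i hi) h1 h2 with e | e
  · rw [e lam u σ L R hL, e lam u σ' L' R hL']
    exact grid i hi.le
  · rw [e lam u σ L R hL, e lam u σ' L' R hL']
    exact grid (i + 1) hi

end

section

/-! ### The typical behaviour at scale `4 ^ k` -/

/-- The length of the fine time slots at scale `4 ^ k`. -/
def fineStep (A k : ℕ) : ℝ≥0 := 1 / (4 * A * 64 ^ k)

/-- The number of fine time slots up to time `M`. -/
def slotCount (A k M : ℕ) : ℕ := M * (4 * A) * 64 ^ k

/-- The first site of the `i`-th block which is a candidate for a barrier in the `j`-th coarse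
time slot. The blocks have `A k + 1` sites, and there are `2 ^ k` blocks for each slot. -/
def blockStart (A k j i : ℕ) : ℤ := -(4 : ℤ) ^ k + (j * 2 ^ k + i : ℕ) * (A * k + 1 : ℕ)

/-- The typical behaviour at scale `4 ^ k` up to time `M`, for the sites in `(-∞, M]` and the
half-line processes with `4 ^ k ≤ L ≤ 4 ^ (k + 1)`. -/
structure Good (lam : ℝ) (A k M : ℕ) (n : ℤ → ℝ≥0 → ℕ) (u : ℤ → ℕ → ℝ) (σ : Config) : Prop where
  /-- No fine slot has two arrivals. -/
  one : ∀ i < slotCount A k M, AtMostOneArrival n (Finset.Icc (-(4 : ℤ) ^ (k + 1)) M)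
    (i * fineStep A k) ((i + 1 : ℕ) * fineStep A k)
  /-- At the ends of the fine slots there are no long constant stretches. -/
  nonconst : ∀ i ≤ slotCount A k M, ∀ L : ℕ, 4 ^ k ≤ L → L ≤ 4 ^ (k + 1) → ∀ c : ℤ,
    -(4 : ℤ) ^ k ≤ c → c + (A * k : ℕ) ≤ M →
      ¬ IsConstOn (halfLineProcess lam n u σ L (i * fineStep A k)) c (c + (A * k : ℕ))
  /-- In every coarse slot some candidate block has no arrivals. -/
  block : ∀ j < M * (4 * A), ∃ i < 2 ^ k, ∀ y, blockStart A k j i ≤ y →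
    y ≤ blockStart A k j i + (A * k : ℕ) →
      n y ((j * 64 ^ k : ℕ) * fineStep A k) = n y (((j + 1) * 64 ^ k : ℕ) * fineStep A k)

variable {Ω : Type*} [MeasurableSpace Ω] {Q : Measure Ω} {X : Ω → Config}
    {N : ℤ → ℝ≥0 → Ω → ℕ} {U : ℤ → ℕ → Ω → ℝ}

/-- The Borel–Cantelli lemma for events with geometrically decaying probabilities. -/
theorem ae_eventually_notMem_of_le {s : ℕ → Set Ω} {C r : ℝ} (hr0 : 0 ≤ r) (hr1 : r < 1)
    (h : ∀ k, Q (s k) ≤ ENNReal.ofReal (C * r ^ k)) : ∀ᵐ ω ∂Q, ∀ᶠ k in atTop, ω ∉ s k := by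
  refine ae_eventually_notMem (ne_top_of_le_ne_top ?_ (ENNReal.tsum_le_tsum h))
  exact ((summable_geometric_of_lt_one hr0 hr1).mul_left C).tsum_ofReal_ne_top

/-- The increments of the counting processes after time `s` are a driving noise. -/
theorem Driven.noise_shift [IsProbabilityMeasure Q] (h : Driven Q X N U) (s : ℝ≥0) :
    IsDrivingNoise Q (shiftN N s) (shiftU N U s) :=
  (h.shift s measurable_fst).noise

theorem Driven.measure_not_atMostOne_le [IsProbabilityMeasure Q] (h : Driven Q X N U)
    (W : Finset ℤ) (s t : ℝ≥0) :
    Q {ω | ¬ AtMostOneArrival (fun y r => N y r ω) W s (s + t)} ≤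
      ENNReal.ofReal ((W.card * t) ^ 2) := by
  refine le_trans (measure_mono ?_) ((h.noise_shift s).measure_multi_le W t)
  intro ω hω
  have hm : ∀ y, N y s ω ≤ N y (s + t) ω := fun y =>
    (h.noise.regular ω y).mono le_self_add
  refine ⟨fun h0 => hω (Or.inl fun y hy => ?_), fun y hy h1 => hω (Or.inr ⟨y, hy, fun z hz => ?_⟩)⟩
  · have := h0 y hy
    have := hm y
    simp only [shiftN] at *
    omega
  · have := h1 z hz
    have := hm z
    simp only [shiftN] at *
    omega

theorem fineStep_pos {A : ℕ} (hA : 0 < A) (k : ℕ) : 0 < fineStep A k := by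
  unfold fineStep; positivity

theorem slotCount_mul_fineStep {A : ℕ} (hA : 0 < A) (k M : ℕ) :
    (slotCount A k M : ℝ≥0) * fineStep A k = M := by
  have : (A : ℝ≥0) ≠ 0 := by positivity
  unfold slotCount fineStep
  push_cast
  field_simp

theorem card_window_le (k M : ℕ) :
    ((Finset.Icc (-(4 : ℤ) ^ (k + 1)) M).card : ℝ) ≤ (M + 5) * 4 ^ k := by
  rw [Int.card_Icc]
  have h1 : (1 : ℤ) ≤ 4 ^ k := one_le_pow₀ (by norm_num)
  have : (((M : ℤ) + 1 - -(4 : ℤ) ^ (k + 1)).toNat : ℤ) ≤ (M + 5) * 4 ^ k := by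
    rw [Int.toNat_of_nonneg (by rw [sub_neg_eq_add]; positivity)]
    rw [pow_succ]
    nlinarith
  exact_mod_cast this

/-- There are of the order of `64 ^ k` fine slots and `4 ^ k` sites, and the slots have length of
the order of `64 ^ (-k)`: some slot has two arrivals with probability `O(4 ^ (-k))`. -/
theorem ae_eventually_one [IsProbabilityMeasure Q] (h : Driven Q X N U) {A : ℕ} (hA : 0 < A)
    (M : ℕ) : ∀ᵐ ω ∂Q, ∀ᶠ k in atTop, ∀ i < slotCount A k M,
      AtMostOneArrival (fun y r => N y r ω) (Finset.Icc (-(4 : ℤ) ^ (k + 1)) M)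
        (i * fineStep A k) ((i + 1 : ℕ) * fineStep A k) := by
  have := ae_eventually_notMem_of_le (Q := Q) (r := 1 / 4) (C := (M : ℝ) * (M + 5) ^ 2)
    (s := fun k => ⋃ i ∈ Finset.range (slotCount A k M),
      {ω | ¬ AtMostOneArrival (fun y r => N y r ω) (Finset.Icc (-(4 : ℤ) ^ (k + 1)) M)
        (i * fineStep A k) ((i + 1 : ℕ) * fineStep A k)}) (by norm_num) (by norm_num) ?_
  · filter_upwards [this] with ω hω
    filter_upwards [hω] with k hk i hi
    simp only [Set.mem_iUnion, not_exists, Finset.mem_range] at hk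
    exact not_not.1 (hk i hi)
  · intro k
    set w := (Finset.Icc (-(4 : ℤ) ^ (k + 1)) (M : ℤ)).card with hw
    have hstep : ∀ i ∈ Finset.range (slotCount A k M),
        Q {ω | ¬ AtMostOneArrival (fun y r => N y r ω) (Finset.Icc (-(4 : ℤ) ^ (k + 1)) M)
        (i * fineStep A k) ((i + 1 : ℕ) * fineStep A k)} ≤
        ENNReal.ofReal ((w * fineStep A k) ^ 2) := by
      intro i _
      have e : ((i + 1 : ℕ) : ℝ≥0) * fineStep A k = i * fineStep A k + fineStep A k := by
        push_cast; ring
      rw [e]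
      exact h.measure_not_atMostOne_le _ _ _
    refine (measure_biUnion_finset_le _ _).trans ((Finset.sum_le_sum hstep).trans ?_)
    rw [Finset.sum_const, Finset.card_range, nsmul_eq_mul, ← ENNReal.ofReal_natCast,
      ← ENNReal.ofReal_mul (by positivity)]
    refine ENNReal.ofReal_le_ofReal ?_
    have e1 : (slotCount A k M : ℝ) * fineStep A k = M := by
      exact_mod_cast congrArg NNReal.toReal (slotCount_mul_fineStep hA k M)
    have e2 : (fineStep A k : ℝ) ≤ 1 / 64 ^ k := by
      unfold fineStep
      push_cast
      have : (1 : ℝ) ≤ A := by exact_mod_cast hA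
      refine one_div_le_one_div_of_le (by positivity) ?_
      nlinarith [show (0 : ℝ) < 64 ^ k by positivity]
    calc (slotCount A k M : ℝ) * (w * fineStep A k) ^ 2
        = (M : ℝ) * w ^ 2 * fineStep A k := by rw [← e1]; ring
      _ ≤ (M : ℝ) * ((M + 5) * 4 ^ k) ^ 2 * (1 / 64 ^ k) := by
          gcongr
          exact card_window_le k M
      _ = (M : ℝ) * (M + 5) ^ 2 * (1 / 4) ^ k := by
          have : (64 : ℝ) ^ k = 4 ^ k * 4 ^ k * 4 ^ k := by
            rw [← mul_pow, ← mul_pow]; norm_num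
          rw [this, one_div_pow]
          field_simp

/-- The probability of the more likely spin. -/
def maxWeight (p : unitInterval) : ℝ := max p (1 - p)

theorem spinWeight_le_maxWeight (p : unitInterval) (η : ℤˣ) :
    spinWeight p η ≤ ENNReal.ofReal (maxWeight p) := by
  rcases Int.units_eq_one_or η with rfl | rfl
  · rw [spinWeight_one]; exact ENNReal.ofReal_le_ofReal (le_max_left _ _)
  · rw [spinWeight_neg_one]; exact ENNReal.ofReal_le_ofReal (le_max_right _ _)

theorem maxWeight_nonneg (p : unitInterval) : 0 ≤ maxWeight p := p.2.1.trans (le_max_left _ _)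

theorem maxWeight_le_one (p : unitInterval) : maxWeight p ≤ 1 :=
  max_le p.2.2 (by linarith [p.2.1])

theorem maxWeight_lt_one {p : unitInterval} (hp0 : 0 < p) (hp1 : p < 1) : maxWeight p < 1 := by
  have h0 : (0 : ℝ) < p := hp0
  have h1 : (p : ℝ) < 1 := hp1
  exact max_lt h1 (by linarith)

theorem measurableSet_isConstOn (c d : ℤ) : MeasurableSet {σ : Config | IsConstOn σ c d} := by
  have : {σ : Config | IsConstOn σ c d} =
      ⋂ z, ⋂ (_ : c ≤ z), ⋂ (_ : z ≤ d), {σ | σ z = σ c} := by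
    ext σ; simp [IsConstOn]
  rw [this]
  exact MeasurableSet.iInter fun z => MeasurableSet.iInter fun _ => MeasurableSet.iInter fun _ =>
    measurableSet_eq_fun (measurable_pi_apply z) (measurable_pi_apply c)

theorem productBernoulli_isConstOn_le (p : unitInterval) (c : ℤ) (K : ℕ) :
    productBernoulli p {σ | IsConstOn σ c (c + K)} ≤ ENNReal.ofReal (2 * maxWeight p ^ K) := by
  have hsub : {σ : Config | IsConstOn σ c (c + K)} ⊆
      ⋃ η : ℤˣ, ((Finset.Icc c (c + K) : Finset ℤ) : Set ℤ).pi fun _ => {η} := by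
    intro σ hσ
    refine Set.mem_iUnion.2 ⟨σ c, fun z hz => ?_⟩
    rw [Finset.coe_Icc] at hz
    exact hσ z hz.1 hz.2
  refine (measure_mono hsub).trans ((measure_iUnion_fintype_le _ _).trans ?_)
  calc ∑ η : ℤˣ, productBernoulli p (((Finset.Icc c (c + K) : Finset ℤ) : Set ℤ).pi fun _ => {η})
      ≤ ∑ _η : ℤˣ, ENNReal.ofReal (maxWeight p ^ K) := by
        refine Finset.sum_le_sum fun η _ => ?_
        rw [productBernoulli, Measure.infinitePi_pi _ fun y _ => measurableSet_singleton _,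
          Finset.prod_const, Int.card_Icc]
        have e : (c + (K : ℤ) + 1 - c).toNat = K + 1 := by omega
        rw [e]
        calc spinWeight p η ^ (K + 1) ≤ ENNReal.ofReal (maxWeight p) ^ (K + 1) := by
              gcongr
              exact spinWeight_le_maxWeight p η
          _ ≤ ENNReal.ofReal (maxWeight p) ^ K := by
              refine pow_le_pow_of_le_one zero_le ?_ (Nat.le_succ K)
              rw [← ENNReal.ofReal_one]
              exact ENNReal.ofReal_le_ofReal (maxWeight_le_one p)
          _ = _ := (ENNReal.ofReal_pow (maxWeight_nonneg p) K).symm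
    _ = _ := by
        rw [Finset.sum_const, Finset.card_univ, nsmul_eq_mul, ← ENNReal.ofReal_natCast,
          ← ENNReal.ofReal_mul (by positivity)]
        simp [Fintype.card_units_int]

/-- By the density bound, long constant stretches are exponentially unlikely at any fixed time, with
a bound that does not depend on `L`. -/
theorem Driven.measure_isConstOn_le [IsProbabilityMeasure Q] (hd : Driven Q X N U) {lam : ℝ}
    (h0 : 0 < lam) (h1 : lam < 1) {p : unitInterval} (hp0 : 0 < p) (hp1 : p < 1)
    (hX : Q.map X = productBernoulli p) (L : ℕ) (t : ℝ≥0) {c : ℤ} (hc : -(L : ℤ) ≤ c) (K : ℕ) :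
    Q {ω | IsConstOn (halfLineProcess lam (fun y t => N y t ω) (fun y k => U y k ω) (X ω) L t)
        c (c + K)} ≤
      ENNReal.ofReal (Real.exp (densityRate lam p * t + 1) * (2 * maxWeight p ^ K)) := by
  classical
  set g : Config → ℝ≥0∞ := Set.indicator {σ | IsConstOn σ c (c + K)} 1 with hg
  have hb := densityBound_windowState hd h0 h1 hp0 hp1 hX L (c + K) t g
    (measurable_one.indicator (measurableSet_isConstOn c (c + K))) ?_
  · have e1 : ∀ ω, IsConstOn (halfLineProcess lam (fun y t => N y t ω) (fun y k => U y k ω) (X ω)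
        L t) c (c + K) ↔ IsConstOn (windowState lam (fun y t => N y t ω) (fun y k => U y k ω) (X ω)
        L (c + K) t) c (c + K) := by
      intro ω
      refine forall_congr' fun z => forall_congr' fun _ => forall_congr' fun hz => ?_
      rw [halfLineProcess_eq_windowState lam _ _ _ L hz,
        halfLineProcess_eq_windowState lam _ _ _ L (show c ≤ c + K by omega)]
    have hm : Measurable fun ω => windowState lam (fun y t => N y t ω) (fun y k => U y k ω) (X ω)
        L (c + K) t := by
      refine measurable_windowState lam L _ t (fun ω y => hd.noise.regular ω y)
        (fun y r _ => (hd.noise.poisson y).measurable r) (fun y k => hd.noise.measurable_U y k)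
        hd.measurable
    simp only [e1]
    rw [ENNReal.ofReal_mul (Real.exp_pos _).le]
    calc Q {ω | IsConstOn (windowState lam (fun y t => N y t ω) (fun y k => U y k ω) (X ω)
          L (c + K) t) c (c + K)}
        = ∫⁻ ω, g (windowState lam (fun y t => N y t ω) (fun y k => U y k ω) (X ω)
          L (c + K) t) ∂Q := by
          exact (lintegral_indicator_one (hm (measurableSet_isConstOn c (c + K)))).symm
      _ ≤ _ := hb
      _ ≤ _ := by
          rw [hg, lintegral_indicator_one (measurableSet_isConstOn c (c + K))]
          gcongr
          exact productBernoulli_isConstOn_le p c K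
  · intro σ σ' hσ
    have : IsConstOn σ c (c + K) ↔ IsConstOn σ' c (c + K) := by
      refine forall_congr' fun z => forall_congr' fun hz1 => forall_congr' fun hz => ?_
      rw [hσ z ⟨hc.trans hz1, hz⟩, hσ c ⟨hc, by omega⟩]
    simp only [hg, Set.indicator_apply, Set.mem_ofPred_eq, this, Pi.one_apply]

/-- The union bound over of the order of `64 ^ k` times, `4 ^ k` processes and `4 ^ k` stretches of
`A k + 1` sites, each of which is constant with probability `O(2048 ^ (-k))`. -/
theorem ae_eventually_nonconst [IsProbabilityMeasure Q] (hd : Driven Q X N U) {lam : ℝ}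
    (h0 : 0 < lam) (h1 : lam < 1) {p : unitInterval} (hp0 : 0 < p) (hp1 : p < 1)
    (hX : Q.map X = productBernoulli p) {A : ℕ} (hA : 0 < A)
    (hAp : maxWeight p ^ A ≤ 1 / 2048) (M : ℕ) :
    ∀ᵐ ω ∂Q, ∀ᶠ k in atTop, ∀ i ≤ slotCount A k M, ∀ L : ℕ, 4 ^ k ≤ L → L ≤ 4 ^ (k + 1) →
      ∀ c : ℤ, -(4 : ℤ) ^ k ≤ c → c + (A * k : ℕ) ≤ M →
      ¬ IsConstOn (halfLineProcess lam (fun y t => N y t ω) (fun y k => U y k ω) (X ω) L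
        (i * fineStep A k)) c (c + (A * k : ℕ)) := by
  set E : ℝ := Real.exp (densityRate lam p * M + 1) with hE
  set S : ℕ → ℕ → ℕ → ℤ → Set Ω := fun k i L c => {ω | IsConstOn (halfLineProcess lam
    (fun y t => N y t ω) (fun y k => U y k ω) (X ω) L (i * fineStep A k)) c (c + (A * k : ℕ))}
    with hS
  have := ae_eventually_notMem_of_le (Q := Q) (r := 1 / 2)
    (C := (4 * A * M + 1) * 5 * (M + 2) * (E * 2))
    (s := fun k => ⋃ i ∈ Finset.range (slotCount A k M + 1), ⋃ L ∈ Finset.Icc (4 ^ k) (4 ^ (k + 1)),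
      ⋃ c ∈ Finset.Icc (-(4 : ℤ) ^ k) M, S k i L c) (by norm_num) (by norm_num) ?_
  · filter_upwards [this] with ω hω
    filter_upwards [hω] with k hk i hi L hL1 hL2 c hc1 hc2 hconst
    refine hk ?_
    simp only [Set.mem_iUnion]
    exact ⟨i, Finset.mem_range.2 (by omega), L, Finset.mem_Icc.2 ⟨hL1, hL2⟩, c,
      Finset.mem_Icc.2 ⟨hc1, by omega⟩, hconst⟩
  · intro k
    have hone : ∀ i ∈ Finset.range (slotCount A k M + 1), ∀ L ∈ Finset.Icc (4 ^ k) (4 ^ (k + 1)),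
        ∀ c ∈ Finset.Icc (-(4 : ℤ) ^ k) M, Q (S k i L c) ≤
          ENNReal.ofReal (E * (2 * (1 / 2048) ^ k)) := by
      intro i hi L hL c hc
      rw [Finset.mem_range] at hi
      rw [Finset.mem_Icc] at hL hc
      have hcL : -(L : ℤ) ≤ c := by
        refine le_trans ?_ hc.1
        have : ((4 ^ k : ℕ) : ℤ) ≤ L := by exact_mod_cast hL.1
        push_cast at this
        omega
      refine (hd.measure_isConstOn_le h0 h1 hp0 hp1 hX L _ hcL (A * k)).trans
        (ENNReal.ofReal_le_ofReal ?_)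
      have ht : ((i * fineStep A k : ℝ≥0) : ℝ) ≤ M := by
        have : (i : ℝ≥0) * fineStep A k ≤ M := by
          rw [← slotCount_mul_fineStep hA k M]
          gcongr; omega
        exact_mod_cast this
      have hD : 0 ≤ densityRate lam p := ENNReal.toReal_nonneg
      have hq := maxWeight_nonneg p
      rw [hE, pow_mul]
      gcongr
    have hcL : ((Finset.Icc (4 ^ k) (4 ^ (k + 1))).card : ℝ) ≤ 5 * 4 ^ k := by
      rw [Nat.card_Icc]
      have : 4 ^ (k + 1) + 1 - 4 ^ k ≤ 5 * 4 ^ k := by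
        rw [pow_succ]; have : 0 < 4 ^ k := by positivity
        omega
      exact_mod_cast this
    have hcc : ((Finset.Icc (-(4 : ℤ) ^ k) M).card : ℝ) ≤ (M + 2) * 4 ^ k := by
      rw [Int.card_Icc]
      have h1 : (1 : ℤ) ≤ 4 ^ k := one_le_pow₀ (by norm_num)
      have : (((M : ℤ) + 1 - -(4 : ℤ) ^ k).toNat : ℤ) ≤ (M + 2) * 4 ^ k := by
        rw [Int.toNat_of_nonneg (by rw [sub_neg_eq_add]; positivity)]
        nlinarith
      exact_mod_cast this
    have hcS : ((slotCount A k M + 1 : ℕ) : ℝ) ≤ (4 * A * M + 1) * 64 ^ k := by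
      have : slotCount A k M + 1 ≤ (4 * A * M + 1) * 64 ^ k := by
        unfold slotCount
        have : 1 ≤ 64 ^ k := one_le_pow₀ (by norm_num)
        calc M * (4 * A) * 64 ^ k + 1 ≤ M * (4 * A) * 64 ^ k + 64 ^ k := by omega
          _ = _ := by ring
      exact_mod_cast this
    calc Q (⋃ i ∈ Finset.range (slotCount A k M + 1), ⋃ L ∈ Finset.Icc (4 ^ k) (4 ^ (k + 1)),
          ⋃ c ∈ Finset.Icc (-(4 : ℤ) ^ k) M, S k i L c)
        ≤ ∑ i ∈ Finset.range (slotCount A k M + 1), ∑ L ∈ Finset.Icc (4 ^ k) (4 ^ (k + 1)),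
          ∑ c ∈ Finset.Icc (-(4 : ℤ) ^ k) M, ENNReal.ofReal (E * (2 * (1 / 2048) ^ k)) := by
          refine (measure_biUnion_finset_le _ _).trans (Finset.sum_le_sum fun i hi => ?_)
          refine (measure_biUnion_finset_le _ _).trans (Finset.sum_le_sum fun L hL => ?_)
          refine (measure_biUnion_finset_le _ _).trans (Finset.sum_le_sum fun c hc => ?_)
          exact hone i hi L hL c hc
      _ = ENNReal.ofReal (((slotCount A k M + 1 : ℕ) : ℝ) *
          (((Finset.Icc (4 ^ k) (4 ^ (k + 1))).card : ℝ) *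
          (((Finset.Icc (-(4 : ℤ) ^ k) M).card : ℝ) * (E * (2 * (1 / 2048) ^ k))))) := by
          simp only [Finset.sum_const, Finset.card_range, nsmul_eq_mul]
          rw [ENNReal.ofReal_mul (Nat.cast_nonneg _), ENNReal.ofReal_mul (Nat.cast_nonneg _),
            ENNReal.ofReal_mul (Nat.cast_nonneg _)]
          simp only [ENNReal.ofReal_natCast]
      _ ≤ ENNReal.ofReal (((4 * A * M + 1) * 64 ^ k) * ((5 * 4 ^ k) *
          (((M + 2) * 4 ^ k) * (E * (2 * (1 / 2048) ^ k))))) := by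
          refine ENNReal.ofReal_le_ofReal ?_
          gcongr
      _ = _ := by
          congr 1
          have : (64 : ℝ) ^ k * 4 ^ k * 4 ^ k * (1 / 2048) ^ k = (1 / 2) ^ k := by
            rw [← mul_pow, ← mul_pow, ← mul_pow]; norm_num
          rw [← this]; ring

theorem one_sub_pow_le {q : ℝ} (hq0 : 0 < q) (hq1 : q ≤ 1) {m : ℕ} (hm : 0 < m) :
    (1 - q) ^ m ≤ 1 / (m * q) := by
  have hm' : (0 : ℝ) < m := by exact_mod_cast hm
  calc (1 - q) ^ m ≤ Real.exp (-q) ^ m := by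
        have := Real.add_one_le_exp (-q)
        exact pow_le_pow_left₀ (by linarith) (by linarith) m
    _ = 1 / Real.exp (m * q) := by
        rw [← Real.exp_nat_mul, one_div, ← Real.exp_neg]; ring_nf
    _ ≤ 1 / (m * q) := by
        refine one_div_le_one_div_of_le (by positivity) ?_
        linarith [Real.add_one_le_exp (m * q)]

/-- Disjoint blocks of sites have arrivals independently of each other. -/
theorem IsDrivingNoise.measure_iInter_arrival [IsProbabilityMeasure Q] (h : IsDrivingNoise Q N U)
    (s : Finset ℕ) (B : ℕ → Finset ℤ) (hB : Pairwise fun i j => Disjoint (B i) (B j)) {w : ℕ}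
    (hw : ∀ i, (B i).card = w) (t : ℝ≥0) :
    Q (⋂ i ∈ s, {ω | ∀ y ∈ B i, N y t ω = 0}ᶜ) =
      ENNReal.ofReal ((1 - Real.exp (-(w * t))) ^ s.card) := by
  have hm : ∀ i, MeasurableSet {ω | ∀ y ∈ B i, N y t ω = 0} := fun i =>
    h.measurableSet_counts (B i) t fun _ => 0
  have hI : iIndepSet (fun i => {ω | ∀ y ∈ B i, N y t ω = 0}) Q := by
    rw [iIndepSet_iff_meas_biInter hm]
    intro S
    have : (⋂ i ∈ S, {ω | ∀ y ∈ B i, N y t ω = 0}) =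
        {ω | ∀ y ∈ S.biUnion B, N y t ω = 0} := by
      ext ω
      simp only [Set.mem_iInter, Set.mem_ofPred_eq, Finset.mem_biUnion]
      grind
    rw [this, h.measure_noArrival, Finset.card_biUnion fun i _ j _ hij => hB hij]
    simp only [h.measure_noArrival, hw, Finset.prod_const, Finset.sum_const, smul_eq_mul]
    rw [← ENNReal.ofReal_pow (Real.exp_pos _).le, ← Real.exp_nat_mul]
    push_cast
    ring_nf
  rw [iIndepSet_iff] at hI
  rw [hI s (f := fun i => {ω | ∀ y ∈ B i, N y t ω = 0}ᶜ) fun i _ => MeasurableSet.compl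
    (MeasurableSpace.measurableSet_generateFrom rfl)]
  have : ∀ i ∈ s, Q {ω | ∀ y ∈ B i, N y t ω = 0}ᶜ = ENNReal.ofReal (1 - Real.exp (-(w * t))) := by
    intro i _
    rw [prob_compl_eq_one_sub (hm i), h.measure_noArrival, hw, ← ENNReal.ofReal_one,
      ENNReal.ofReal_sub _ (Real.exp_pos _).le]
  rw [Finset.prod_congr rfl this, Finset.prod_const, ENNReal.ofReal_pow]
  rw [sub_nonneg, Real.exp_le_one_iff]
  have : (0 : ℝ) ≤ w * t := by positivity
  linarith

/-- During a coarse slot, of length `1 / (4 A)`, a given block has no arrivals with probability at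
least `e⁻¹ (3 / 4) ^ k`. There are `2 ^ k` independent candidates, so that all of them have arrivals
with probability `O((2 / 3) ^ k)`. -/
theorem ae_eventually_block [IsProbabilityMeasure Q] (h : Driven Q X N U) {A : ℕ} (hA : 0 < A)
    (M : ℕ) : ∀ᵐ ω ∂Q, ∀ᶠ k in atTop, ∀ j < M * (4 * A), ∃ i < 2 ^ k, ∀ y,
      blockStart A k j i ≤ y → y ≤ blockStart A k j i + (A * k : ℕ) →
      N y ((j * 64 ^ k : ℕ) * fineStep A k) ω = N y (((j + 1) * 64 ^ k : ℕ) * fineStep A k) ω := by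
  set t : ℝ≥0 := 1 / (4 * A) with ht
  have hA' : (A : ℝ≥0) ≠ 0 := by positivity
  have htime : ∀ k j : ℕ, ((j * 64 ^ k : ℕ) : ℝ≥0) * fineStep A k = j * t := by
    intro k j
    unfold fineStep
    rw [ht]
    push_cast
    field_simp
  set B : ℕ → ℕ → ℕ → Finset ℤ := fun k j i =>
    Finset.Icc (blockStart A k j i) (blockStart A k j i + (A * k : ℕ)) with hB
  have hBcard : ∀ k j i, (B k j i).card = A * k + 1 := by
    intro k j i
    rw [hB, Int.card_Icc]; omega
  have hBd : ∀ k j, Pairwise fun i i' => Disjoint (B k j i) (B k j i') := by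
    intro k j
    have hlt : ∀ i i', i < i' → Disjoint (B k j i) (B k j i') := by
      intro i i' hii
      refine Finset.disjoint_left.2 fun y hy hy' => ?_
      simp only [hB, Finset.mem_Icc, blockStart] at hy hy'
      have : ((j * 2 ^ k + i : ℕ) : ℤ) * (A * k + 1 : ℕ) + (A * k + 1 : ℕ) ≤
          ((j * 2 ^ k + i' : ℕ) : ℤ) * (A * k + 1 : ℕ) := by
        have h1 : ((j * 2 ^ k + i : ℕ) : ℤ) + 1 ≤ ((j * 2 ^ k + i' : ℕ) : ℤ) := by
          exact_mod_cast (by omega : j * 2 ^ k + i + 1 ≤ j * 2 ^ k + i')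
        nlinarith [show (0 : ℤ) ≤ (A * k + 1 : ℕ) from Int.natCast_nonneg _]
      omega
    intro i i' hne
    rcases lt_or_gt_of_ne hne with h | h
    · exact hlt i i' h
    · exact (hlt i' i h).symm
  have := ae_eventually_notMem_of_le (Q := Q) (r := 2 / 3) (C := (M * (4 * A) : ℕ) * Real.exp 1)
    (s := fun k => ⋃ j ∈ Finset.range (M * (4 * A)), ⋂ i ∈ Finset.range (2 ^ k),
      {ω | ∀ y ∈ B k j i, shiftN N (j * t) y t ω = 0}ᶜ) (by norm_num) (by norm_num) ?_
  · filter_upwards [this] with ω hω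
    filter_upwards [hω] with k hk j hj
    by_contra hcon
    push Not at hcon
    refine hk ?_
    simp only [Set.mem_iUnion, Set.mem_iInter, Finset.mem_range]
    refine ⟨j, hj, fun i hi hall => ?_⟩
    obtain ⟨y, hy1, hy2, hne⟩ := hcon i hi
    have h0 := hall y (Finset.mem_Icc.2 ⟨hy1, hy2⟩)
    rw [htime, htime] at hne
    have e : ((j + 1 : ℕ) : ℝ≥0) * t = j * t + t := by push_cast; ring
    rw [e] at hne
    have hm : N y (j * t) ω ≤ N y (j * t + t) ω := (h.noise.regular ω y).mono le_self_add
    simp only [shiftN] at h0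
    omega
  · intro k
    have hj : ∀ j ∈ Finset.range (M * (4 * A)), Q (⋂ i ∈ Finset.range (2 ^ k),
        {ω | ∀ y ∈ B k j i, shiftN N (j * t) y t ω = 0}ᶜ) ≤
        ENNReal.ofReal (Real.exp 1 * (2 / 3) ^ k) := by
      intro j _
      rw [(h.noise_shift (j * t)).measure_iInter_arrival _ _ (hBd k j) (hBcard k j),
        Finset.card_range]
      refine ENNReal.ofReal_le_ofReal ?_
      have hA1 : (1 : ℝ) ≤ A := by exact_mod_cast hA
      set q : ℝ := Real.exp (-((A * k + 1 : ℕ) * t)) with hq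
      have hqt : ((A * k + 1 : ℕ) : ℝ) * t ≤ k * (1 / 4) + 1 := by
        rw [ht]
        push_cast
        have : ((A : ℝ) * k + 1) * (1 / (4 * A)) = k * (1 / 4) + 1 / (4 * A) := by field_simp
        rw [this]
        have : 1 / (4 * (A : ℝ)) ≤ 1 := by
          rw [div_le_one (by positivity)]; linarith
        linarith
      have hqlow : Real.exp (-1) * (3 / 4) ^ k ≤ q := by
        calc Real.exp (-1) * (3 / 4) ^ k ≤ Real.exp (-1) * Real.exp (-(1 / 4)) ^ k := by
              gcongr
              have := Real.add_one_le_exp (-(1 / 4) : ℝ)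
              linarith
          _ = Real.exp (-(k * (1 / 4) + 1)) := by
              rw [← Real.exp_nat_mul, ← Real.exp_add]; ring_nf
          _ ≤ q := by
              rw [hq]
              exact Real.exp_le_exp.2 (neg_le_neg hqt)
      have hq1 : q ≤ 1 := by
        rw [hq, Real.exp_le_one_iff]
        have : (0 : ℝ) ≤ (A * k + 1 : ℕ) * t := by positivity
        linarith
      calc (1 - q) ^ 2 ^ k ≤ 1 / ((2 ^ k : ℕ) * q) :=
            one_sub_pow_le (Real.exp_pos _) hq1 (by positivity)
        _ ≤ 1 / ((2 ^ k : ℕ) * (Real.exp (-1) * (3 / 4) ^ k)) := by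
            refine one_div_le_one_div_of_le (by positivity) ?_
            gcongr
        _ = Real.exp 1 * (2 / 3) ^ k := by
            push_cast
            rw [Real.exp_neg, show (2 / 3 : ℝ) = 1 / (2 * (3 / 4)) by norm_num, one_div_pow,
              mul_pow]
            field_simp
    refine (measure_biUnion_finset_le _ _).trans ((Finset.sum_le_sum hj).trans ?_)
    rw [Finset.sum_const, Finset.card_range, nsmul_eq_mul, ← ENNReal.ofReal_natCast,
      ← ENNReal.ofReal_mul (by positivity), mul_assoc]

/-- Almost surely, the behaviour is typical at all large scales. -/
theorem ae_eventually_good [IsProbabilityMeasure Q] (hd : Driven Q X N U) {lam : ℝ}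
    (h0 : 0 < lam) (h1 : lam < 1) {p : unitInterval} (hp0 : 0 < p) (hp1 : p < 1)
    (hX : Q.map X = productBernoulli p) {A : ℕ} (hA : 0 < A)
    (hAp : maxWeight p ^ A ≤ 1 / 2048) :
    ∀ᵐ ω ∂Q, ∀ M : ℕ, ∀ᶠ k in atTop,
      Good lam A k M (fun y t => N y t ω) (fun y k => U y k ω) (X ω) := by
  rw [ae_all_iff]
  intro M
  filter_upwards [ae_eventually_one hd hA M,
    ae_eventually_nonconst hd h0 h1 hp0 hp1 hX hA hAp M, ae_eventually_block hd hA M]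
    with ω e1 e2 e3
  filter_upwards [e1, e2, e3] with k e1 e2 e3
  exact ⟨e1, e2, e3⟩

/-- Constants for which the typical behaviour prevails exist. -/
theorem exists_blockFactor {p : unitInterval} (hp0 : 0 < p) (hp1 : p < 1) :
    ∃ A : ℕ, 0 < A ∧ maxWeight p ^ A ≤ 1 / 2048 := by
  obtain ⟨A, hA⟩ := exists_pow_lt_of_lt_one (show (0 : ℝ) < 1 / 2048 by norm_num)
    (maxWeight_lt_one hp0 hp1)
  refine ⟨A, Nat.pos_of_ne_zero ?_, hA.le⟩
  rintro rfl
  norm_num at hA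

end

section

/-! ### Convergence of the half-line processes -/

variable {lam : ℝ} {n : ℤ → ℝ≥0 → ℕ} {u : ℤ → ℕ → ℝ} {σ σ' : Config} {A k M : ℕ}

theorem isConstOn_congr {τ τ' : Config} {c d : ℤ} (hcd : c ≤ d)
    (h : ∀ z, c ≤ z → z ≤ d → τ z = τ' z) : IsConstOn τ c d ↔ IsConstOn τ' c d := by
  refine forall_congr' fun z => forall_congr' fun h1 => forall_congr' fun h2 => ?_
  rw [h z h1 h2, h c le_rfl hcd]

/-- The scale is so large that the barriers up to time `M` stay to the left of `-4 ^ k / 2`. -/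
def LargeScale (A k M : ℕ) : Prop := 2 * (M * (4 * A) * 2 ^ k * (A * k + 1)) ≤ 4 ^ k

theorem eventually_linear_le_two_pow (a b : ℕ) : ∀ᶠ k : ℕ in atTop, a * k + b ≤ 2 ^ k := by
  have h1 : Tendsto (fun k : ℕ => (k : ℝ) * (1 / 2) ^ k) atTop (𝓝 0) := by
    simpa using tendsto_pow_const_mul_const_pow_of_abs_lt_one 1
      (show |(1 / 2 : ℝ)| < 1 by norm_num [abs_of_pos])
  have h2 : Tendsto (fun k : ℕ => ((1 : ℝ) / 2) ^ k) atTop (𝓝 0) :=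
    tendsto_pow_atTop_nhds_zero_of_lt_one (by norm_num) (by norm_num)
  have h3 : Tendsto (fun k : ℕ => (a : ℝ) * ((k : ℝ) * (1 / 2) ^ k) + b * (1 / 2) ^ k) atTop
      (𝓝 0) := by
    simpa using (h1.const_mul (a : ℝ)).add (h2.const_mul (b : ℝ))
  filter_upwards [h3.eventually (gt_mem_nhds (show (0 : ℝ) < 1 by norm_num))] with k hk
  have h2k : (0 : ℝ) < 2 ^ k := by positivity
  have : ((a : ℝ) * k + b) / 2 ^ k < 1 := by
    calc ((a : ℝ) * k + b) / 2 ^ k = (a : ℝ) * ((k : ℝ) * (1 / 2) ^ k) + b * (1 / 2) ^ k := by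
          rw [one_div_pow]; ring
      _ < 1 := hk
  rw [div_lt_one h2k] at this
  exact_mod_cast this.le

theorem eventually_largeScale (A M : ℕ) : ∀ᶠ k in atTop, LargeScale A k M := by
  filter_upwards [eventually_linear_le_two_pow (2 * (M * (4 * A)) * A) (2 * (M * (4 * A)))]
    with k hk
  have h4 : 4 ^ k = 2 ^ k * 2 ^ k := by rw [← mul_pow]; norm_num
  unfold LargeScale
  rw [h4]
  calc 2 * (M * (4 * A) * 2 ^ k * (A * k + 1))
      = 2 ^ k * (2 * (M * (4 * A)) * A * k + 2 * (M * (4 * A))) := by ring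
    _ ≤ _ := by gcongr

theorem window_subset {L : ℕ} (hL : L ≤ 4 ^ (k + 1)) :
    Finset.Icc (-(L : ℤ)) M ⊆ Finset.Icc (-(4 : ℤ) ^ (k + 1)) M := by
  refine Finset.Icc_subset_Icc ?_ le_rfl
  have : (L : ℤ) ≤ ((4 ^ (k + 1) : ℕ) : ℤ) := by exact_mod_cast hL
  push_cast at this
  omega

theorem slotCount_pos (hA : 0 < A) (hM : 0 < M) : 0 < slotCount A k M := by
  unfold slotCount; positivity

/-- Every time up to `M` lies in a fine slot. -/
theorem exists_fineSlot (hA : 0 < A) (hM : 0 < M) {t : ℝ≥0} (ht : t ≤ M) :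
    ∃ i < slotCount A k M, i * fineStep A k ≤ t ∧ t ≤ (i + 1 : ℕ) * fineStep A k :=
  exists_slot (fineStep_pos hA k) (slotCount_pos hA hM)
    (by rw [slotCount_mul_fineStep hA]; exact ht)

/-- At a typical scale there are no long constant stretches at any time up to `M`: within a fine
slot the state is one of those at the two ends. -/
theorem Good.nonconst_of_le (hG : Good lam A k M n u σ) (hn : ∀ y, RegularPath (n y)) (hA : 0 < A)
    (hM : 0 < M) {t : ℝ≥0} (ht : t ≤ M) {L : ℕ} (hL : 4 ^ k ≤ L) (hL' : L ≤ 4 ^ (k + 1)) {c : ℤ}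
    (hc : -(4 : ℤ) ^ k ≤ c) (hcM : c + (A * k : ℕ) ≤ M) :
    ¬ IsConstOn (halfLineProcess lam n u σ L t) c (c + (A * k : ℕ)) := by
  obtain ⟨i, hi, h1, h2⟩ := exists_fineSlot (k := k) hA hM ht
  have key : ∀ s, windowState lam n u σ L M t = windowState lam n u σ L M s →
      ¬ IsConstOn (halfLineProcess lam n u σ L s) c (c + (A * k : ℕ)) →
      ¬ IsConstOn (halfLineProcess lam n u σ L t) c (c + (A * k : ℕ)) := by
    intro s hs hnc
    rwa [isConstOn_congr (τ' := halfLineProcess lam n u σ L s) (by omega)]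
    intro z hz1 hz2
    rw [halfLineProcess_eq_windowState lam n u σ L (hz2.trans hcM),
      halfLineProcess_eq_windowState lam n u σ L (hz2.trans hcM), hs]
  rcases windowState_eq_left_or_right hn (hG.one i hi) h1 h2 with e | e
  · exact key _ (e lam u σ L M (window_subset hL')) (hG.nonconst i hi.le L hL hL' c hc hcM)
  · exact key _ (e lam u σ L M (window_subset hL')) (hG.nonconst (i + 1) hi L hL hL' c hc hcM)

/-- At a typical scale, another evolution with the same noise, which has no long constant stretches
and has the same initial spins in `[-4 ^ k, M]`, agrees with the half-line process to the right
of `-4 ^ k / 2` up to time `M`. -/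
theorem Good.agree (hG : Good lam A k M n u σ) (hn : ∀ y, RegularPath (n y)) (hA : 0 < A)
    (hM : 0 < M) (hsize : LargeScale A k M) {L L' : ℕ} (hL : 4 ^ k ≤ L) (hL4 : L ≤ 4 ^ (k + 1))
    (hL' : 4 ^ k ≤ L') (hL4' : L' ≤ 4 ^ (k + 1))
    (hnc : ∀ i ≤ slotCount A k M, ∀ c : ℤ, -(4 : ℤ) ^ k ≤ c → c + (A * k : ℕ) ≤ M →
      ¬ IsConstOn (windowState lam n u σ' L' M (i * fineStep A k)) c (c + (A * k : ℕ)))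
    (hinit : ∀ x, -(4 : ℤ) ^ k ≤ x → x ≤ M → σ x = σ' x) {t : ℝ≥0} (ht : t ≤ M) {x : ℤ}
    (hx : -(4 : ℤ) ^ k ≤ 2 * x) (hxM : x ≤ M) :
    windowState lam n u σ L M t x = windowState lam n u σ' L' M t x := by
  choose! b hb hblock using hG.block
  set J := M * (4 * A) with hJ
  have hJpos : 0 < J := by positivity
  have h4 : ∀ {ℓ : ℕ}, 4 ^ k ≤ ℓ → -(ℓ : ℤ) ≤ -(4 : ℤ) ^ k := by
    intro ℓ hℓ
    have : ((4 ^ k : ℕ) : ℤ) ≤ ℓ := by exact_mod_cast hℓ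
    push_cast at this
    omega
  have hlow : ∀ j, -(4 : ℤ) ^ k ≤ blockStart A k j (b j) := by
    intro j
    unfold blockStart
    have : (0 : ℤ) ≤ (j * 2 ^ k + b j : ℕ) * (A * k + 1 : ℕ) := by positivity
    omega
  -- all the barriers stay to the left of `-4 ^ k / 2`
  have hup : ∀ j < J, 2 * (blockStart A k j (b j) + (A * k : ℕ) + 1) ≤ -(4 : ℤ) ^ k := by
    intro j hj
    have h1 : (j * 2 ^ k + b j + 1) * (A * k + 1) ≤ J * 2 ^ k * (A * k + 1) := by
      refine Nat.mul_le_mul_right _ ?_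
      have := hb j hj
      calc j * 2 ^ k + b j + 1 ≤ j * 2 ^ k + 2 ^ k := by omega
        _ = (j + 1) * 2 ^ k := by ring
        _ ≤ J * 2 ^ k := Nat.mul_le_mul_right _ hj
    have h2 : 2 * ((j * 2 ^ k + b j + 1) * (A * k + 1)) ≤ 4 ^ k := by
      unfold LargeScale at hsize
      rw [← hJ] at hsize
      omega
    have h3 : (2 : ℤ) * (((j * 2 ^ k + b j : ℕ) + 1) * (A * k + 1 : ℕ)) ≤ 4 ^ k := by
      exact_mod_cast h2
    unfold blockStart
    rw [add_mul, one_mul] at h3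
    push_cast at h3 ⊢
    linarith
  have hpos : (0 : ℤ) < 4 ^ k := by positivity
  have hS : ∀ {τ : Config} {ℓ : ℕ} {s : ℝ≥0} {c : ℤ}, c + (A * k : ℕ) ≤ M →
      ¬ IsConstOn (halfLineProcess lam n u τ ℓ s) c (c + (A * k : ℕ)) →
      ¬ IsConstOn (windowState lam n u τ ℓ M s) c (c + (A * k : ℕ)) := by
    intro τ ℓ s c hc h
    rwa [isConstOn_congr (τ' := halfLineProcess lam n u τ ℓ s) (by omega)]
    intro z _ hz2
    rw [halfLineProcess_eq_windowState lam n u τ ℓ (hz2.trans hc)]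
  have hcM : ∀ j < J, blockStart A k j (b j) + (A * k : ℕ) ≤ M := by
    intro j hj
    have := hup j hj
    omega
  refine agree_of_barriers (W := Finset.Icc (-(4 : ℤ) ^ (k + 1)) M) (g := 64 ^ k) (J := J)
    (K := A * k) (c := fun j => blockStart A k j (b j)) hn (fineStep_pos hA k) hG.one
    (window_subset hL4) (window_subset hL4') (by positivity)
    (fun j _ => (h4 hL).trans (hlow j)) (fun j _ => (h4 hL').trans (hlow j)) ?_ hblock
    (fun j hj i hi => hS (hcM j hj) (hG.nonconst i hi.le L hL hL4 _ (hlow j) (hcM j hj)))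
    (fun j hj i hi => hnc i hi.le _ (hlow j) (hcM j hj))
    (fun z hz hzM => hinit z ((hlow 0).trans hz) hzM) ?_ ?_ hxM
  · intro j hj
    unfold blockStart
    have h1 : j * 2 ^ k + b j ≤ (j + 1) * 2 ^ k + b (j + 1) := by
      have := hb j (by omega)
      rw [add_mul, one_mul]
      omega
    have h2 : ((j * 2 ^ k + b j : ℕ) : ℤ) * (A * k + 1 : ℕ) ≤
        (((j + 1) * 2 ^ k + b (j + 1) : ℕ) : ℤ) * (A * k + 1 : ℕ) := by
      gcongr
    omega
  · have := slotCount_mul_fineStep hA k M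
    unfold slotCount at this
    rw [this]
    exact ht
  · intro j hj
    have := hup j hj
    omega

/-- The half-line processes of one typical scale agree. -/
theorem Good.halfLine_eq (hG : Good lam A k M n u σ) (hn : ∀ y, RegularPath (n y)) (hA : 0 < A)
    (hM : 0 < M) (hsize : LargeScale A k M) {L L' : ℕ} (hL : 4 ^ k ≤ L) (hL4 : L ≤ 4 ^ (k + 1))
    (hL' : 4 ^ k ≤ L') (hL4' : L' ≤ 4 ^ (k + 1)) {t : ℝ≥0} (ht : t ≤ M) {x : ℤ}
    (hx : -(4 : ℤ) ^ k ≤ 2 * x) (hxM : x ≤ M) :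
    halfLineProcess lam n u σ L t x = halfLineProcess lam n u σ L' t x := by
  rw [halfLineProcess_eq_windowState lam n u σ L hxM,
    halfLineProcess_eq_windowState lam n u σ L' hxM]
  refine hG.agree hn hA hM hsize hL hL4 hL' hL4' (fun i hi c hc hcM => ?_) (fun _ _ _ => rfl) ht hx
    hxM
  rw [isConstOn_congr (τ' := halfLineProcess lam n u σ L' (i * fineStep A k)) (by omega)]
  · exact hG.nonconst i hi L' hL' hL4' c hc hcM
  · intro z _ hz2
    rw [halfLineProcess_eq_windowState lam n u σ L' (hz2.trans hcM)]

theorem limitProcess_eq_of_eventually {t : ℝ≥0} {x : ℤ} {v : ℤˣ}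
    (h : ∀ᶠ L : ℕ in atTop, halfLineProcess lam n u σ L t x = v) :
    limitProcess lam n u σ t x = v := by
  unfold limitProcess
  rcases Int.units_eq_one_or v with rfl | rfl
  · rw [if_pos h]
  · rw [if_neg]
    intro h'
    obtain ⟨L, h1, h2⟩ := (h.and h').exists
    rw [h1] at h2
    exact absurd h2 (by decide)

/-- If the behaviour is typical at all large scales, then the half-line processes are eventually
equal to the limit process, locally uniformly in space and time. -/
theorem eventually_halfLine_eq_limit (hn : ∀ y, RegularPath (n y)) (hA : 0 < A) (hM : 0 < M)
    (hG : ∀ᶠ k in atTop, Good lam A k M n u σ) :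
    ∀ᶠ k : ℕ in atTop, ∀ L : ℕ, 4 ^ k ≤ L → ∀ t ≤ (M : ℝ≥0), ∀ x : ℤ, -(4 : ℤ) ^ k ≤ 2 * x →
      x ≤ M → halfLineProcess lam n u σ L t x = limitProcess lam n u σ t x := by
  obtain ⟨k₀, hk₀⟩ := eventually_atTop.1 (hG.and (eventually_largeScale A M))
  filter_upwards [eventually_ge_atTop k₀] with k hk
  have step : ∀ L : ℕ, 4 ^ k ≤ L → ∀ t ≤ (M : ℝ≥0), ∀ x : ℤ, -(4 : ℤ) ^ k ≤ 2 * x →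
      x ≤ M → halfLineProcess lam n u σ L t x = halfLineProcess lam n u σ (4 ^ k) t x := by
    intro L hL t ht x hx hxM
    have hx' : ∀ j, k ≤ j → -(4 : ℤ) ^ j ≤ 2 * x := by
      intro j hj
      have : (4 : ℤ) ^ k ≤ 4 ^ j := pow_le_pow_right₀ (by norm_num) hj
      omega
    -- consecutive scales overlap in the process with `L = 4 ^ (j + 1)`
    have chain : ∀ j, k ≤ j →
        halfLineProcess lam n u σ (4 ^ j) t x = halfLineProcess lam n u σ (4 ^ k) t x := by
      intro j hj
      induction j, hj using Nat.le_induction with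
      | base => rfl
      | succ j hj ih =>
        rw [← ih]
        have h4 : 4 ^ j ≤ 4 ^ (j + 1) := Nat.pow_le_pow_right (by norm_num) (Nat.le_succ j)
        exact (hk₀ j (hk.trans hj)).1.halfLine_eq hn hA hM (hk₀ j (hk.trans hj)).2 h4 le_rfl le_rfl
          h4 ht (hx' j hj) hxM
    have hL0 : L ≠ 0 := (Nat.lt_of_lt_of_le (by positivity) hL).ne'
    have hlog : k ≤ Nat.log 4 L := Nat.le_log_of_pow_le (by norm_num) hL
    rw [← chain _ hlog]
    have h4 : 4 ^ Nat.log 4 L ≤ 4 ^ (Nat.log 4 L + 1) :=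
      Nat.pow_le_pow_right (by norm_num) (Nat.le_succ _)
    exact (hk₀ _ (hk.trans hlog)).1.halfLine_eq hn hA hM (hk₀ _ (hk.trans hlog)).2
      (Nat.pow_log_le_self 4 hL0) (Nat.lt_pow_succ_log_self (by norm_num) L).le le_rfl h4 ht
      (hx' _ hlog) hxM
  intro L hL t ht x hx hxM
  rw [step L hL t ht x hx hxM]
  refine (limitProcess_eq_of_eventually ?_).symm
  filter_upwards [eventually_ge_atTop (4 ^ k)] with L' hL'
  exact step L' hL' t ht x hx hxM

theorem eventually_neg_four_pow_le (x : ℤ) : ∀ᶠ k : ℕ in atTop, -(4 : ℤ) ^ k ≤ 2 * x := by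
  filter_upwards [eventually_ge_atTop (2 * x).natAbs] with k hk
  have h1 : k < 4 ^ k := Nat.lt_pow_self (by norm_num)
  have h2 : ((2 * x).natAbs : ℤ) ≤ (4 ^ k : ℕ) := by exact_mod_cast hk.trans h1.le
  rw [Nat.cast_pow, Nat.cast_ofNat] at h2
  omega

/-- Convergence of the half-line processes, uniformly on compact time intervals. -/
theorem eventually_forall_halfLine_eq_limit (hn : ∀ y, RegularPath (n y)) (hA : 0 < A)
    (hG : ∀ M : ℕ, ∀ᶠ k in atTop, Good lam A k M n u σ) (T : ℝ≥0) (x : ℤ) :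
    ∀ᶠ L : ℕ in atTop, ∀ t ≤ T,
      halfLineProcess lam n u σ L t x = limitProcess lam n u σ t x := by
  set M : ℕ := ⌈T⌉₊ + x.natAbs + 1 with hM
  have hTM : T ≤ M := (Nat.le_ceil T).trans (by rw [hM]; gcongr; omega)
  obtain ⟨k, h1, h2⟩ := ((eventually_halfLine_eq_limit hn hA (show 0 < M by omega) (hG M)).and
    (eventually_neg_four_pow_le x)).exists
  filter_upwards [eventually_ge_atTop (4 ^ k)] with L hL t ht
  exact h1 L hL t (ht.trans hTM) x h2 (by omega)

/-! ### Regularity of the paths -/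

theorem RegularPath.eventually_eq_left {n : ℝ≥0 → ℕ} (hn : RegularPath n) (t : ℝ≥0) :
    ∃ v, ∀ᶠ s in 𝓝[<] t, n s = v := by
  rcases eq_or_ne t 0 with rfl | ht
  · refine ⟨0, ?_⟩
    have : 𝓝[<] (0 : ℝ≥0) = ⊥ := by
      rw [show Set.Iio (0 : ℝ≥0) = ∅ from Set.Iio_bot, nhdsWithin_empty]
    rw [this]
    exact eventually_bot
  · have hbdd : BddAbove (n '' Set.Iio t) :=
      ⟨n t, by rintro _ ⟨s, hs, rfl⟩; exact hn.mono (le_of_lt hs)⟩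
    have hne : (n '' Set.Iio t).Nonempty := ⟨n 0, 0, pos_iff_ne_zero.2 ht, rfl⟩
    obtain ⟨r, hr, hrv⟩ := Nat.sSup_mem hne hbdd
    refine ⟨n r, ?_⟩
    filter_upwards [Ioo_mem_nhdsLT hr] with s hs
    refine le_antisymm ?_ (hn.mono hs.1.le)
    rw [hrv]
    exact le_csSup hbdd ⟨s, hs.2, rfl⟩

theorem windowState_eventually_eq_right (hn : ∀ y, RegularPath (n y)) (L : ℕ) (R : ℤ) (t : ℝ≥0) :
    ∀ᶠ s in 𝓝[≥] t, windowState lam n u σ L R s = windowState lam n u σ L R t := by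
  have : ∀ᶠ s in 𝓝[≥] t, ∀ y ∈ Finset.Icc (-(L : ℤ)) R, n y s = n y t :=
    (Finset.eventually_all _).2 fun y _ => (hn y).eventually_eq_right t
  filter_upwards [this] with s hs
  exact windowState_eq_of_no_arrival lam n u σ L R fun y h1 h2 =>
    (hs y (Finset.mem_Icc.2 ⟨h1, h2⟩)).symm

theorem windowState_eventually_eq_left (hn : ∀ y, RegularPath (n y)) (L : ℕ) (R : ℤ) (t : ℝ≥0) :
    ∃ τ, ∀ᶠ s in 𝓝[<] t, windowState lam n u σ L R s = τ := by
  choose v hv using fun y => (hn y).eventually_eq_left t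
  have h : ∀ᶠ s in 𝓝[<] t, ∀ y ∈ Finset.Icc (-(L : ℤ)) R, n y s = v y :=
    (Finset.eventually_all _).2 fun y _ => hv y
  rcases eq_or_neBot (𝓝[<] t) with hbot | hne
  · exact ⟨σ, by rw [hbot]; exact eventually_bot⟩
  · obtain ⟨r, hr⟩ := h.exists
    refine ⟨windowState lam n u σ L R r, ?_⟩
    filter_upwards [h] with s hs
    refine windowState_eq_of_no_arrival lam n u σ L R fun y h1 h2 => ?_
    rw [hr y (Finset.mem_Icc.2 ⟨h1, h2⟩), hs y (Finset.mem_Icc.2 ⟨h1, h2⟩)]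

/-- The limit process has right-continuous paths with left limits. -/
theorem limitProcess_cadlag (hn : ∀ y, RegularPath (n y)) (hA : 0 < A)
    (hG : ∀ M : ℕ, ∀ᶠ k in atTop, Good lam A k M n u σ) (t : ℝ≥0) :
    ContinuousWithinAt (fun s => limitProcess lam n u σ s) (Set.Ici t) t ∧
      ∃ l : Config, Tendsto (fun s => limitProcess lam n u σ s) (𝓝[<] t) (𝓝 l) := by
  have hloc : ∀ x : ℤ, ∃ L : ℕ, ∀ s ≤ t + 1,
      windowState lam n u σ L x s x = limitProcess lam n u σ s x := fun x =>
    (eventually_forall_halfLine_eq_limit hn hA hG (t + 1) x).exists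
  have hlt : ∀ᶠ s in 𝓝 t, s ≤ t + 1 := by
    filter_upwards [Iio_mem_nhds (lt_add_one t)] with s hs
    exact le_of_lt hs
  constructor
  · rw [continuousWithinAt_pi]
    intro x
    obtain ⟨L, hL⟩ := hloc x
    rw [ContinuousWithinAt, nhds_discrete ℤˣ, tendsto_pure]
    filter_upwards [windowState_eventually_eq_right (lam := lam) (u := u) (σ := σ) hn L x t,
      nhdsWithin_le_nhds hlt] with s hs1 hs2
    rw [← hL s hs2, hs1, hL t le_self_add]
  · have : ∀ x : ℤ, ∃ v : ℤˣ, ∀ᶠ s in 𝓝[<] t, limitProcess lam n u σ s x = v := by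
      intro x
      obtain ⟨L, hL⟩ := hloc x
      obtain ⟨τ, hτ⟩ := windowState_eventually_eq_left (lam := lam) (u := u) (σ := σ) hn L x t
      refine ⟨τ x, ?_⟩
      filter_upwards [hτ, nhdsWithin_le_nhds hlt] with s hs1 hs2
      rw [← hL s hs2, hs1]
    choose l hl using this
    refine ⟨l, tendsto_pi_nhds.2 fun x => ?_⟩
    rw [nhds_discrete ℤˣ, tendsto_pure]
    exact hl x

end

section

/-! ### The stochastic differential equation -/

variable {lam : ℝ} {n : ℤ → ℝ≥0 → ℕ} {u : ℤ → ℕ → ℝ} {σ σ' : Config} {A k M : ℕ}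

theorem sum_units_real (f : ℤˣ → ℝ) : ∑ η : ℤˣ, f η = f 1 + f (-1) := by
  have : (Finset.univ : Finset ℤˣ) = {1, -1} := by decide
  rw [this, Finset.sum_pair (by decide)]

open Classical in
/-- The change of the spin at `x` by an update at `x` itself. -/
theorem update_self_sub {v : ℝ} (hv : v ≠ lam) (σ : Config) (x : ℤ) :
    (((update lam σ x v x : ℤˣ) : ℤ) : ℝ) - ((σ x : ℤ) : ℝ) =
      ∑ η : ℤˣ, 2 * ((η : ℤ) : ℝ) * -(if HasMark lam η v then chi η x x σ else 0) := by
  have hchi : ∀ η, chi η x x σ = if σ x = η then 1 else 0 := by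
    intro η
    unfold chi
    refine if_congr ⟨fun h => h x le_rfl le_rfl, fun h z h1 h2 => ?_⟩ rfl rfl
    rwa [le_antisymm h2 h1]
  have hne : (-1 : ℤˣ) ≠ 1 := by decide
  have hne' : (1 : ℤˣ) ≠ -1 := by decide
  rw [sum_units_real]
  simp only [hchi, HasMark]
  rcases Int.units_eq_one_or (σ x) with h | h
  · rcases lt_or_gt_of_ne hv with hlt | hlt
    · simp [update, exchange, h, hlt, hlt.le, hne, hne']; norm_num
    · simp [update, h, hlt, hne, hne', not_lt.2 hlt.le, not_le.2 hlt]
  · rcases lt_or_gt_of_ne hv with hlt | hlt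
    · simp [update, h, hlt, hlt.le, hne, hne', not_lt.2 hlt.le]
    · simp [update, exchange, h, hlt, hne, hne']; norm_num

open Classical in
/-- The change of the spin at `x` by an update at `y < x`. -/
theorem update_sub {v : ℝ} (hv : v ≠ lam) (σ : Config) {x y : ℤ} (hyx : y < x) :
    (((update lam σ y v x : ℤˣ) : ℤ) : ℝ) - ((σ x : ℤ) : ℝ) =
      ∑ η : ℤˣ, 2 * ((η : ℤ) : ℝ) *
        (if HasMark lam η v then chi η y (x - 1) σ * chi (-η) x x σ else 0) := by
  have hchi : ∀ η, chi η x x σ = if σ x = η then 1 else 0 := by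
    intro η
    unfold chi
    refine if_congr ⟨fun h => h x le_rfl le_rfl, fun h z h1 h2 => ?_⟩ rfl rfl
    rwa [le_antisymm h2 h1]
  have hne : (-1 : ℤˣ) ≠ 1 := by decide
  have hne' : (1 : ℤˣ) ≠ -1 := by decide
  have hchi0 : ∀ η, σ y ≠ η → chi η y (x - 1) σ = 0 := by
    intro η h
    unfold chi
    rw [if_neg]
    intro hall
    exact h (hall y le_rfl (by omega))
  have hxy : x ≠ y := hyx.ne'
  have hfirst : IsFirstOpposite σ y x ↔
      (∀ z, y ≤ z → z ≤ x - 1 → σ z = σ y) ∧ σ x = -σ y := by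
    constructor
    · rintro ⟨_, h2, h3⟩
      refine ⟨fun z hz1 hz2 => ?_, h2⟩
      rcases hz1.eq_or_lt with rfl | h
      · rfl
      · exact h3 z h (by omega)
    · rintro ⟨h1, h2⟩
      exact ⟨hyx, h2, fun w hw1 hw2 => h1 w hw1.le (by omega)⟩
  have hprod : chi (σ y) y (x - 1) σ * chi (-σ y) x x σ =
      if IsFirstOpposite σ y x then 1 else 0 := by
    rw [hchi, chi]
    by_cases h1 : ∀ z, y ≤ z → z ≤ x - 1 → σ z = σ y
    · by_cases h2 : σ x = -σ y
      · rw [if_pos h1, if_pos h2, if_pos (hfirst.2 ⟨h1, h2⟩), mul_one]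
      · rw [if_neg h2, if_neg fun h => h2 (hfirst.1 h).2, mul_zero]
    · rw [if_neg h1, if_neg fun h => h1 (hfirst.1 h).1, zero_mul]
  rw [sum_units_real]
  by_cases hf : IsFirstOpposite σ y x
  · rw [if_pos hf] at hprod
    have hx := hf.2.1
    rcases Int.units_eq_one_or (σ y) with h | h
    · rw [h] at hprod hx
      rw [hchi0 (-1) (by rw [h]; exact hne'), hprod]
      rcases lt_or_gt_of_ne hv with hlt | hlt
      · simp [update, exchange, h, hlt, hlt.le, hne, hf, hx, HasMark]; norm_num
      · simp [update, h, hlt, hne, hne', not_lt.2 hlt.le, not_le.2 hlt, HasMark]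
    · rw [h] at hprod hx
      rw [hchi0 1 (by rw [h]; exact hne), hprod]
      rcases lt_or_gt_of_ne hv with hlt | hlt
      · simp [update, h, hlt, hlt.le, hne, hne', not_lt.2 hlt.le, HasMark]
      · simp [update, exchange, h, hlt, hne, hf, hx, HasMark]; norm_num
  · rw [if_neg hf] at hprod
    have hup : update lam σ y v x = σ x := by
      unfold update
      split_ifs
      · unfold exchange
        rw [if_neg]
        rintro (h | h)
        · exact hxy h
        · exact hf h
      · rfl
    rw [hup, sub_self]
    rcases Int.units_eq_one_or (σ y) with h | h
    · rw [h] at hprod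
      rw [hchi0 (-1) (by rw [h]; exact hne'), hprod]
      simp
    · rw [h] at hprod
      rw [hchi0 1 (by rw [h]; exact hne), hprod]
      simp

theorem chi_congr {η : ℤˣ} {a b : ℤ} {τ τ' : Config} (h : ∀ z, a ≤ z → z ≤ b → τ z = τ' z) :
    chi η a b τ = chi η a b τ' := by
  unfold chi
  refine if_congr ?_ rfl rfl
  refine forall_congr' fun z => forall_congr' fun h1 => forall_congr' fun h2 => ?_
  rw [h z h1 h2]

theorem thinnedIntegral_add {n : ℝ≥0 → ℕ} (hn : RegularPath n) (u : ℕ → ℝ) (η : ℤˣ)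
    (g : ℝ≥0 → ℝ) {a b c : ℝ≥0} (hab : a ≤ b) (hbc : b ≤ c) :
    thinnedIntegral lam n u η g a b + thinnedIntegral lam n u η g b c =
      thinnedIntegral lam n u η g a c := by
  unfold thinnedIntegral
  rw [← Finset.Ioc_union_Ioc_eq_Ioc (hn.mono hab) (hn.mono hbc), Finset.sum_union]
  refine Finset.disjoint_left.2 fun j h1 h2 => ?_
  rw [Finset.mem_Ioc] at h1 h2
  omega

theorem thinnedIntegral_of_eq {n : ℝ≥0 → ℕ} (u : ℕ → ℝ) (η : ℤˣ)
    (g : ℝ≥0 → ℝ) {a b : ℝ≥0} (h : n b = n a) : thinnedIntegral lam n u η g a b = 0 := by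
  unfold thinnedIntegral
  rw [h, Finset.Ioc_self, Finset.sum_empty]

open Classical in
theorem thinnedIntegral_of_single {n : ℝ≥0 → ℕ} (u : ℕ → ℝ) (η : ℤˣ)
    (g : ℝ≥0 → ℝ) {a b : ℝ≥0} (h : n b = n a + 1) :
    thinnedIntegral lam n u η g a b =
      if HasMark lam η (u (n b)) then g (jumpTime n (n b)) else 0 := by
  unfold thinnedIntegral
  rw [h, show Finset.Ioc (n a) (n a + 1) = {n a + 1} by ext; simp, Finset.sum_singleton]

theorem thinnedIntegral_eq_zero {n : ℝ≥0 → ℕ} (u : ℕ → ℝ) (η : ℤˣ)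
    {g : ℝ≥0 → ℝ} {a b : ℝ≥0} (h : ∀ j ∈ Finset.Ioc (n a) (n b), g (jumpTime n j) = 0) :
    thinnedIntegral lam n u η g a b = 0 := by
  unfold thinnedIntegral
  refine Finset.sum_eq_zero fun j hj => ?_
  rw [h j hj, ite_self]

theorem AtMostOneArrival.mono {n : ℤ → ℝ≥0 → ℕ} (hn : ∀ y, RegularPath (n y)) {W : Finset ℤ}
    {a b a' b' : ℝ≥0} (h : AtMostOneArrival n W a b) (h1 : a ≤ a') (h2 : a' ≤ b') (h3 : b' ≤ b) :
    AtMostOneArrival n W a' b' := by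
  have e1 : ∀ z, n z a ≤ n z a' := fun z => (hn z).mono h1
  have e2 : ∀ z, n z a' ≤ n z b' := fun z => (hn z).mono h2
  have e3 : ∀ z, n z b' ≤ n z b := fun z => (hn z).mono h3
  rcases h with h | ⟨y, hy, h⟩
  · refine Or.inl fun z hz => ?_
    have := h z hz; have := e1 z; have := e2 z; have := e3 z
    omega
  · have hoff : ∀ z ∈ W, z ≠ y → n z b' = n z a' := by
      intro z hz hzy
      have h0 := h z hz; have := e1 z; have := e2 z; have := e3 z
      rw [if_neg hzy] at h0
      omega
    have hyy := h y hy
    rw [if_pos rfl] at hyy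
    have := e1 y; have := e2 y; have := e3 y
    rcases (show n y b' = n y a' ∨ n y b' = n y a' + 1 by omega) with e | e
    · refine Or.inl fun z hz => ?_
      by_cases hzy : z = y
      · rw [hzy, e]
      · exact hoff z hz hzy
    · refine Or.inr ⟨y, hy, fun z hz => ?_⟩
      by_cases hzy : z = y
      · rw [if_pos hzy, hzy, e]
      · rw [if_neg hzy, add_zero, hoff z hz hzy]

/-- Up to time `T` the path `ρ` coincides on `[x - 1 - K, x]` with a window process which is never
constant on `[x - 1 - K, x - 1]`. Exchanges from the left of this stretch thus never reach `x`. -/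
structure LocalData (lam : ℝ) (n : ℤ → ℝ≥0 → ℕ) (u : ℤ → ℕ → ℝ) (σ₀ : Config) (ρ : ℝ≥0 → Config)
    (L : ℕ) (R : ℤ) (K : ℕ) (x : ℤ) (T : ℝ≥0) : Prop where
  left : -(L : ℤ) ≤ x - 1 - K
  right : x ≤ R
  eq : ∀ t ≤ T, ∀ z, x - 1 - K ≤ z → z ≤ x → ρ t z = windowState lam n u σ₀ L R t z
  nonconst : ∀ t ≤ T, ¬ IsConstOn (windowState lam n u σ₀ L R t) (x - 1 - K) (x - 1)
  limits : ∀ t, ∃ l : Config, Tendsto ρ (𝓝[<] t) (𝓝 l)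

section

variable {σ₀ : Config} {ρ : ℝ≥0 → Config} {L K : ℕ} {R x : ℤ} {T : ℝ≥0}

theorem LocalData.leftLim_eventually (hd : LocalData lam n u σ₀ ρ L R K x T) {t : ℝ≥0}
    (ht : 0 < t) (z : ℤ) :
    ∀ᶠ s in 𝓝[<] t, ρ s z = Function.leftLim ρ t z := by
  obtain ⟨l, hl⟩ := hd.limits t
  have : (𝓝[<] t).NeBot := nhdsLT_neBot_of_exists_lt ⟨0, ht⟩
  rw [leftLim_eq_of_tendsto hl]
  have := tendsto_pi_nhds.1 hl z
  rw [nhds_discrete ℤˣ, tendsto_pure] at this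
  exact this

/-- Just before the only jump in a time slot the spins are those at the beginning of the slot. -/
theorem LocalData.leftLim_eq (hd : LocalData lam n u σ₀ ρ L R K x T)
    {a t : ℝ≥0} (hat : a < t) (htT : t ≤ T)
    (h : ∀ s, a ≤ s → s < t → ∀ y, -(L : ℤ) ≤ y → y ≤ R → n y s = n y a) {z : ℤ}
    (hz : x - 1 - K ≤ z) (hzx : z ≤ x) :
    Function.leftLim ρ t z = windowState lam n u σ₀ L R a z := by
  have h0 : 0 < t := zero_le.trans_lt hat
  have : (𝓝[<] t).NeBot := nhdsLT_neBot_of_exists_lt ⟨0, h0⟩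
  obtain ⟨s, hs1, hs2⟩ := ((hd.leftLim_eventually h0 z).and (Ioo_mem_nhdsLT hat)).exists
  rw [← hs1, hd.eq s (hs2.2.le.trans htT) z hz hzx]
  rw [windowState_eq_of_no_arrival lam n u σ₀ L R fun y hy1 hy2 =>
    (h s hs2.1.le hs2.2 y hy1 hy2).symm]

theorem LocalData.leftLim_nonconst (hd : LocalData lam n u σ₀ ρ L R K x T) {t : ℝ≥0} (ht : 0 < t)
    (htT : t ≤ T) : ¬ IsConstOn (Function.leftLim ρ t) (x - 1 - K) (x - 1) := by
  have : (𝓝[<] t).NeBot := nhdsLT_neBot_of_exists_lt ⟨0, ht⟩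
  have h : ∀ᶠ s in 𝓝[<] t, ∀ z ∈ Finset.Icc (x - 1 - K) (x - 1),
      ρ s z = Function.leftLim ρ t z :=
    (Finset.eventually_all _).2 fun z _ => hd.leftLim_eventually ht z
  obtain ⟨s, hs1, hs2⟩ := (h.and (Ioo_mem_nhdsLT ht)).exists
  rw [isConstOn_congr (τ' := windowState lam n u σ₀ L R s) (by omega)]
  · exact hd.nonconst s (hs2.2.le.trans htT)
  · intro z h1 h2
    rw [← hs1 z (Finset.mem_Icc.2 ⟨h1, h2⟩), hd.eq s (hs2.2.le.trans htT) z h1 (by omega)]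

theorem jumpTime_mem {n : ℝ≥0 → ℕ} (hn : RegularPath n) {a b : ℝ≥0} {j : ℕ}
    (hj : j ∈ Finset.Ioc (n a) (n b)) : a < jumpTime n j ∧ jumpTime n j ≤ b := by
  rw [Finset.mem_Ioc] at hj
  exact ⟨(hn.lt_jumpTime_iff hj.2).2 hj.1, (hn.jumpTime_le_iff hj.2).2 hj.2⟩

/-- Arrivals at a distance of more than `K + 1` do not change the spin at `x`. -/
theorem LocalData.gainTerm_eq_zero (hd : LocalData lam n u σ₀ ρ L R K x T)
    (hn : ∀ y, RegularPath (n y)) {t₁ t₂ : ℝ≥0} (ht : t₂ ≤ T) (η : ℤˣ) {y : ℤ}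
    (hy : y < x - 1 - K) : gainTerm lam n u ρ x t₁ t₂ η y = 0 := by
  unfold gainTerm
  refine thinnedIntegral_eq_zero _ _ fun j hj => ?_
  obtain ⟨h1, h2⟩ := jumpTime_mem (hn y) hj
  have hnc := hd.leftLim_nonconst (zero_le.trans_lt h1) (h2.trans ht)
  have : chi η y (x - 1) (Function.leftLim ρ (jumpTime (n y) j)) = 0 := by
    unfold chi
    rw [if_neg]
    intro hall
    refine hnc fun z hz1 hz2 => ?_
    rw [hall z (by omega) hz2, hall (x - 1 - K) hy.le (by omega)]
  rw [this, zero_mul]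

/-- The right-hand side of the equation, restricted to the sites which can influence `x`. -/
def localIncrement (lam : ℝ) (n : ℤ → ℝ≥0 → ℕ) (u : ℤ → ℕ → ℝ) (ρ : ℝ≥0 → Config) (K : ℕ) (x : ℤ)
    (t₁ t₂ : ℝ≥0) : ℝ :=
  ∑ η : ℤˣ, 2 * ((η : ℤ) : ℝ) *
    ((∑ y ∈ Finset.Ico (x - 1 - K) x, gainTerm lam n u ρ x t₁ t₂ η y) -
      lossTerm lam n u ρ x t₁ t₂ η)

theorem localIncrement_add (hn : ∀ y, RegularPath (n y)) {a b c : ℝ≥0} (hab : a ≤ b) (hbc : b ≤ c) :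
    localIncrement lam n u ρ K x a b + localIncrement lam n u ρ K x b c =
      localIncrement lam n u ρ K x a c := by
  unfold localIncrement
  rw [← Finset.sum_add_distrib]
  refine Finset.sum_congr rfl fun η _ => ?_
  have h1 : ∀ y, gainTerm lam n u ρ x a b η y + gainTerm lam n u ρ x b c η y =
      gainTerm lam n u ρ x a c η y := fun y => thinnedIntegral_add (hn y) _ _ _ hab hbc
  have h2 : lossTerm lam n u ρ x a b η + lossTerm lam n u ρ x b c η =
      lossTerm lam n u ρ x a c η := thinnedIntegral_add (hn x) _ _ _ hab hbc
  rw [← h2, ← Finset.sum_congr rfl fun y _ => h1 y, Finset.sum_add_distrib]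
  ring

/-- The equation holds over a time interval with at most one arrival. -/
theorem LocalData.increment_of_atMostOne (hd : LocalData lam n u σ₀ ρ L R K x T)
    (hn : ∀ y, RegularPath (n y)) (hu : ∀ y k, u y k ≠ lam) {a b : ℝ≥0} (hab : a ≤ b) (hb : b ≤ T)
    (h : AtMostOneArrival n (Finset.Icc (-(L : ℤ)) R) a b) :
    ((ρ b x : ℤ) : ℝ) - ((ρ a x : ℤ) : ℝ) = localIncrement lam n u ρ K x a b := by
  classical
  have hl := hd.left
  have hr := hd.right
  have hmem : ∀ y, x - 1 - K ≤ y → y ≤ x → y ∈ Finset.Icc (-(L : ℤ)) R := fun y h1 h2 =>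
    Finset.mem_Icc.2 ⟨by omega, by omega⟩
  rw [hd.eq b hb x (by omega) le_rfl, hd.eq a (hab.trans hb) x (by omega) le_rfl]
  rcases h with h | ⟨y, hy, h⟩
  · rw [windowState_eq_of_no_arrival lam n u σ₀ L R fun y h1 h2 =>
      (h y (Finset.mem_Icc.2 ⟨h1, h2⟩)).symm, sub_self]
    unfold localIncrement gainTerm lossTerm
    refine (Finset.sum_eq_zero fun η _ => ?_).symm
    rw [thinnedIntegral_of_eq _ _ _ (h x (hmem x (by omega) le_rfl)),
      Finset.sum_eq_zero fun y hy => thinnedIntegral_of_eq _ _ _ (h y (hmem y ?_ ?_))]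
    · simp
    · exact (Finset.mem_Ico.1 hy).1
    · exact (Finset.mem_Ico.1 hy).2.le
  · have hyW := Finset.mem_Icc.1 hy
    have hyy := h y hy
    rw [if_pos rfl] at hyy
    have hoff : ∀ z ∈ Finset.Icc (-(L : ℤ)) R, z ≠ y → n z b = n z a := fun z hz hzy => by
      rw [h z hz, if_neg hzy, add_zero]
    set S := windowState lam n u σ₀ L R a with hS
    set v := u y (n y b) with hv
    have hstep : windowState lam n u σ₀ L R b = update lam S y v :=
      windowState_of_single_arrival lam hn u σ₀ L R hab hyW hyy fun z h1 h2 hzy =>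
        hoff z (Finset.mem_Icc.2 ⟨h1, h2⟩) hzy
    have hvlam : v ≠ lam := hu _ _
    -- the configuration just before the arrival
    obtain ⟨hj1, hj2⟩ := jumpTime_mem (hn y) (a := a) (b := b) (j := n y b)
      (Finset.mem_Ioc.2 ⟨by omega, le_rfl⟩)
    have hlim : ∀ z, x - 1 - K ≤ z → z ≤ x →
        Function.leftLim ρ (jumpTime (n y) (n y b)) z = S z := by
      intro z hz1 hz2
      refine hd.leftLim_eq hj1 (hj2.trans hb) (fun s hs1 hs2 w hw1 hw2 => ?_) hz1 hz2
      have hsb : s ≤ b := hs2.le.trans hj2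
      have e1 := (hn w).mono hs1
      have e2 := (hn w).mono hsb
      by_cases hwy : w = y
      · subst hwy
        have : n w s < n w b := by
          by_contra hcon
          exact absurd (jumpTime_le (n := n w) (not_lt.1 hcon)) (not_le.2 hs2)
        omega
      · have := hoff w (Finset.mem_Icc.2 ⟨hw1, hw2⟩) hwy
        omega
    rw [hstep]
    unfold localIncrement
    have hgain0 : ∀ η, ∀ z ∈ Finset.Ico (x - 1 - K) x, z ≠ y →
        gainTerm lam n u ρ x a b η z = 0 := by
      intro η z hz hzy
      rw [Finset.mem_Ico] at hz
      exact thinnedIntegral_of_eq _ _ _ (hoff z (hmem z hz.1 hz.2.le) hzy)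
    have hloss0 : x ≠ y → ∀ η, lossTerm lam n u ρ x a b η = 0 := fun hxy η =>
      thinnedIntegral_of_eq _ _ _ (hoff x (hmem x (by omega) le_rfl) hxy)
    rcases lt_trichotomy y x with hyx | hyx | hyx
    · rcases lt_or_ge y (x - 1 - K) with hfar | hnear
      · rw [update_apply_of_not_isConstOn lam v hfar.le (show x - 1 - K ≤ x - 1 by omega)
          (show x - 1 < x by omega) (hd.nonconst a (hab.trans hb)), sub_self]
        refine (Finset.sum_eq_zero fun η _ => ?_).symm
        rw [hloss0 hyx.ne', Finset.sum_eq_zero fun z hz => hgain0 η z hz ?_]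
        · simp
        · rw [Finset.mem_Ico] at hz; omega
      · rw [update_sub hvlam S hyx]
        refine Finset.sum_congr rfl fun η _ => ?_
        rw [hloss0 hyx.ne', sub_zero, Finset.sum_eq_single_of_mem y (Finset.mem_Ico.2 ⟨hnear, hyx⟩)
          fun z hz hzy => hgain0 η z hz hzy, gainTerm, thinnedIntegral_of_single _ _ _ hyy]
        rw [chi_congr (τ := Function.leftLim ρ _) (τ' := S) fun z h1 h2 => hlim z (by omega)
          (by omega), chi_congr (τ := Function.leftLim ρ _) (τ' := S) (a := x) fun z h1 h2 =>
          hlim z (by omega) h2]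
    · subst hyx
      rw [update_self_sub hvlam S y]
      refine Finset.sum_congr rfl fun η _ => ?_
      rw [Finset.sum_eq_zero fun z hz => hgain0 η z hz (Finset.mem_Ico.1 hz).2.ne, zero_sub,
        lossTerm, thinnedIntegral_of_single _ _ _ hyy]
      rw [chi_congr (τ := Function.leftLim ρ _) (τ' := S) fun z h1 h2 => hlim z (by omega)
          (by omega)]
    · rw [update_apply_of_lt lam S v hyx, sub_self]
      refine (Finset.sum_eq_zero fun η _ => ?_).symm
      rw [hloss0 hyx.ne, Finset.sum_eq_zero fun z hz => hgain0 η z hz ?_]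
      · simp
      · rw [Finset.mem_Ico] at hz; omega

/-- The equation holds up to any time, by summation over the time slots. -/
theorem LocalData.increment (hd : LocalData lam n u σ₀ ρ L R K x T)
    (hn : ∀ y, RegularPath (n y)) (hu : ∀ y k, u y k ≠ lam) {h : ℝ≥0} {I : ℕ}
    (hh : 0 < h) (hI : 0 < I) (hIT : I * h = T)
    (hone : ∀ i < I, AtMostOneArrival n (Finset.Icc (-(L : ℤ)) R) (i * h) ((i + 1 : ℕ) * h))
    {t : ℝ≥0} (ht : t ≤ T) :
    ((ρ t x : ℤ) : ℝ) - ((ρ 0 x : ℤ) : ℝ) = localIncrement lam n u ρ K x 0 t := by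
  have hmono : ∀ i j : ℕ, i ≤ j → (i : ℝ≥0) * h ≤ j * h := fun i j hij => by gcongr
  have grid : ∀ i ≤ I, ((ρ (i * h) x : ℤ) : ℝ) - ((ρ 0 x : ℤ) : ℝ) =
      localIncrement lam n u ρ K x 0 (i * h) := by
    intro i
    induction i with
    | zero =>
      intro _
      rw [Nat.cast_zero, zero_mul, sub_self]
      have := localIncrement_add (lam := lam) (u := u) (ρ := ρ) (K := K) (x := x) hn
        (le_refl (0 : ℝ≥0)) (le_refl (0 : ℝ≥0))
      linarith
    | succ i ih =>
      intro hi
      rw [← localIncrement_add hn zero_le (hmono i (i + 1) (by omega)), ← ih (by omega),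
        ← hd.increment_of_atMostOne hn hu (hmono i (i + 1) (by omega))
          (by rw [← hIT]; exact hmono _ _ hi) (hone i (by omega))]
      ring
  obtain ⟨i, hi, h1, h2⟩ := exists_slot hh hI (hIT.symm ▸ ht)
  rw [← localIncrement_add hn zero_le h1, ← grid i hi.le,
    ← hd.increment_of_atMostOne hn hu h1 ht ((hone i hi).mono hn le_rfl h1 h2)]
  ring

end

/-- The limit process solves the equation if the behaviour is typical at all large scales. -/
theorem satisfiesSDE_limitProcess (hn : ∀ y, RegularPath (n y)) (hu : ∀ y k, u y k ≠ lam)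
    (hA : 0 < A) (hG : ∀ M : ℕ, ∀ᶠ k in atTop, Good lam A k M n u σ) :
    SatisfiesSDE lam n u (fun t => limitProcess lam n u σ t) := by
  intro x t₁ t₂ ht
  set M : ℕ := ⌈t₂⌉₊ + x.natAbs + 1 with hM
  have hM0 : 0 < M := by omega
  have hTM : t₂ ≤ M := (Nat.le_ceil t₂).trans (by rw [hM]; gcongr; omega)
  have hxM : x ≤ M := by omega
  -- a scale at which everything is typical
  have hfar : ∀ᶠ k : ℕ in atTop, -(4 : ℤ) ^ k ≤ 2 * (x - 1 - (A * k : ℕ)) := by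
    filter_upwards [eventually_linear_le_two_pow (2 * A) (2 * (x - 1).natAbs)] with k hk
    have h2 : (2 * A * k + 2 * (x - 1).natAbs : ℕ) ≤ 4 ^ k :=
      hk.trans (Nat.pow_le_pow_left (by norm_num) k)
    have h3 : ((2 * A * k + 2 * (x - 1).natAbs : ℕ) : ℤ) ≤ (4 ^ k : ℕ) := by exact_mod_cast h2
    rw [Nat.cast_pow, Nat.cast_ofNat] at h3
    have : 2 * A * k = 2 * (A * k) := by ring
    rw [this] at h3
    omega
  obtain ⟨k, ⟨h1, h2⟩, h3⟩ := (((eventually_halfLine_eq_limit hn hA hM0 (hG M)).and (hG M)).and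
    hfar).exists
  set L : ℕ := 4 ^ k with hL
  have hL4 : L ≤ 4 ^ (k + 1) := Nat.pow_le_pow_right (by norm_num) (Nat.le_succ k)
  have hLZ : (L : ℤ) = 4 ^ k := by rw [hL]; push_cast; rfl
  have hpos : (0 : ℤ) < 4 ^ k := by positivity
  have hd : LocalData lam n u σ (fun t => limitProcess lam n u σ t) L M (A * k) x M := by
    refine ⟨by omega, hxM, fun t ht z hz1 hz2 => ?_, fun t ht => ?_, fun t =>
      (limitProcess_cadlag hn hA hG t).2⟩
    · rw [← halfLineProcess_eq_windowState lam n u σ L (hz2.trans hxM)]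
      exact (h1 L le_rfl t ht z (by omega) (hz2.trans hxM)).symm
    · have := h2.nonconst_of_le hn hA hM0 ht le_rfl hL4 (c := x - 1 - (A * k : ℕ)) (by omega)
        (by omega)
      rw [show x - 1 - ((A * k : ℕ) : ℤ) + ((A * k : ℕ) : ℤ) = x - 1 by ring] at this
      rwa [isConstOn_congr (τ' := halfLineProcess lam n u σ L t) (by omega)]
      intro z _ hz2
      rw [halfLineProcess_eq_windowState lam n u σ L (show z ≤ M by omega)]
  have hone : ∀ i < slotCount A k M, AtMostOneArrival n (Finset.Icc (-(L : ℤ)) M)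
      (i * fineStep A k) ((i + 1 : ℕ) * fineStep A k) := fun i hi =>
    (h2.one i hi).subset (window_subset hL4)
  have hinc : ∀ t ≤ (M : ℝ≥0), _ := fun t ht => hd.increment hn hu (fineStep_pos hA k)
    (slotCount_pos hA hM0) (slotCount_mul_fineStep hA k M) hone ht
  have hzero : ∀ η, ∀ y : Set.Iio x,
      y ∉ (Finset.Ico (x - 1 - (A * k : ℕ)) x).subtype (· ∈ Set.Iio x) →
      gainTerm lam n u (fun t => limitProcess lam n u σ t) x t₁ t₂ η y = 0 := by
    intro η y hy
    refine hd.gainTerm_eq_zero hn hTM η ?_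
    rw [Finset.mem_subtype, Finset.mem_Ico] at hy
    have := y.2
    rw [Set.mem_Iio] at this
    omega
  refine ⟨fun η => ?_, ?_⟩
  · refine summable_of_ne_finset_zero (s := (Finset.Ico (x - 1 - (A * k : ℕ)) x).subtype
      (· ∈ Set.Iio x)) fun y hy => ?_
    rw [hzero η y hy, abs_zero]
  · have e := localIncrement_add (lam := lam) (u := u) (ρ := fun t => limitProcess lam n u σ t)
      (K := A * k) (x := x) hn (zero_le (a := t₁)) ht.le
    rw [← hinc t₂ hTM, ← hinc t₁ (ht.le.trans hTM)] at e
    have e2 : localIncrement lam n u (fun t => limitProcess lam n u σ t) (A * k) x t₁ t₂ =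
        ∑ η : ℤˣ, 2 * ((η : ℤ) : ℝ) *
        ((∑' y : Set.Iio x, gainTerm lam n u (fun t => limitProcess lam n u σ t) x t₁ t₂ η y) -
          lossTerm lam n u (fun t => limitProcess lam n u σ t) x t₁ t₂ η) := by
      unfold localIncrement
      refine Finset.sum_congr rfl fun η _ => ?_
      rw [tsum_eq_sum (s := (Finset.Ico (x - 1 - (A * k : ℕ)) x).subtype (· ∈ Set.Iio x))
        (hzero η), Finset.sum_subtype_eq_sum_filter, Finset.filter_true_of_mem]
      intro y hy
      exact (Finset.mem_Ico.1 hy).2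
    rw [← e2]
    linarith

end

section

/-! ### Spatial shifts and the law of the limit process -/

/-- The configuration shifted by `j` sites. -/
def shiftConfig (j : ℕ) (σ : Config) : Config := fun z => σ (z + j)

theorem measurable_shiftConfig (j : ℕ) : Measurable (shiftConfig j) :=
  measurable_pi_lambda _ fun z => measurable_pi_apply (z + j)

theorem map_shiftConfig_productBernoulli (p : unitInterval) (j : ℕ) :
    (productBernoulli p).map (shiftConfig j) = productBernoulli p :=
  Measure.map_infinitePi_infinitePi_of_inj (P := fun _ : ℤ => bernoulliMeasure (1 : ℤˣ) (-1) p)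
    (add_left_injective (j : ℤ))

theorem iIndepFun_coordinates (p : unitInterval) :
    iIndepFun (fun (z : ℤ) (σ : Config) => σ z) (productBernoulli p) :=
  iIndepFun_infinitePi (P := fun _ : ℤ => bernoulliMeasure (1 : ℤˣ) (-1) p)
    (X := fun _ v => v) fun _ => measurable_id

/-- Functions of disjoint finite sets of spins are independent under Bernoulli measure. -/
theorem indepFun_of_dependsOn (p : unitInterval) {S T : Finset ℤ} (hST : Disjoint S T)
    {f g : Config → ℝ} (hf : DependsOn f S) (hg : DependsOn g T) :
    IndepFun f g (productBernoulli p) := by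
  classical
  have h := (iIndepFun_coordinates p).indepFun_finset S T hST fun z => measurable_pi_apply z
  have key : ∀ {S : Finset ℤ} {f : Config → ℝ}, DependsOn f S →
      ∃ φ : (S → ℤˣ) → ℝ, Measurable φ ∧ f = φ ∘ fun σ (z : S) => σ z := by
    intro S f hf
    refine ⟨fun ρ => f fun z => if hz : z ∈ S then ρ ⟨z, hz⟩ else 1, .of_discrete, ?_⟩
    funext σ
    refine hf fun z hz => ?_
    rw [Finset.mem_coe] at hz
    simp [hz]
  obtain ⟨φ, hφ, rfl⟩ := key hf
  obtain ⟨ψ, hψ, rfl⟩ := key hg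
  exact h.comp hφ hψ

/-- A shift-invariant law which is dominated by a multiple of Bernoulli measure on all finite
windows is Bernoulli measure, by the law of large numbers. -/
theorem eq_productBernoulli_of_dominated {p : unitInterval} {μ : Measure Config}
    [IsProbabilityMeasure μ] {c : ℝ≥0∞} (hc : c ≠ ∞)
    (hdom : ∀ (a : ℕ) (g : Config → ℝ≥0∞), Measurable g → DependsOn g (Set.Icc (-(a : ℤ)) a) →
      ∫⁻ σ, g σ ∂μ ≤ c * ∫⁻ σ, g σ ∂productBernoulli p)
    (hshift : ∀ j, μ.map (shiftConfig j) = μ) : μ = productBernoulli p := by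
  classical
  set π := productBernoulli p with hπ
  refine Measure.eq_infinitePi _ fun F t ht => ?_
  rw [← Measure.infinitePi_pi (fun _ : ℤ => bernoulliMeasure (1 : ℤˣ) (-1) p) (s := F)
    fun i _ => ht i]
  change μ (Set.pi F t) = π (Set.pi F t)
  set E : Set Config := Set.pi F t with hE
  have hEm : MeasurableSet E := .pi F.countable_toSet fun _ _ => ht _
  obtain ⟨a, ha⟩ : ∃ a : ℕ, ∀ z ∈ F, -(a : ℤ) ≤ z ∧ z ≤ a :=
    ⟨F.sup Int.natAbs, fun z hz => by
      have := Finset.le_sup (f := Int.natAbs) hz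
      omega⟩
  set w : ℕ := 2 * a + 1 with hw
  set f : Config → ℝ := E.indicator 1 with hf
  have hfm : Measurable f := measurable_one.indicator hEm
  have hf1 : ∀ σ, ‖f σ‖ ≤ 1 := fun σ => by
    rw [hf, Set.indicator_apply]; split_ifs <;> simp
  set Y : ℕ → Config → ℝ := fun i σ => f (shiftConfig (i * w) σ) with hY
  have hYm : ∀ i, Measurable (Y i) := fun i => hfm.comp (measurable_shiftConfig _)
  have hfdep : ∀ j : ℕ, DependsOn (fun σ => f (shiftConfig j σ))
      (Finset.Icc (-(a : ℤ) + j) (a + j) : Finset ℤ) := by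
    intro j σ σ' h
    have : ∀ z ∈ F, shiftConfig j σ z = shiftConfig j σ' z := fun z hz => by
      refine h (z + j) ?_
      have := ha z hz
      rw [Finset.coe_Icc, Set.mem_Icc]
      omega
    have hiff : shiftConfig j σ ∈ E ↔ shiftConfig j σ' ∈ E := by
      simp only [hE, Set.mem_pi, Finset.mem_coe]
      exact forall_congr' fun z => forall_congr' fun hz => by rw [this z hz]
    simp only [hf, Set.indicator_apply, hiff, Pi.one_apply]
  -- the shifted indicators are independent and identically distributed
  have hind : Pairwise (Function.onFun (IndepFun · · π) Y) := by
    intro i j hij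
    refine indepFun_of_dependsOn p ?_ (hfdep (i * w)) (hfdep (j * w))
    refine Finset.disjoint_left.2 fun z h1 h2 => ?_
    rw [Finset.mem_Icc] at h1 h2
    push_cast at h1 h2
    rcases lt_or_gt_of_ne hij with h | h
    · have : (i : ℤ) + 1 ≤ j := by exact_mod_cast h
      have : ((i : ℤ) + 1) * w ≤ j * w := by gcongr
      rw [add_mul, one_mul] at this
      omega
    · have : (j : ℤ) + 1 ≤ i := by exact_mod_cast h
      have : ((j : ℤ) + 1) * w ≤ i * w := by gcongr
      rw [add_mul, one_mul] at this
      omega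
  have hid : ∀ i, IdentDistrib (Y i) (Y 0) π π := by
    intro i
    have h0 : IdentDistrib (shiftConfig (i * w)) (shiftConfig (0 * w)) π π :=
      ⟨(measurable_shiftConfig _).aemeasurable, (measurable_shiftConfig _).aemeasurable, by
        rw [map_shiftConfig_productBernoulli, map_shiftConfig_productBernoulli]⟩
    exact h0.comp hfm
  have hYint : ∀ (ν : Measure Config) [IsProbabilityMeasure ν] i, Integrable (Y i) ν :=
    fun ν _ i => Integrable.of_bound (hYm i).aestronglyMeasurable 1 (ae_of_all _ fun σ => hf1 _)
  have hmean : ∀ (ν : Measure Config) [IsProbabilityMeasure ν],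
      (∀ j, ν.map (shiftConfig j) = ν) → ∀ i, ∫ σ, Y i σ ∂ν = ν.real E := by
    intro ν _ hν i
    simp only [hY]
    rw [← integral_map (measurable_shiftConfig (i * w)).aemeasurable
      (f := f) hfm.aestronglyMeasurable, hν, hf, integral_indicator_one hEm]
  have hπmean : ∫ σ, Y 0 σ ∂π = π.real E := hmean π (map_shiftConfig_productBernoulli p) 0
  have hlln := strong_law_ae_real Y (hYint π 0) hind hid
  rw [hπmean] at hlln
  set Z : ℕ → Config → ℝ := fun m σ => (∑ i ∈ Finset.range m, Y i σ) / m - π.real E with hZ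
  have hZm : ∀ m, Measurable (Z m) := fun m =>
    ((Finset.measurable_sum _ fun i _ => hYm i).div_const _).sub_const _
  -- the law of large numbers in mean, for Bernoulli measure
  have hlim : Tendsto (fun m => ∫⁻ σ, ‖Z m σ‖ₑ ∂π) atTop (𝓝 0) := by
    have h0 : ∫⁻ _ : Config, (0 : ℝ≥0∞) ∂π = 0 := lintegral_zero
    rw [← h0]
    refine tendsto_lintegral_of_dominated_convergence (fun _ => 2) (fun m => (hZm m).enorm)
      (fun m => ae_of_all _ fun σ => ?_) (by simp) ?_
    · have h1 : ‖Z m σ‖ ≤ 2 := by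
        have e1 : ‖(∑ i ∈ Finset.range m, Y i σ) / m‖ ≤ 1 := by
          rw [norm_div, Real.norm_natCast]
          refine div_le_one_of_le₀ ?_ (Nat.cast_nonneg m)
          refine (norm_sum_le _ _).trans ?_
          calc ∑ i ∈ Finset.range m, ‖Y i σ‖ ≤ ∑ i ∈ Finset.range m, (1 : ℝ) :=
                Finset.sum_le_sum fun i _ => hf1 _
            _ = m := by simp
        have e2 : ‖π.real E‖ ≤ 1 := by
          rw [Real.norm_of_nonneg measureReal_nonneg]
          exact measureReal_le_one
        calc ‖Z m σ‖ ≤ ‖(∑ i ∈ Finset.range m, Y i σ) / m‖ + ‖π.real E‖ := norm_sub_le _ _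
          _ ≤ 2 := by linarith
      change ‖Z m σ‖ₑ ≤ 2
      rw [← ofReal_norm]
      exact (ENNReal.ofReal_le_ofReal h1).trans (by simp)
    · filter_upwards [hlln] with σ hσ
      have : Tendsto (fun m => Z m σ) atTop (𝓝 0) := by
        have := hσ.sub_const (π.real E)
        rwa [sub_self] at this
      have := this.enorm
      simpa using this
  -- the averages depend on a finite window, so that the convergence carries over to `μ`
  have hμ0 : Tendsto (fun m => ∫⁻ σ, ‖Z m σ‖ₑ ∂μ) atTop (𝓝 0) := by
    have hup : Tendsto (fun m => c * ∫⁻ σ, ‖Z m σ‖ₑ ∂π) atTop (𝓝 0) := by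
      have := ENNReal.Tendsto.const_mul hlim (Or.inr hc)
      rwa [mul_zero] at this
    refine tendsto_of_tendsto_of_tendsto_of_le_of_le tendsto_const_nhds hup (fun _ => zero_le)
      fun m => ?_
    refine hdom (a + m * w) _ (hZm m).enorm ?_
    intro σ σ' h
    have : ∀ i ∈ Finset.range m, Y i σ = Y i σ' := by
      intro i hi
      refine hfdep (i * w) fun z hz => h z ?_
      rw [Finset.coe_Icc, Set.mem_Icc] at hz
      rw [Finset.mem_range] at hi
      have : i * w ≤ m * w := by gcongr
      rw [Set.mem_Icc]
      push_cast at *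
      have : (i : ℤ) * w ≤ m * w := by exact_mod_cast this
      have : (0 : ℤ) ≤ i * w := by positivity
      omega
    simp only [hZ, Finset.sum_congr rfl this]
  -- under `μ` the averages have mean `μ E`, by shift invariance
  have hconst : ∀ m : ℕ, 0 < m → ENNReal.ofReal ‖μ.real E - π.real E‖ ≤ ∫⁻ σ, ‖Z m σ‖ₑ ∂μ := by
    intro m hm
    have e : ∫ σ, Z m σ ∂μ = μ.real E - π.real E := by
      simp only [hZ]
      rw [integral_sub ((integrable_finsetSum _ fun i _ => hYint μ i).div_const _)
        (integrable_const _), integral_div, integral_finsetSum _ fun i _ => hYint μ i,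
        Finset.sum_congr rfl fun i _ => hmean μ hshift i]
      have : (m : ℝ) ≠ 0 := by positivity
      simp [this]
    rw [← e, ofReal_norm]
    exact enorm_integral_le_lintegral_enorm _
  have hzero : ENNReal.ofReal ‖μ.real E - π.real E‖ = 0 := by
    refine le_antisymm (ge_of_tendsto hμ0 ?_) zero_le
    filter_upwards [eventually_gt_atTop 0] with m hm
    exact hconst m hm
  have : μ.real E = π.real E := by
    rw [ENNReal.ofReal_eq_zero] at hzero
    exact sub_eq_zero.1 (norm_le_zero_iff.1 hzero)
  rw [measureReal_def, measureReal_def,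
    ENNReal.toReal_eq_toReal_iff' (measure_ne_top _ _) (measure_ne_top _ _)] at this
  exact this

variable {Ω : Type*} [MeasurableSpace Ω] {Q : Measure Ω} {X : Ω → Config}
    {N : ℤ → ℝ≥0 → Ω → ℕ} {U : ℤ → ℕ → Ω → ℝ}

/-- The noise shifted in space drives the shifted initial configuration. -/
theorem Driven.spaceShift (h : Driven Q X N U) (j : ℕ) :
    Driven Q (fun ω => shiftConfig j (X ω)) (fun y => N (y + j)) (fun y => U (y + j)) := by
  have hmn : Measurable fun n : ℤ → ℝ≥0 → ℕ => fun y => n (y + j) :=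
    measurable_pi_lambda _ fun y => measurable_pi_apply (y + j)
  have hmu : Measurable fun v : ℤ → ℕ → ℝ => fun y => v (y + j) :=
    measurable_pi_lambda _ fun y => measurable_pi_apply (y + j)
  refine ⟨⟨fun x => h.noise.poisson _, fun x k => h.noise.measurable_U _ _,
    fun x k => h.noise.uniform _ _, h.noise.indep_N.precomp (add_left_injective (j : ℤ)),
    h.noise.indep_U.precomp (g := fun i : ℤ × ℕ => (i.1 + (j : ℤ), i.2)) ?_,
    h.noise.indep_N_U.comp hmn hmu⟩,
    (measurable_shiftConfig j).comp h.measurable,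
    h.indep.comp (measurable_shiftConfig j) ((hmn.comp measurable_fst).prodMk
      (hmu.comp measurable_snd))⟩
  rintro ⟨x, k⟩ ⟨x', k'⟩ he
  simp only [Prod.mk.injEq, add_left_inj] at he ⊢
  exact he

theorem Driven.measurable_limit (h : Driven Q X N U) (lam : ℝ) (t : ℝ≥0) :
    Measurable fun ω => limitProcess lam (fun y t => N y t ω) (fun y k => U y k ω) (X ω) t :=
  measurable_limitProcess lam t (fun ω y => h.noise.regular ω y)
    (fun y r _ => (h.noise.poisson y).measurable r) (fun y k => h.noise.measurable_U y k)
    h.measurable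

theorem Driven.measurable_halfLine (h : Driven Q X N U) (lam : ℝ) (L : ℕ) (t : ℝ≥0) :
    Measurable fun ω => halfLineProcess lam (fun y t => N y t ω) (fun y k => U y k ω) (X ω) L t :=
  measurable_pi_lambda _ fun x => (measurable_pi_apply x).comp
    (measurable_windowState lam L x t (fun ω y => h.noise.regular ω y)
      (fun y r _ => (h.noise.poisson y).measurable r) (fun y k => h.noise.measurable_U y k)
      h.measurable)

/-- Started from Bernoulli measure, the limit process has the law `Ber_p` at all times. -/
theorem Driven.map_limit [IsProbabilityMeasure Q] (hd : Driven Q X N U) {lam : ℝ}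
    (h0 : 0 < lam) (h1 : lam < 1) {p : unitInterval} (hp0 : 0 < p) (hp1 : p < 1)
    (hX : Q.map X = productBernoulli p) (t : ℝ≥0) :
    Q.map (fun ω => limitProcess lam (fun y t => N y t ω) (fun y k => U y k ω) (X ω) t) =
      productBernoulli p := by
  obtain ⟨A, hA, hAp⟩ := exists_blockFactor hp0 hp1
  have hlm := hd.measurable_limit lam t
  have := Measure.isProbabilityMeasure_map (μ := Q) hlm.aemeasurable
  refine eq_productBernoulli_of_dominated
    (c := ENNReal.ofReal (Real.exp (densityRate lam p * t + 1))) ENNReal.ofReal_ne_top ?_ ?_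
  · intro a g hg hga
    rw [lintegral_map hg hlm]
    -- the density bound passes to the limit by Fatou, as `g` sees only finitely many spins
    have hle : ∀ᵐ ω ∂Q, g (limitProcess lam (fun y t => N y t ω) (fun y k => U y k ω) (X ω) t) ≤
        liminf (fun L : ℕ => g (halfLineProcess lam (fun y t => N y t ω) (fun y k => U y k ω)
          (X ω) L t)) atTop := by
      filter_upwards [ae_eventually_good hd h0 h1 hp0 hp1 hX hA hAp] with ω hω
      have hall : ∀ᶠ L : ℕ in atTop, ∀ x ∈ Finset.Icc (-(a : ℤ)) a,
          halfLineProcess lam (fun y t => N y t ω) (fun y k => U y k ω) (X ω) L t x =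
          limitProcess lam (fun y t => N y t ω) (fun y k => U y k ω) (X ω) t x := by
        refine (Finset.eventually_all _).2 fun x _ => ?_
        filter_upwards [eventually_forall_halfLine_eq_limit (fun y => hd.noise.regular ω y) hA hω t
          x] with L hL
        exact hL t le_rfl
      have hev : ∀ᶠ L : ℕ in atTop, g (halfLineProcess lam (fun y t => N y t ω)
          (fun y k => U y k ω) (X ω) L t) =
          g (limitProcess lam (fun y t => N y t ω) (fun y k => U y k ω) (X ω) t) := by
        filter_upwards [hall] with L hL
        exact hga fun x hx => hL x (Finset.mem_Icc.2 hx)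
      rw [liminf_congr hev, liminf_const]
    calc ∫⁻ ω, g (limitProcess lam (fun y t => N y t ω) (fun y k => U y k ω) (X ω) t) ∂Q
        ≤ ∫⁻ ω, liminf (fun L : ℕ => g (halfLineProcess lam (fun y t => N y t ω)
            (fun y k => U y k ω) (X ω) L t)) atTop ∂Q := lintegral_mono_ae hle
      _ ≤ liminf (fun L : ℕ => ∫⁻ ω, g (halfLineProcess lam (fun y t => N y t ω)
            (fun y k => U y k ω) (X ω) L t) ∂Q) atTop :=
          lintegral_liminf_le fun L => hg.comp (hd.measurable_halfLine lam L t)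
      _ ≤ liminf (fun _ : ℕ => ENNReal.ofReal (Real.exp (densityRate lam p * t + 1)) *
            ∫⁻ σ, g σ ∂productBernoulli p) atTop := by
          refine liminf_le_liminf ?_
          filter_upwards [eventually_ge_atTop a] with L hL
          have hsub : Set.Icc (-(a : ℤ)) a ⊆ Set.Icc (-(L : ℤ)) a :=
            Set.Icc_subset_Icc (by omega) le_rfl
          have := densityBound_windowState hd h0 h1 hp0 hp1 hX L a t g hg
            fun σ σ' h => hga fun x hx => h x (hsub hx)
          refine le_trans (lintegral_mono fun ω => le_of_eq ?_) this
          exact hga fun x hx => halfLineProcess_eq_windowState lam _ _ _ L hx.2 t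
      _ = _ := liminf_const _
  · intro j
    -- shift invariance, since the shifted input has the same law
    have hd' := hd.spaceShift j
    have hX' : Q.map (fun ω => shiftConfig j (X ω)) = Q.map X := by
      rw [hX, ← map_shiftConfig_productBernoulli p j, ← hX,
        Measure.map_map (measurable_shiftConfig j) hd.measurable]
      rfl
    have hlaw := hd'.map_input_eq hd hX'
    have e1 : (fun ω => limitProcess lam (fun y t => N y t ω) (fun y k => U y k ω) (X ω) t) =
        limitMap lam t ∘ input X N U := by
      funext ω
      exact (limitMap_eq lam t (fun y => hd.noise.regular ω y) _ _).symm
    have e2 : shiftConfig j ∘ (fun ω => limitProcess lam (fun y t => N y t ω)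
        (fun y k => U y k ω) (X ω) t) = limitMap lam t ∘
        input (fun ω => shiftConfig j (X ω)) (fun y => N (y + j)) (fun y => U (y + j)) := by
      funext ω
      refine Eq.trans ?_ (limitMap_eq lam t (fun y => hd'.noise.regular ω y) _ _).symm
      funext x
      exact (limitProcess_shift lam (fun y t => N y t ω) (fun y k => U y k ω) (X ω) j t x).symm
    rw [Measure.map_map (measurable_shiftConfig j) hlm, e2,
      ← Measure.map_map (measurable_limitMap lam t) hd'.measurable_input, hlaw,
      Measure.map_map (measurable_limitMap lam t) hd.measurable_input, e1]

end

section

/-! ### The flow property -/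

/-- Restarting the limit process at time `s` from `σ_s` with the noise after time `s` gives the same
process, provided that the behaviour is typical before and after the restart. -/
theorem limitProcess_add {lam : ℝ} {n : ℤ → ℝ≥0 → ℕ} {u u' : ℤ → ℕ → ℝ} {σ : Config} {A : ℕ}
    (hn : ∀ y, RegularPath (n y)) (hA : 0 < A) (s : ℝ≥0)
    (hu' : u' = fun y k => u y (shiftIndex (fun y => n y s) y k))
    (hG : ∀ M : ℕ, ∀ᶠ k in atTop, Good lam A k M n u σ)
    (hG' : ∀ M : ℕ, ∀ᶠ k in atTop, Good lam A k M (shiftPath n s) u' (limitProcess lam n u σ s))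
    (t : ℝ≥0) :
    limitProcess lam n u σ (s + t) =
      limitProcess lam (shiftPath n s) u' (limitProcess lam n u σ s) t := by
  funext x
  have hn' : ∀ y, RegularPath (shiftPath n s y) := RegularPath.shift hn s
  set M : ℕ := ⌈t⌉₊ + x.natAbs + 1 with hM
  set M' : ℕ := M + ⌈s⌉₊ with hM'
  have hM0 : 0 < M := by omega
  have hM0' : 0 < M' := by omega
  have hMM : (M : ℤ) ≤ M' := by exact_mod_cast Nat.le_add_right M _
  have htM : t ≤ M := (Nat.le_ceil t).trans (by rw [hM]; gcongr; omega)
  have hsM : s ≤ M' := (Nat.le_ceil s).trans (by rw [hM']; gcongr; omega)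
  have hsM' : ∀ r ≤ (M : ℝ≥0), s + r ≤ M' := by
    intro r hr
    rw [hM', Nat.cast_add, add_comm]
    exact add_le_add hr (Nat.le_ceil s)
  have hxM : x ≤ M := by omega
  obtain ⟨k, ⟨⟨⟨⟨h1, h2⟩, h3⟩, h4⟩, h5⟩, h6⟩ := ((((((hG' M).and (hG M')).and
    (eventually_largeScale A M)).and
    ((tendsto_add_atTop_nat 1).eventually (eventually_halfLine_eq_limit hn hA hM0' (hG M')))).and
    (eventually_halfLine_eq_limit hn' hA hM0 (hG' M))).and (eventually_neg_four_pow_le x)).exists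
  -- the process with the larger cutoff `4 ^ (k + 1)` agrees with its limit on the whole window
  -- `[-4 ^ k, M]` on which the restarted process with cutoff `4 ^ k` lives
  set L' : ℕ := 4 ^ (k + 1) with hL'
  have hkk : 4 ^ k ≤ 4 ^ (k + 1) := Nat.pow_le_pow_right (by norm_num) (Nat.le_succ k)
  have hpos : (0 : ℤ) < 4 ^ k := by positivity
  have hpow : (4 : ℤ) ^ (k + 1) = 4 * 4 ^ k := by rw [pow_succ]; ring
  have hflow : ∀ r, windowState lam n u σ L' M (s + r) =
      windowState lam (shiftPath n s) u' (windowState lam n u σ L' M s) L' M r := by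
    intro r
    rw [hu']
    exact windowState_add lam hn u σ L' M s r
  have hag := h1.agree (σ' := windowState lam n u σ L' M s) hn' hA hM0 h3 (L := 4 ^ k) (L' := L')
    le_rfl hkk hkk le_rfl (fun i hi c hc hcM => ?_) (fun z hz hzM => ?_) htM h6 hxM
  · rw [← hflow, ← halfLineProcess_eq_windowState lam n u σ L' hxM,
      h4 L' le_rfl (s + t) (hsM' t htM) x (by rw [hpow]; omega) (hxM.trans hMM)] at hag
    rw [← hag, ← halfLineProcess_eq_windowState lam _ _ _ _ hxM]
    exact h5 (4 ^ k) le_rfl t htM x h6 hxM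
  · rw [← hflow]
    have hi' : (i : ℝ≥0) * fineStep A k ≤ M := by
      rw [← slotCount_mul_fineStep hA k M]
      gcongr
    have := h2.nonconst_of_le hn hA hM0' (hsM' _ hi') hkk le_rfl hc (hcM.trans hMM)
    rwa [isConstOn_congr (τ' := halfLineProcess lam n u σ L' (s + i * fineStep A k)) (by omega)]
    intro z _ hz2
    rw [halfLineProcess_eq_windowState lam n u σ L' (hz2.trans hcM)]
  · rw [← halfLineProcess_eq_windowState lam n u σ L' hzM]
    exact (h4 L' le_rfl s hsM z (by rw [hpow]; omega) (hzM.trans hMM)).symm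

section

variable {Ω : Type*} [MeasurableSpace Ω] {Q : Measure Ω} {X : Ω → Config}
    {N : ℤ → ℝ≥0 → Ω → ℕ} {U : ℤ → ℕ → Ω → ℝ}

/-- The limit process on a general sample space. -/
def limitOf (lam : ℝ) (X : Ω → Config) (N : ℤ → ℝ≥0 → Ω → ℕ) (U : ℤ → ℕ → Ω → ℝ) (t : ℝ≥0) (ω : Ω) :
    Config :=
  limitProcess lam (fun y t => N y t ω) (fun y k => U y k ω) (X ω) t

theorem Driven.limitOf_eq (h : Driven Q X N U) (lam : ℝ) (t : ℝ≥0) (ω : Ω) :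
    limitOf lam X N U t ω = limitMap lam t (input X N U ω) :=
  (limitMap_eq lam t (fun y => h.noise.regular ω y) _ _).symm

/-- The state at time `s` is a function of the data revealed up to time `s`. -/
theorem Driven.limitOf_eq_past (h : Driven Q X N U) (lam : ℝ) (s : ℝ≥0) (ω : Ω) :
    limitOf lam X N U s ω = limitMap lam s (pastInput s (input X N U ω)) :=
  (limitMap_pastInput lam s (fun y => h.noise.regular ω y) _ _).symm

/-- The process after time `s` is driven by the noise after time `s`. -/
theorem Driven.restart [IsProbabilityMeasure Q] (h : Driven Q X N U) (lam : ℝ) (s : ℝ≥0) :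
    Driven Q (limitOf lam X N U s) (shiftN N s) (shiftU N U s) := by
  have := h.shift s (measurable_limitMap lam s)
  have e : (fun ω => limitMap lam s (pastInput s (input X N U ω))) = limitOf lam X N U s :=
    funext fun ω => (h.limitOf_eq_past lam s ω).symm
  rwa [e] at this

/-- Almost surely, the process restarted at time `s` with the noise after time `s` is the original
one. -/
theorem Driven.ae_limitOf_add [IsProbabilityMeasure Q] (hd : Driven Q X N U) {lam : ℝ}
    (h0 : 0 < lam) (h1 : lam < 1) {p : unitInterval} (hp0 : 0 < p) (hp1 : p < 1)
    (hX : Q.map X = productBernoulli p) (s : ℝ≥0) :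
    ∀ᵐ ω ∂Q, ∀ t, limitOf lam X N U (s + t) ω =
      limitOf lam (limitOf lam X N U s) (shiftN N s) (shiftU N U s) t ω := by
  obtain ⟨A, hA, hAp⟩ := exists_blockFactor hp0 hp1
  filter_upwards [ae_eventually_good hd h0 h1 hp0 hp1 hX hA hAp,
    ae_eventually_good (hd.restart lam s) h0 h1 hp0 hp1
      (hd.map_limit h0 h1 hp0 hp1 hX s) hA hAp] with ω e1 e2 t
  exact limitProcess_add (fun y => hd.noise.regular ω y) hA s rfl e1 e2 t

/-! ### The Markov property -/

/-- The transition kernels: run the dynamics for the time `t` with a fresh noise. -/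
def transitionKernel (lam : ℝ) (ν : Measure ((ℤ → ℝ≥0 → ℕ) × (ℤ → ℕ → ℝ))) (t : ℝ≥0) :
    Kernel Config Config :=
  (Kernel.prod Kernel.id (Kernel.const Config ν)).map (limitMap lam t)

/-- The law of the noise. -/
def noiseLaw (Q : Measure Ω) (N : ℤ → ℝ≥0 → Ω → ℕ) : Measure ((ℤ → ℝ≥0 → ℕ) × (ℤ → ℕ → ℝ)) :=
  (Q.map fun ω (x : ℤ) (t : ℝ≥0) => N x t ω).prod markLaw

theorem Driven.isProbabilityMeasure_noiseLaw [IsProbabilityMeasure Q] (h : Driven Q X N U) :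
    IsProbabilityMeasure (noiseLaw Q N) := by
  have := Measure.isProbabilityMeasure_map (μ := Q) h.noise.measurable_N.aemeasurable
  unfold noiseLaw
  infer_instance

theorem transitionKernel_apply (lam : ℝ) (ν : Measure ((ℤ → ℝ≥0 → ℕ) × (ℤ → ℕ → ℝ)))
    [IsProbabilityMeasure ν] (t : ℝ≥0) (σ : Config) {B : Set Config} (hB : MeasurableSet B) :
    transitionKernel lam ν t σ B = ν {ξ | limitMap lam t (σ, ξ) ∈ B} := by
  have hm := measurable_limitMap lam t
  rw [transitionKernel, Kernel.map_apply' _ hm _ hB, Kernel.prod_apply, Kernel.id_apply,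
    Kernel.const_apply, Measure.prod_apply (hm hB), lintegral_dirac' _
      (measurable_measure_prodMk_left (hm hB))]
  rfl

instance (lam : ℝ) (ν : Measure ((ℤ → ℝ≥0 → ℕ) × (ℤ → ℕ → ℝ))) [IsProbabilityMeasure ν] (t : ℝ≥0) :
    IsMarkovKernel (transitionKernel lam ν t) := by
  unfold transitionKernel
  exact Kernel.IsMarkovKernel.map _ (measurable_limitMap lam t)

/-- The transition kernels leave Bernoulli measure invariant. -/
theorem Driven.invariant_transitionKernel [IsProbabilityMeasure Q] (hd : Driven Q X N U) {lam : ℝ}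
    (h0 : 0 < lam) (h1 : lam < 1) {p : unitInterval} (hp0 : 0 < p) (hp1 : p < 1)
    (hX : Q.map X = productBernoulli p) (t : ℝ≥0) :
    Kernel.Invariant (transitionKernel lam (noiseLaw Q N) t) (productBernoulli p) := by
  have := hd.isProbabilityMeasure_noiseLaw
  have hm := measurable_limitMap lam t
  unfold Kernel.Invariant
  ext B hB
  rw [Measure.bind_apply hB (Kernel.aemeasurable _)]
  simp only [transitionKernel_apply lam _ t _ hB]
  have e := hd.map_limit h0 h1 hp0 hp1 hX t
  change Q.map (limitOf lam X N U t) = _ at e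
  rw [show limitOf lam X N U t = limitMap lam t ∘ input X N U from
    funext fun ω => hd.limitOf_eq lam t ω, ← Measure.map_map hm hd.measurable_input,
    hd.map_input, hX] at e
  conv_rhs => rw [← e]
  rw [Measure.map_apply hm hB, Measure.prod_apply (hm hB)]
  rfl

/-- The joint law of the past up to time `s` and of the noise after time `s`. -/
theorem Driven.map_past_future [IsProbabilityMeasure Q] (h : Driven Q X N U) (s : ℝ≥0) :
    Q.map (fun ω => (pastInput s (input X N U ω), futureNoise s (input X N U ω).2)) =
      (Q.map fun ω => pastInput s (input X N U ω)).prod (noiseLaw Q N) := by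
  have hpm : Measurable fun ω => pastInput s (input X N U ω) :=
    (measurable_pastInput s).comp h.measurable_input
  have hfm : Measurable fun ω => futureNoise s (input X N U ω).2 :=
    (measurable_futureNoise s).comp h.measurable_input.snd
  rw [(indepFun_iff_map_prod_eq_prod_map_map hpm.aemeasurable hfm.aemeasurable).1
    (h.indepFun_past_future s), h.map_futureNoise s, noiseLaw]

/-- The law of the process after time `s` does not depend on `s`. -/
theorem Driven.map_limitOf_add [IsProbabilityMeasure Q] (hd : Driven Q X N U) {lam : ℝ}
    (h0 : 0 < lam) (h1 : lam < 1) {p : unitInterval} (hp0 : 0 < p) (hp1 : p < 1)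
    (hX : Q.map X = productBernoulli p) (s : ℝ≥0) :
    Q.map (fun ω t => limitOf lam X N U (s + t) ω) = Q.map (fun ω t => limitOf lam X N U t ω) := by
  have hd' := hd.restart lam s
  have hm : Measurable fun (z : InputSpace) (t : ℝ≥0) => limitMap lam t z :=
    measurable_pi_lambda _ fun t => measurable_limitMap lam t
  have hlaw := hd'.map_input_eq hd ((hd.map_limit h0 h1 hp0 hp1 hX s).trans hX.symm)
  have e1 : (fun ω t => limitOf lam X N U (s + t) ω) =ᵐ[Q] (fun z t => limitMap lam t z) ∘
      input (limitOf lam X N U s) (shiftN N s) (shiftU N U s) := by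
    filter_upwards [hd.ae_limitOf_add h0 h1 hp0 hp1 hX s] with ω hω
    funext t
    rw [hω t, hd'.limitOf_eq lam t ω]
    rfl
  have e2 : (fun ω t => limitOf lam X N U t ω) = (fun z t => limitMap lam t z) ∘ input X N U := by
    funext ω t
    exact hd.limitOf_eq lam t ω
  rw [Measure.map_congr e1, e2, ← Measure.map_map hm hd'.measurable_input, hlaw,
    Measure.map_map hm hd.measurable_input]

end

/-- The Markov property, for a `σ`-algebra `m` of events before time `s`. -/
theorem Driven.condExp_limitOf {Ω : Type*} {m mΩ : MeasurableSpace Ω} {Q : Measure Ω}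
    [IsProbabilityMeasure Q] {X : Ω → Config} {N : ℤ → ℝ≥0 → Ω → ℕ} {U : ℤ → ℕ → Ω → ℝ}
    (hd : Driven Q X N U) {lam : ℝ}
    (h0 : 0 < lam) (h1 : lam < 1) {p : unitInterval} (hp0 : 0 < p) (hp1 : p < 1)
    (hX : Q.map X = productBernoulli p) (s t : ℝ≥0) (hm : m ≤ mΩ)
    (hpast : m ≤ MeasurableSpace.comap (fun ω => pastInput s (input X N U ω)) inferInstance)
    {Y : Ω → Config} (hY : Measurable[m] Y) (hXY : limitOf lam X N U s =ᵐ[Q] Y)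
    {B : Set Config} (hB : MeasurableSet B) :
    Q⟦limitOf lam X N U (s + t) ⁻¹' B | m⟧ =ᵐ[Q]
      fun ω => (transitionKernel lam (noiseLaw Q N) t (limitOf lam X N U s ω)).real B := by
  have := hd.isProbabilityMeasure_noiseLaw
  set κ := transitionKernel lam (noiseLaw Q N) t with hκ
  have hκm : Measurable fun σ => (κ σ).real B := (Kernel.measurable_coe κ hB).ennreal_toReal
  have hst : Measurable (limitOf lam X N U (s + t)) := hd.measurable_limit lam (s + t)
  have hs : Measurable (limitOf lam X N U s) := hd.measurable_limit lam s
  have hf : Integrable ((limitOf lam X N U (s + t) ⁻¹' B).indicator fun _ => (1 : ℝ)) Q :=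
    (integrable_const 1).indicator (hst hB)
  have hgint : Integrable (fun ω => (κ (limitOf lam X N U s ω)).real B) Q := by
    refine Integrable.of_bound (hκm.comp hs).aestronglyMeasurable 1 (ae_of_all _ fun ω => ?_)
    rw [Real.norm_of_nonneg measureReal_nonneg]
    exact measureReal_le_one
  refine (ae_eq_condExp_of_forall_setIntegral_eq hm hf (fun _ _ _ => hgint.integrableOn) ?_ ?_).symm
  · intro C hC _
    obtain ⟨C', hC', rfl⟩ := hpast C hC
    set pst : Ω → InputSpace := fun ω => pastInput s (input X N U ω) with hpst
    set fut : Ω → (ℤ → ℝ≥0 → ℕ) × (ℤ → ℕ → ℝ) := fun ω => futureNoise s (input X N U ω).2 with hfut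
    have hpm : Measurable pst := (measurable_pastInput s).comp hd.measurable_input
    have hfm : Measurable fut := (measurable_futureNoise s).comp hd.measurable_input.snd
    have hCm : MeasurableSet (pst ⁻¹' C') := hpm hC'
    rw [setIntegral_indicator (hst hB), setIntegral_const, smul_eq_mul, mul_one]
    -- the event, in terms of the past and the future
    set E : Set (InputSpace × ((ℤ → ℝ≥0 → ℕ) × (ℤ → ℕ → ℝ))) :=
      {z | z.1 ∈ C' ∧ limitMap lam t (limitMap lam s z.1, z.2) ∈ B} with hE
    have hmm : Measurable fun z : InputSpace × ((ℤ → ℝ≥0 → ℕ) × (ℤ → ℕ → ℝ)) =>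
        limitMap lam t (limitMap lam s z.1, z.2) :=
      (measurable_limitMap lam t).comp
        (((measurable_limitMap lam s).comp measurable_fst).prodMk measurable_snd)
    have hEm : MeasurableSet E := (measurable_fst hC').inter (hmm hB)
    have hev : Q (pst ⁻¹' C' ∩ limitOf lam X N U (s + t) ⁻¹' B) =
        Q ((fun ω => (pst ω, fut ω)) ⁻¹' E) := by
      refine measure_congr ?_
      filter_upwards [hd.ae_limitOf_add h0 h1 hp0 hp1 hX s] with ω hω
      refine propext (and_congr Iff.rfl ?_)
      change limitOf lam X N U (s + t) ω ∈ B ↔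
        limitMap lam t (limitMap lam s (pst ω), fut ω) ∈ B
      rw [hω t, (hd.restart lam s).limitOf_eq lam t ω]
      rw [show input (limitOf lam X N U s) (shiftN N s) (shiftU N U s) ω =
        (limitMap lam s (pst ω), fut ω) from Prod.ext (hd.limitOf_eq_past lam s ω) rfl]
    have hprob : Q ((fun ω => (pst ω, fut ω)) ⁻¹' E) =
        ∫⁻ ω in pst ⁻¹' C', κ (limitOf lam X N U s ω) B ∂Q := by
      rw [← Measure.map_apply (hpm.prodMk hfm) hEm, hd.map_past_future s, Measure.prod_apply hEm,
        lintegral_map (measurable_measure_prodMk_left hEm) hpm, ← lintegral_indicator hCm]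
      refine lintegral_congr fun ω => ?_
      by_cases hω : pst ω ∈ C'
      · rw [Set.indicator_of_mem (show ω ∈ pst ⁻¹' C' from hω), hκ,
          transitionKernel_apply lam _ t _ hB]
        congr 1
        ext ξ
        simp only [hE, Set.mem_preimage, Set.mem_ofPred_eq]
        rw [hd.limitOf_eq_past lam s ω]
        exact and_iff_right hω
      · rw [Set.indicator_of_notMem (show ω ∉ pst ⁻¹' C' from hω)]
        have : Prod.mk (pst ω) ⁻¹' E = ∅ := by
          ext ξ
          simp only [hE, Set.mem_preimage, Set.mem_ofPred_eq, Set.mem_empty_iff_false, iff_false]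
          exact fun h => hω h.1
        rw [this, measure_empty]
    rw [measureReal_def, hev, hprob]
    simp only [measureReal_def]
    rw [integral_toReal]
    · exact ((Kernel.measurable_coe κ hB).comp hs).aemeasurable
    · exact ae_of_all _ fun ω => measure_lt_top _ _
  · refine ⟨fun ω => (κ (Y ω)).real B, (hκm.comp hY).stronglyMeasurable, ?_⟩
    filter_upwards [hXY] with ω hω
    rw [hω]

end

section

/-! ### The product sample space -/

theorem _root_.ProbabilityTheory.iIndepFun.comp_measurePreserving {Ω Ω' ι : Type*} {β : ι → Type*}
    [MeasurableSpace Ω] [MeasurableSpace Ω'] {m : ∀ i, MeasurableSpace (β i)} {μ : Measure Ω}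
    {μ' : Measure Ω'} {f : ∀ i, Ω → β i} {g : Ω' → Ω} (h : iIndepFun f μ)
    (hf : ∀ i, Measurable (f i)) (hg : MeasurePreserving g μ' μ) :
    iIndepFun (fun i ω => f i (g ω)) μ' := by
  rw [iIndepFun_iff_measure_inter_preimage_eq_mul] at h ⊢
  intro S sets hS
  have := h S hS
  rw [← hg.measure_preimage
    (S.measurableSet_biInter fun i hi => hf i (hS i hi)).nullMeasurableSet] at this
  rw [show (⋂ i ∈ S, (fun ω => f i (g ω)) ⁻¹' sets i) = g ⁻¹' ⋂ i ∈ S, f i ⁻¹' sets i by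
    simp only [Set.preimage_iInter]; rfl, this]
  exact Finset.prod_congr rfl fun i hi =>
    (hg.measure_preimage (hf i (hS i hi)).nullMeasurableSet).symm

variable {𝒪 : Type*} [MeasurableSpace 𝒪] {P : Measure 𝒪} {N : ℤ → ℝ≥0 → 𝒪 → ℕ}
    {U : ℤ → ℕ → 𝒪 → ℝ}

/-- A driving noise on `𝒪` is a driving noise on every extension of the sample space. -/
theorem IsDrivingNoise.comp_measurePreserving {Ω : Type*} [MeasurableSpace Ω] {Q : Measure Ω}
    (h : IsDrivingNoise P N U) {g : Ω → 𝒪} (hg : MeasurePreserving g Q P) :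
    IsDrivingNoise Q (fun x t ω => N x t (g ω)) (fun x k ω => U x k (g ω)) where
  poisson x :=
    { measurable := fun t => ((h.poisson x).measurable t).comp hg.measurable
      zero := fun ω => (h.poisson x).zero _
      mono := fun ω => (h.poisson x).mono _
      rightCont := fun ω => (h.poisson x).rightCont _
      indepIncrements := fun n t ht => iIndepFun.comp_measurePreserving
        ((h.poisson x).indepIncrements n t ht)
        (fun _ => ((h.poisson x).measurable _).sub ((h.poisson x).measurable _)) hg
      law := fun s t hst => by
        have hm : Measurable fun ω => N x t ω - N x s ω :=
          ((h.poisson x).measurable t).sub ((h.poisson x).measurable s)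
        rw [← (h.poisson x).law s t hst, ← hg.map_eq, Measure.map_map hm hg.measurable]
        rfl }
  measurable_U x k := (h.measurable_U x k).comp hg.measurable
  uniform x k := by
    rw [← h.uniform x k, ← hg.map_eq, Measure.map_map (h.measurable_U x k) hg.measurable]
    rfl
  indep_N := h.indep_N.comp_measurePreserving (fun x => (h.poisson x).measurable_path) hg
  indep_U := h.indep_U.comp_measurePreserving (fun i => h.measurable_U i.1 i.2) hg
  indep_N_U := by
    have hi := h.indep_N_U
    rw [indepFun_iff_measure_inter_preimage_eq_mul] at hi ⊢
    intro A B hA hB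
    have hA' := h.measurable_N hA
    have hB' := h.measurable_U' hB
    have := hi A B hA hB
    rwa [← hg.measure_preimage hA'.nullMeasurableSet, ← hg.measure_preimage hB'.nullMeasurableSet,
      ← hg.measure_preimage (hA'.inter hB').nullMeasurableSet] at this

/-- On the product space, the first coordinate is an initial configuration that is independent of
the noise in the second coordinate. -/
theorem IsDrivingNoise.driven_prod [IsProbabilityMeasure P] (h : IsDrivingNoise P N U)
    (π : Measure Config) [IsProbabilityMeasure π] :
    Driven (π.prod P) Prod.fst (fun x t (w : Config × 𝒪) => N x t w.2)
      (fun x k (w : Config × 𝒪) => U x k w.2) where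
  noise := h.comp_measurePreserving measurePreserving_snd
  measurable := measurable_fst
  indep := indepFun_prod measurable_id (h.measurable_N.prodMk h.measurable_U')

theorem IsDrivingNoise.ae_mark_ne (h : IsDrivingNoise P N U) (a : ℝ) :
    ∀ᵐ ω ∂P, ∀ x k, U x k ω ≠ a := by
  refine ae_all_iff.2 fun x => ae_all_iff.2 fun k => ?_
  have : (P.map (U x k)) {a} = 0 := by rw [h.uniform x k]; exact measure_singleton a
  rw [Measure.map_apply (h.measurable_U x k) (measurableSet_singleton a)] at this
  exact measure_eq_zero_iff_ae_notMem.1 this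

/-! ### Adaptedness -/

/-- At a fixed time there is almost surely no arrival. -/
theorem IsRateOnePoisson.ae_exists_lt_eq {n : ℝ≥0 → 𝒪 → ℕ} [IsProbabilityMeasure P]
    (h : IsRateOnePoisson P n) {s : ℝ≥0} (hs : 0 < s) : ∀ᵐ ω ∂P, ∃ r < s, n r ω = n s ω := by
  have key : ∀ r < s, P {ω | ¬ ∃ r < s, n r ω = n s ω} ≤ ENNReal.ofReal (s - r) := by
    intro r hr
    have hm : Measurable fun ω => n s ω - n r ω := (h.measurable s).sub (h.measurable r)
    have hsub : {ω | ¬ ∃ r < s, n r ω = n s ω} ⊆ (fun ω => n s ω - n r ω) ⁻¹' {0}ᶜ := by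
      intro ω hω h0
      refine hω ⟨r, hr, ?_⟩
      have h1 := h.mono ω hr.le
      simp only [Set.mem_singleton_iff] at h0
      dsimp only at h1
      omega
    refine (measure_mono hsub).trans ?_
    rw [← Measure.map_apply hm (measurableSet_singleton 0).compl, h.law r s hr.le,
      prob_compl_eq_one_sub (measurableSet_singleton 0), poissonMeasure_singleton]
    rw [pow_zero, Nat.factorial_zero, Nat.cast_one, div_one, mul_one, NNReal.coe_sub hr.le,
      ← ENNReal.ofReal_one, ← ENNReal.ofReal_sub _ (Real.exp_pos _).le]
    refine ENNReal.ofReal_le_ofReal ?_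
    have := Real.add_one_le_exp (-((s : ℝ) - r))
    linarith
  rw [ae_iff]
  refine le_antisymm (ENNReal.le_of_forall_pos_le_add fun ε hε _ => ?_) zero_le
  rw [zero_add]
  have hlt : s - min ε s < s := tsub_lt_self hs (lt_min hε hs)
  refine (key _ hlt).trans ?_
  rw [← ENNReal.ofReal_coe_nnreal]
  refine ENNReal.ofReal_le_ofReal ?_
  rw [NNReal.coe_sub (min_le_right _ _), sub_sub_cancel]
  exact_mod_cast min_le_left ε s

/-- Almost surely, the marks revealed before time `s` are those of the arrivals up to time `s`. -/
theorem IsDrivingNoise.ae_revealedMark_eq [IsProbabilityMeasure P] (h : IsDrivingNoise P N U)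
    (s : ℝ≥0) : ∀ᵐ ω ∂P, (fun x k => revealedMark N U x k s ω) =
      firstMarks (fun y => N y s ω) fun x k => U x k ω := by
  have hlt : ∀ᵐ ω ∂P, ∀ x, 0 < s → ∃ r < s, N x r ω = N x s ω :=
    ae_all_iff.2 fun x => by
      by_cases hs : 0 < s
      · filter_upwards [(h.poisson x).ae_exists_lt_eq hs] with ω hω _ using hω
      · exact ae_of_all _ fun ω h => absurd h hs
  filter_upwards [hlt] with ω hω
  funext x k
  classical
  have hiff : (1 ≤ k ∧ ArrivedBefore (fun r => N x r ω) k s) ↔ 1 ≤ k ∧ k ≤ N x s ω := by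
    refine and_congr_right fun hk => ⟨?_, fun hkn => ?_⟩
    · rintro ⟨r, hr, hkr⟩
      exact hkr.trans ((h.poisson x).mono ω hr.le)
    · rcases eq_zero_or_pos s with rfl | hs
      · rw [(h.poisson x).zero] at hkn
        omega
      · obtain ⟨r, hr, he⟩ := hω x hs
        exact ⟨r, hr, hkn.trans_eq he.symm⟩
  unfold revealedMark firstMarks
  exact if_congr hiff rfl rfl

/-- The limiting process at time `s` agrees almost surely with a variable that is measurable with
respect to the `σ`-algebra of the events before time `s`. -/
theorem IsDrivingNoise.exists_adapted [IsProbabilityMeasure P] (h : IsDrivingNoise P N U)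
    (π : Measure Config) [IsProbabilityMeasure π] (lam : ℝ) (s : ℝ≥0) :
    ∃ Y : Config × 𝒪 → Config, Measurable[noiseSigma N U s] Y ∧
      fullLine lam N U s =ᵐ[π.prod P] Y := by
  refine ⟨fun w => limitMap lam s (w.1, stopPath (fun y t => N y t w.2) s,
    fun x k => revealedMark N U x k s w.2), ?_, ?_⟩
  · have h1 : Measurable[noiseSigma N U s] (Prod.fst : Config × 𝒪 → Config) :=
      measurable_iff_comap_le.2 (le_sup_left.trans' le_sup_left)
    have h2 : Measurable[noiseSigma N U s]
        fun w : Config × 𝒪 => stopPath (fun y t => N y t w.2) s :=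
      @measurable_pi_lambda _ _ _ (noiseSigma N U s) _ _ fun y =>
        @measurable_pi_lambda _ _ _ (noiseSigma N U s) _ _ fun t =>
          noiseSigma_N_measurable N U y (min_le_right t s)
    have h3 : Measurable[noiseSigma N U s]
        fun w : Config × 𝒪 => fun (x : ℤ) (k : ℕ) => revealedMark N U x k s w.2 := by
      refine @measurable_pi_lambda _ _ _ (noiseSigma N U s) _ _ fun x =>
        @measurable_pi_lambda _ _ _ (noiseSigma N U s) _ _ fun k => ?_
      rw [measurable_iff_comap_le]
      refine le_trans ?_ le_sup_right
      exact le_iSup_of_le x (le_iSup_of_le k le_rfl)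
    exact (measurable_limitMap lam s).comp
      (h1.prodMk (h2.prodMk h3))
  · have hae : ∀ᵐ w ∂(π.prod P), (fun x k => revealedMark N U x k s w.2) =
        firstMarks (fun y => N y s w.2) fun x k => U x k w.2 :=
      (measurePreserving_snd (μ := π) (ν := P)).quasiMeasurePreserving.ae (h.ae_revealedMark_eq s)
    filter_upwards [hae] with w hw
    rw [hw]
    exact (limitMap_pastInput lam s (fun y => h.regular w.2 y) _ _).symm

/-- The `σ`-algebra of the events before time `s` is generated by the data revealed up to time
`s`. -/
theorem IsDrivingNoise.noiseSigma_le_comap (h : IsDrivingNoise P N U) (s : ℝ≥0) :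
    noiseSigma N U s ≤ MeasurableSpace.comap
      (fun w : Config × 𝒪 => pastInput s (input Prod.fst (fun x t (w : Config × 𝒪) => N x t w.2)
        (fun x k (w : Config × 𝒪) => U x k w.2) w)) inferInstance := by
  set f := fun w : Config × 𝒪 => pastInput s (input Prod.fst (fun x t (w : Config × 𝒪) => N x t w.2)
        (fun x k (w : Config × 𝒪) => U x k w.2) w) with hf
  set m := MeasurableSpace.comap f inferInstance with hm
  have hfm : Measurable[m] f := comap_measurable f
  have hN : ∀ x, ∀ r ≤ s, Measurable[m] fun w : Config × 𝒪 => N x r w.2 := by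
    intro x r hr
    have h1 : Measurable fun z : InputSpace => z.2.1 x r := by fun_prop
    have h2 := h1.comp hfm
    have e : (fun z : InputSpace => z.2.1 x r) ∘ f = fun w : Config × 𝒪 => N x r w.2 := by
      funext w
      simp only [hf, Function.comp, pastInput, input, stopPath, min_eq_left hr]
    rwa [e] at h2
  refine sup_le (sup_le ?_ ?_) ?_
  · exact (measurable_fst.comp hfm).comap_le
  · exact iSup_le fun x => iSup_le fun r => iSup_le fun hr => (hN x r hr).comap_le
  · refine iSup_le fun x => iSup_le fun k => Measurable.comap_le ?_
    have hA : MeasurableSet[m] {w : Config × 𝒪 | ArrivedBefore (fun r => N x r w.2) k s} :=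
      measurableSet_arrivedBefore (N := fun r (w : Config × 𝒪) => N x r w.2)
        (fun w => (h.poisson x).mono w.2) k s fun r hr => hN x r hr.le
    have h1 : Measurable fun z : InputSpace => z.2.2 x k := by fun_prop
    have hR := (h1.comp hfm).indicator hA
    have e : (fun w : Config × 𝒪 => revealedMark N U x k s w.2) =
        Set.indicator {w : Config × 𝒪 | ArrivedBefore (fun r => N x r w.2) k s}
          ((fun z : InputSpace => z.2.2 x k) ∘ f) := by
      funext w
      by_cases hw : ArrivedBefore (fun r => N x r w.2) k s
      · rw [Set.indicator_of_mem (show w ∈ {w : Config × 𝒪 | ArrivedBefore (fun r => N x r w.2) k s}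
          from hw)]
        have hk : k ≤ N x s w.2 := by
          obtain ⟨r, hr, hkr⟩ := hw
          exact hkr.trans ((h.poisson x).mono w.2 hr.le)
        simp only [revealedMark, hf, Function.comp, pastInput, input, firstMarks, hw, hk]
      · rw [Set.indicator_of_notMem
          (show w ∉ {w : Config × 𝒪 | ArrivedBefore (fun r => N x r w.2) k s} from hw)]
        simp only [revealedMark, hw, and_false, if_false]
    rw [e]
    exact hR

end

end ToomInterface

end

theorem mainTheorem6 {𝒪 : Type*} [MeasurableSpace 𝒪] (P : Measure 𝒪) [IsProbabilityMeasure P]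
    (N : ℤ → ℝ≥0 → 𝒪 → ℕ) (U : ℤ → ℕ → 𝒪 → ℝ) (hNU : IsDrivingNoise P N U)
    (lam : ℝ) (hlam0 : 0 < lam) (hlam1 : lam < 1)
    (p : unitInterval) (hp0 : 0 < p) (hp1 : p < 1) :
    (∀ᵐ w ∂((productBernoulli p).prod P), ∀ (T : ℝ≥0) (x : ℤ), ∀ᶠ L : ℕ in atTop, ∀ t ≤ T,
      halfLine lam N U L t w x = fullLine lam N U t w x) ∧
    (∀ᵐ w ∂((productBernoulli p).prod P), ∀ t : ℝ≥0,
      ContinuousWithinAt (fun s => fullLine lam N U s w) (Set.Ici t) t ∧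
      ∃ l : Config, Tendsto (fun s => fullLine lam N U s w) (𝓝[<] t) (𝓝 l)) ∧
    IsStationaryMarkov ((productBernoulli p).prod P) (noiseFiltration hNU)
      (fullLine lam N U) (productBernoulli p) ∧
    (∀ᵐ w ∂((productBernoulli p).prod P),
      SatisfiesSDE lam (fun x s => N x s w.2) (fun x k => U x k w.2)
        (fun t => fullLine lam N U t w)) := by
  have : IsProbabilityMeasure (productBernoulli p) := by
    unfold productBernoulli
    infer_instance
  have hd := hNU.driven_prod (productBernoulli p)
  have hX : ((productBernoulli p).prod P).map Prod.fst = productBernoulli p := by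
    rw [Measure.map_fst_prod, measure_univ, one_smul]
  obtain ⟨A, hA, hAp⟩ := exists_blockFactor hp0 hp1
  have hG := ae_eventually_good hd hlam0 hlam1 hp0 hp1 hX hA hAp
  have hreg : ∀ (w : Config × 𝒪) y, RegularPath fun t => N y t w.2 := fun w y => hNU.regular w.2 y
  refine ⟨?_, ?_, ⟨hd.measurable_limit lam, hNU.exists_adapted (productBernoulli p) lam,
    hd.map_limitOf_add hlam0 hlam1 hp0 hp1 hX, hd.map_limit hlam0 hlam1 hp0 hp1 hX,
    transitionKernel lam (noiseLaw ((productBernoulli p).prod P) fun x t w => N x t w.2),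
    fun t => ?_⟩, ?_⟩
  · filter_upwards [hG] with w hw T x
    exact eventually_forall_halfLine_eq_limit (hreg w) hA hw T x
  · filter_upwards [hG] with w hw t
    exact limitProcess_cadlag (hreg w) hA hw t
  · have := hd.isProbabilityMeasure_noiseLaw
    refine ⟨inferInstance, hd.invariant_transitionKernel hlam0 hlam1 hp0 hp1 hX t,
      fun s B hB => ?_⟩
    obtain ⟨Y, hY, hXY⟩ := hNU.exists_adapted (productBernoulli p) lam s
    exact hd.condExp_limitOf hlam0 hlam1 hp0 hp1 hX s t ((noiseFiltration hNU).le s)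
      (hNU.noiseSigma_le_comap s) hY hXY hB
  · filter_upwards [hG, (measurePreserving_snd (μ := productBernoulli p)
      (ν := P)).quasiMeasurePreserving.ae (hNU.ae_mark_ne lam)] with w hw hu
    exact satisfiesSDE_limitProcess (hreg w) hu hA hw
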